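/- **Setting.** A *looped neural network* is a feedforward network $f_\theta:\mathbb R^n\to\mathbb R^n$, $n\ge 3$, with any number $L\ge 1$ of affine layers (weights and biases, arbitrary hidden widths) and ReLU between consecutive layers. Here $\theta=(\theta_1,\dots,\theta_d)$ lists all weights and biases; $L$, the widths, $n$ and $d$ belong to the network and are not bounded in advance. It is run from $x_0=0$ by $x_{t+1}=f_\theta(x_t)$. At each iteration $t\ge 1$: if the first coordinate of $x_t$ (halt) is positive, it halts; otherwise, if the second coordinate (emit) is positive, it appends the bit $\mathbf 1[(x_t)_3>0]$ to its output. It *outputs* $s\in\{0,1\}^*$ if it halts and the bits appended until then form $s$. For reals $0<\delta\le M$ let $\Theta_{\delta,M}$ be the set of parameter vectors (of any finite length) with all entries in $\delta\mathbb Z\cap[-M,M]$. Let $\|\theta\|_0$ be the number of non-zero entries of $\theta$, let $\|\theta\|_p=(\sum_i|\theta_i|^p)^{1/p}$, and let $$\mathcal N_p(s)=\inf\{\|\theta\|_p:\ \theta\in\Theta_{\delta,M},\ \theta\text{ outputs }s\},\qquad \inf\emptyset=\infty .$$ Let $U$ be a universal self-delimiting machine: a partial recursive function on $\{0,1\}^*$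 with prefix-free domain such that for every partial recursive function $V$ on $\{0,1\}^*$ with prefix-free domain there is a string $q$ with $U(qw)=V(w)$ for all $w$ (both sides being undefined at the same $w$). Let $K(s)=\min\{|w|: U(w)=s\}$. **Proposition ($L_p$ sandwich).** Let $0<\delta\le M$ be real numbers and $U$ a universal self-delimiting machine. There are constants $c_U,c_d\ge 0$, depending only on $U$, $\delta$ and $M$, such that for every real $p\ge 1$: 1. $\delta^p\|\theta\|_0\le\|\theta\|_p^p\le M^p\|\theta\|_0$ for every looped network with $\theta\in\Theta_{\delta,M}$. 2. For every $s\in\{0,1\}^*$, $\mathcal N_p(s)<\infty$ and $$\mathcal N_p(s)^p\le M^p\,(K(s)+c_U).$$ 3. If moreover $\delta$ is a computable real number, then for every $s\in\{0,1\}^*$ $$K(s)\le\frac{c_d}{\delta^p}\,\mathcal N_p(s)^p\,\log_2\!\Big(\frac{\mathcal N_p(s)^p}{\delta^p}\Big)+c_d .$$ -/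

import Mathlib

open scoped ENNReal

namespace LoopedNet

/-! ### Prefix Kolmogorov complexity -/

/-- A set of binary strings is prefix-free: no element is a proper prefix of another one. -/
def PrefixFree (A : Set (List Bool)) : Prop :=
  ∀ p ∈ A, ∀ q ∈ A, p <+: q → p = q

/-- A self-delimiting machine: a partial recursive function on binary strings whose
halting set is prefix-free. -/
structure IsPrefixMachine (V : List Bool →. List Bool) : Prop where
  partrec : Partrec V
  prefixFree : PrefixFree V.Dom

/-- A universal self-delimiting machine: it simulates every self-delimiting machine `V`,
the program of `V` being preceded by a fixed string that names `V`. -/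
structure IsUniversal (U : List Bool →. List Bool) : Prop where
  isPrefixMachine : IsPrefixMachine U
  simulates : ∀ V : List Bool →. List Bool, IsPrefixMachine V →
    ∃ q : List Bool, ∀ p : List Bool, U (q ++ p) = V p

/-- `K(s)`: the length of a shortest program on which `U` halts with output `s`. -/
noncomputable def kolmogorov (U : List Bool →. List Bool) (s : List Bool) : ℕ :=
  sInf {k | ∃ p : List Bool, p.length = k ∧ s ∈ U p}

/-- Over a universal machine every string has a program, so that the infimum that defines
`kolmogorov` is a minimum over a nonempty set. -/
theorem IsUniversal.exists_program {U : List Bool →. List Bool} (hU : IsUniversal U)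
    (s : List Bool) : ∃ p : List Bool, s ∈ U p := by
  let V : List Bool →. List Bool := fun p => bif p.isEmpty then Part.some s else Part.none
  have hdom : ∀ p ∈ V.Dom, p = [] := by
    intro p hp
    rcases p with _ | ⟨a, p⟩
    · rfl
    · exact hp.elim
  have hV : IsPrefixMachine V := by
    refine ⟨?_, ?_⟩
    · refine Partrec.cond ?_ (Computable.const s).partrec Partrec.none
      have h : Primrec fun p : List Bool => decide (p.length = 0) :=
        (Primrec.eq.comp Primrec.list_length (Primrec.const 0)).decide
      refine h.to_comp.of_eq fun p => ?_
      cases p <;> simp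
    · intro p hp q hq _
      rw [hdom p hp, hdom q hq]
  obtain ⟨q, hq⟩ := hU.simulates V hV
  refine ⟨q ++ [], ?_⟩
  rw [hq]
  exact Part.mem_some s

/-! ### Feedforward ReLU networks -/

/-- Feedforward networks `ℝ^m → ℝ^k` with any positive number of affine layers (weights and
biases) of arbitrary widths, ReLU being applied between consecutive layers. The value holds
the parameters of the network. -/
inductive FFNet : ℕ → ℕ → Type
  | last {m k : ℕ} (W : Matrix (Fin k) (Fin m) ℝ) (b : Fin k → ℝ) : FFNet m k
  | cons {m l k : ℕ} (W : Matrix (Fin l) (Fin m) ℝ) (b : Fin l → ℝ) (rest : FFNet l k) :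
      FFNet m k

/-- The function computed by a feedforward network. -/
def FFNet.eval : {m k : ℕ} → FFNet m k → (Fin m → ℝ) → (Fin k → ℝ)
  | _, _, .last W b, x => W.mulVec x + b
  | _, _, .cons W b rest, x => rest.eval fun i => max ((W.mulVec x + b) i) 0

/-- The list of the parameters of one affine layer: all weights and all biases. -/
def layerParams {m k : ℕ} (W : Matrix (Fin k) (Fin m) ℝ) (b : Fin k → ℝ) : List ℝ :=
  (List.ofFn fun i => List.ofFn (W i)).flatten ++ List.ofFn b

/-- The parameter vector `θ = (θ_1, …, θ_d)` of a feedforward network. -/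
def FFNet.params : {m k : ℕ} → FFNet m k → List ℝ
  | _, _, .last W b => layerParams W b
  | _, _, .cons W b rest => layerParams W b ++ rest.params

/-! ### Looped networks -/

/-- A looped network: a feedforward block `f_θ : ℝ^n → ℝ^n` whose state has (at least) the
three designated coordinates halt, emit and bit. -/
structure LNN where
  n : ℕ
  three_le : 3 ≤ n
  block : FFNet n n

namespace LNN

variable (N : LNN)

/-- The halt channel, the first coordinate. -/
def haltCh : Fin N.n := ⟨0, by have := N.three_le; omega⟩

/-- The emit channel, the second coordinate. -/
def emitCh : Fin N.n := ⟨1, by have := N.three_le; omega⟩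

/-- The bit channel, the third coordinate. -/
def bitCh : Fin N.n := ⟨2, by have := N.three_le; omega⟩

/-- The state `x_t`: `x_0 = 0` and `x_{t+1} = f_θ(x_t)`. -/
def state : ℕ → Fin N.n → ℝ
  | 0 => 0
  | t + 1 => N.block.eval (state t)

open Classical in
/-- The bits appended to the output at the iterations `1, …, t`, in order, if none of these
iterations halts. -/
noncomputable def emitted : ℕ → List Bool
  | 0 => []
  | t + 1 => emitted t ++
      if 0 < N.state (t + 1) N.emitCh then [decide (0 < N.state (t + 1) N.bitCh)] else []

/-- The network outputs `s`: the first iteration `τ ≥ 1` at which the halt channel is positive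
exists (`τ = t + 1`), and the bits appended before it form `s`. -/
def Outputs (s : List Bool) : Prop :=
  ∃ t : ℕ, 0 < N.state (t + 1) N.haltCh ∧
    (∀ i < t, ¬ 0 < N.state (i + 1) N.haltCh) ∧ N.emitted t = s

/-- `θ ∈ Θ_{δ,M}`: all parameters lie in `δℤ ∩ [-M, M]`. -/
def FixedPrecision (δ M : ℝ) : Prop :=
  ∀ a ∈ N.block.params, (∃ z : ℤ, a = δ * z) ∧ |a| ≤ M

open Classical in
/-- `‖θ‖₀`: the number of non-zero parameters. -/
noncomputable def zeroNorm : ℕ := N.block.params.countP fun a => a ≠ 0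

/-- `‖θ‖_p = (∑ |θ_i|^p)^(1/p)`. -/
noncomputable def lpNorm (p : ℝ) : ℝ :=
  ((N.block.params.map fun a => |a| ^ p).sum) ^ (1 / p)

end LNN

/-- `𝒩_p(s)`: the infimum of `‖θ‖_p` over all looped networks with parameters in `Θ_{δ,M}` that
output `s`; it is `∞` if there is no such network. -/
noncomputable def minLpNorm (δ M p : ℝ) (s : List Bool) : ℝ≥0∞ :=
  ⨅ (N : LNN) (_ : N.FixedPrecision δ M) (_ : N.Outputs s), ENNReal.ofReal (N.lpNorm p)

/-- `x` is a computable real number: some algorithm produces, on input `k`, an integer `a` with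
`|x - a / 2^k| ≤ 1 / 2^k`. -/
def IsComputableReal (x : ℝ) : Prop :=
  ∃ f : ℕ → ℤ, Computable f ∧ ∀ k : ℕ, |x - f k / 2 ^ k| ≤ 1 / 2 ^ k

end LoopedNet

/-!
On the grid `δℤ ∩ [-M, M]` a nonzero parameter has absolute value between `δ` and `M`, so `‖θ‖_p^p`
is `‖θ‖₀` up to the factors `δ^p` and `M^p`, and it suffices to compare `K(s)` with the least number
of nonzero parameters of a network that outputs `s`.

Lower bound: a network with `k` nonzero parameters `δz` becomes a straight-line program of `O(k)`
instructions that add `±δ` times a source to a variable, since each `|z| ≤ M / δ` is bounded. Only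
`O(k)` variables occur, so `O(k log k)` bits describe the program. For computable `δ` the
description can be decoded and run: the values of the variables are integer polynomials in `δ`, and
the sign of such a polynomial is computable, because the polynomials vanishing at `δ` are the
multiples of one fixed polynomial (or only `0`), while a nonzero value is detected by approximation.

Upper bound: a machine computing `U` is a finite multi-stack machine, and a network of constant size
simulates it, a stack being the fraction whose base `B` digits are its symbols. All weights are `±δ`
or `0`, larger integer weights being obtained by copies of neurons; the four layers thus scale the
state by `δ ^ 4`, and only positive multiples matter, so all coordinates are measured in a unit that
is a coordinate itself. A program `w` is loaded from a tape on which one active cell moves. A cell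
holds five symbols and costs five weights, four for passing the activity through the layers and one
for reading the cell, so `|w| + O(1)` nonzero parameters suffice.
-/

namespace LoopedNet

/-! ### Computability -/

section Computability

variable {α β σ : Type*} [Primcodable α] [Primcodable β] [Primcodable σ]

lemma primrec₂_nat_pow : Primrec₂ ((· ^ ·) : ℕ → ℕ → ℕ) :=
  Primrec₂.unpaired'.1 Nat.Primrec.pow

lemma primrec_list_sum : Primrec (List.sum : List ℕ → ℕ) :=
  (Primrec.list_foldr Primrec.id (Primrec.const 0)
    (Primrec.nat_add.comp (Primrec.fst.comp Primrec.snd) (Primrec.snd.comp Primrec.snd)).to₂).of_eq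
    fun l => by rw [List.sum_eq_foldr, id]

lemma primrec₂_list_count [DecidableEq α] : Primrec₂ (List.count : α → List α → ℕ) := by
  have hfilter : Primrec₂ fun (a : α) (l : List α) => l.filter fun b => b = a :=
    (PrimrecRel.listFilter Primrec.eq).swap
  refine (Primrec.list_length.comp₂ hfilter).of_eq fun a l => ?_
  rw [List.count_eq_length_filter]
  rfl

lemma primrec₂_list_lookup [DecidableEq α] :
    Primrec₂ (List.lookup : α → List (α × β) → Option β) := by
  have hentry : Primrec fun q : (α × List (α × β)) × ((α × β) × Option β) => q.2.1 :=
    Primrec.fst.comp Primrec.snd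
  have hstep : Primrec₂ fun (p : α × List (α × β)) (q : (α × β) × Option β) =>
      bif p.1 == q.1.1 then some q.1.2 else q.2 :=
    Primrec.cond
      (Primrec.beq.comp (Primrec.fst.comp Primrec.fst) (Primrec.fst.comp hentry))
      (Primrec.option_some.comp (Primrec.snd.comp hentry)) (Primrec.snd.comp Primrec.snd)
  refine (Primrec.list_foldr Primrec.snd (Primrec.const none) hstep).of_eq fun p => ?_
  induction p.2 with
  | nil => rfl
  | cons x l ih =>
    rw [List.foldr_cons, ih, List.lookup]
    cases p.1 == x.1 <;> rfl

lemma primrecRel_list_perm : PrimrecRel (List.Perm : List α → List α → Prop) := by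
  classical
  have hcount : PrimrecRel fun (a : α) (p : List α × List α) => p.1.count a = p.2.count a :=
    Primrec.eq.comp₂
      (primrec₂_list_count.comp₂ Primrec₂.left (Primrec.fst.comp₂ Primrec₂.right))
      (primrec₂_list_count.comp₂ Primrec₂.left (Primrec.snd.comp₂ Primrec₂.right))
  have happend : Primrec fun p : List α × List α => p.1 ++ p.2 :=
    Primrec.list_append.comp Primrec.fst Primrec.snd
  refine (hcount.forall_mem_list.comp happend Primrec.id).of_eq fun p => ?_
  rw [List.perm_iff_count]
  refine ⟨fun h a => ?_, fun h a _ => h a⟩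
  by_cases ha : a ∈ p.1 ++ p.2
  · exact h a ha
  · rw [List.mem_append, not_or] at ha
    rw [List.count_eq_zero_of_not_mem ha.1, List.count_eq_zero_of_not_mem ha.2]

lemma computable_int_toNat : Computable Int.toNat := by
  refine Primrec.to_comp <| (Primrec.cond (Primrec.nat_bodd.comp Primrec.encode)
    (Primrec.const 0) (Primrec.nat_div2.comp Primrec.encode)).of_eq fun z => ?_
  -- `ℤ` is encoded by `n ↦ 2 * n` and `-(n + 1) ↦ 2 * n + 1`.
  cases z with
  | ofNat n =>
    rw [show Encodable.encode (Int.ofNat n) = 2 * n from rfl]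
    simp
  | negSucc n =>
    rw [show Encodable.encode (Int.negSucc n) = 2 * n + 1 from rfl]
    simp

lemma computable_list_foldl {f : α → List β} {g : α → σ} {h : α → σ × β → σ}
    (hf : Computable f) (hg : Computable g) (hh : Computable₂ h) :
    Computable fun a => (f a).foldl (fun s b => h a (s, b)) (g a) := by
  let step (a : α) (p : ℕ × σ) : σ := ((f a)[p.1]?).casesOn p.2 fun b => h a (p.2, b)
  have hstep : Computable₂ step := by
    have hget : Computable fun q : α × ℕ × σ => (f q.1)[q.2.1]? :=
      Computable.list_getElem?.comp (hf.comp Computable.fst) (Computable.fst.comp Computable.snd)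
    have hnext : Computable fun q : (α × ℕ × σ) × β => h q.1.1 (q.1.2.2, q.2) :=
      hh.comp (Computable.fst.comp Computable.fst)
        (Computable.pair (Computable.snd.comp (Computable.snd.comp Computable.fst))
          Computable.snd)
    exact Computable.option_casesOn hget (Computable.snd.comp Computable.snd) hnext.to₂
  refine (Computable.nat_rec (Computable.list_length.comp hf) hg hstep).of_eq fun a => ?_
  have htake : ∀ n ≤ (f a).length, (Nat.rec (g a) (fun i s => step a (i, s)) n : σ) =
      ((f a).take n).foldl (fun s b => h a (s, b)) (g a) := by
    intro n hn
    induction n with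
    | zero => rfl
    | succ n ih =>
      have hn' : n < (f a).length := hn
      rw [List.take_add_one, List.foldl_append, ← ih hn'.le, List.getElem?_eq_getElem hn']
      simp only [step, List.getElem?_eq_getElem hn']
      rfl
  rw [htake _ le_rfl, List.take_length]

lemma rePred_comp {p : β → Prop} (hp : REPred p) {f : α → β} (hf : Computable f) :
    REPred fun a => p (f a) :=
  Partrec.comp hp hf

lemma rePred_or {p q : α → Prop} (hp : REPred p) (hq : REPred q) :
    REPred fun a => p a ∨ q a := by
  obtain ⟨k, hk, hdom⟩ := Partrec.merge' hp hq
  refine hk.dom_re.of_eq fun a => ?_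
  rw [(hdom a).2]
  simp only [Part.assert, Part.some_dom, exists_prop, and_true]

theorem exists_partrec_choice {R : α → β → Bool} (hR : Computable₂ R) :
    ∃ g : α →. β, Partrec g ∧ (∀ a, (g a).Dom ↔ ∃ b, R a b) ∧ ∀ a, ∀ b ∈ g a, R a b := by
  let test (a : α) (n : ℕ) : Option β :=
    (Encodable.decode n).bind fun b => bif R a b then some b else none
  have htest : Computable₂ test := by
    have hR' : Computable fun p : (α × ℕ) × β => R p.1.1 p.2 :=
      hR.comp (Computable.fst.comp Computable.fst) Computable.snd
    have hdecode : Computable fun p : α × ℕ => (Encodable.decode p.2 : Option β) :=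
      Computable.decode.comp Computable.snd
    exact Computable.option_bind hdecode
      (Computable.cond hR' (Computable.option_some.comp Computable.snd) (Computable.const none))
  have mem_test {a n b} : b ∈ test a n ↔ Encodable.decode n = some b ∧ R a b := by
    simp only [test, Option.mem_def, Option.bind_eq_some_iff]
    constructor
    · rintro ⟨b', hb', h⟩
      cases hR' : R a b' <;> simp_all
    · rintro ⟨hb, hR'⟩
      exact ⟨b, hb, by rw [hR', cond_true]⟩
  refine ⟨_, Partrec.rfindOpt htest, fun a => ?_, fun a b hb => ?_⟩
  · rw [Nat.rfindOpt_dom]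
    exact ⟨fun ⟨n, b, hb⟩ => ⟨b, (mem_test.1 hb).2⟩,
      fun ⟨b, hb⟩ => ⟨Encodable.encode b, b, mem_test.2 ⟨Encodable.encodek b, hb⟩⟩⟩
  · obtain ⟨n, hn⟩ := Nat.rfindOpt_spec hb
    exact (mem_test.1 hn).2

lemma rePred_exists {R : α → β → Bool} (hR : Computable₂ R) : REPred fun a => ∃ b, R a b := by
  obtain ⟨g, hg, hdom, -⟩ := exists_partrec_choice hR
  exact hg.dom_re.of_eq hdom

lemma exists_partrec_inverse {f : α → β} (hf : Computable f) (hinj : Function.Injective f) :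
    ∃ g : β →. α, Partrec g ∧ ∀ b a, a ∈ g b ↔ f a = b := by
  classical
  have heq : Computable₂ fun (b : β) (a : α) => decide (f a = b) :=
    Primrec.eq.decide.to_comp.comp (hf.comp Computable.snd) Computable.fst
  obtain ⟨g, hg, hdom, hmem⟩ := exists_partrec_choice heq
  refine ⟨g, hg, fun b a => ⟨fun h => of_decide_eq_true (hmem b a h), fun h => ?_⟩⟩
  obtain ⟨a', ha'⟩ := Part.dom_iff_mem.1 ((hdom b).2 ⟨a, decide_eq_true h⟩)
  rwa [← hinj ((of_decide_eq_true (hmem b a' ha')).trans h.symm)]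

end Computability

/-! ### The sign of an integer polynomial at a computable real number -/

section ExpSum

open Polynomial

variable {R S : Type*}

/-- The polynomial expression `∑ x ^ e` with exponents `e` from a list. -/
def expSum [Semiring R] (x : R) (l : List ℕ) : R :=
  (l.map (x ^ ·)).sum

section Semiring

variable [Semiring R] [Semiring S] (x : R)

@[simp] lemma expSum_nil : expSum x [] = 0 := rfl

@[simp] lemma expSum_cons (e : ℕ) (l : List ℕ) : expSum x (e :: l) = x ^ e + expSum x l := by
  simp only [expSum, List.map_cons, List.sum_cons]

@[simp] lemma expSum_append (l l' : List ℕ) : expSum x (l ++ l') = expSum x l + expSum x l' := by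
  simp only [expSum, List.map_append, List.sum_append]

lemma map_expSum (f : R →+* S) (l : List ℕ) : f (expSum x l) = expSum (f x) l := by
  simp only [expSum, map_list_sum, List.map_map, Function.comp_def, map_pow]

lemma expSum_map_add (d : ℕ) (l : List ℕ) : expSum x (l.map (d + ·)) = x ^ d * expSum x l := by
  simp only [expSum, List.map_map, Function.comp_def, pow_add, List.sum_map_mul_left]

lemma expSum_product (l l' : List ℕ) :
    expSum x (l.flatMap fun d => l'.map (d + ·)) = expSum x l * expSum x l' := by
  induction l with
  | nil => rw [List.flatMap_nil, expSum_nil, zero_mul]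
  | cons d l ih =>
    rw [List.flatMap_cons, expSum_append, expSum_map_add, ih, expSum_cons, add_mul]

end Semiring

lemma coeff_expSum_X [Semiring R] (l : List ℕ) (e : ℕ) :
    (expSum (X : R[X]) l).coeff e = l.count e := by
  induction l with
  | nil => simp
  | cons d l ih =>
    rw [expSum_cons, coeff_add, ih, coeff_X_pow, List.count_cons, Nat.cast_add, add_comm]
    simp only [beq_iff_eq, eq_comm (a := e), Nat.cast_ite, Nat.cast_one, Nat.cast_zero]

/-- Integer polynomials for computations: `(l, l')` stands for `∑_{e ∈ l} X ^ e` minus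
`∑_{e ∈ l'} X ^ e`. The negative terms are kept apart because the primitive recursiveness of
integer arithmetic is not available. -/
abbrev ExpPair := List ℕ × List ℕ

namespace ExpPair

/-- The value of an integer polynomial at an element of a ring. -/
def eval [Ring R] (q : ExpPair) (x : R) : R := expSum x q.1 - expSum x q.2

/-- The sum of two integer polynomials. -/
def add (q r : ExpPair) : ExpPair := (q.1 ++ r.1, q.2 ++ r.2)

/-- The product of two integer polynomials. -/
def mul (q r : ExpPair) : ExpPair :=
  let prod (l l' : List ℕ) := l.flatMap fun d => l'.map (d + ·)
  (prod q.1 r.1 ++ prod q.2 r.2, prod q.1 r.2 ++ prod q.2 r.1)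

section Ring

variable [CommRing R] [CommRing S] (q r : ExpPair) (x : R)

@[simp] lemma eval_swap : eval q.swap x = -eval q x := (neg_sub _ _).symm

@[simp] lemma eval_add : (add q r).eval x = q.eval x + r.eval x := by
  simp only [eval, add, expSum_append]
  ring

@[simp] lemma eval_mul : (mul q r).eval x = q.eval x * r.eval x := by
  simp only [eval, mul, expSum_append, expSum_product]
  ring

lemma map_eval (f : R →+* S) : f (q.eval x) = q.eval (f x) := by
  simp only [eval, map_sub, map_expSum]

lemma aeval_eval_X [Algebra ℤ R] : aeval x (q.eval (X : ℤ[X])) = q.eval x := by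
  exact (q.map_eval X (aeval x : ℤ[X] →ₐ[ℤ] R).toRingHom).trans (congrArg q.eval (aeval_X x))

end Ring

lemma exists_eval_X_eq (P : ℤ[X]) : ∃ q : ExpPair, q.eval X = P := by
  induction P using Polynomial.induction_on' with
  | add P Q hP hQ =>
    obtain ⟨q, rfl⟩ := hP
    obtain ⟨r, rfl⟩ := hQ
    exact ⟨q.add r, eval_add q r X⟩
  | monomial n a =>
    refine ⟨(List.replicate a.toNat n, List.replicate (-a).toNat n), ?_⟩
    simp only [eval, expSum, List.map_replicate, List.sum_replicate, nsmul_eq_mul, ← sub_mul]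
    have ha : (a.toNat - (-a).toNat : ℤ[X]) = C a := by
      exact_mod_cast congrArg (C : ℤ → ℤ[X]) a.toNat_sub_toNat_neg
    rw [ha, C_mul_X_pow_eq_monomial]

lemma eval_X_eq_zero {q : ExpPair} : q.eval (X : ℤ[X]) = 0 ↔ q.1.Perm q.2 := by
  simp only [eval, sub_eq_zero, Polynomial.ext_iff, coeff_expSum_X, Nat.cast_inj,
    List.perm_iff_count]

lemma primrec₂_add : Primrec₂ add :=
  Primrec.pair
    (Primrec.list_append.comp (Primrec.fst.comp Primrec.fst) (Primrec.fst.comp Primrec.snd))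
    (Primrec.list_append.comp (Primrec.snd.comp Primrec.fst) (Primrec.snd.comp Primrec.snd))

lemma primrec₂_mul : Primrec₂ mul := by
  have hprod : Primrec₂ fun l l' : List ℕ => l.flatMap fun d => l'.map (d + ·) :=
    Primrec.list_flatMap Primrec.fst (Primrec.list_map (Primrec.snd.comp Primrec.fst)
      (Primrec.nat_add.comp (Primrec.snd.comp Primrec.fst) Primrec.snd))
  have h₁ : Primrec fun p : ExpPair × ExpPair => p.1.1 := Primrec.fst.comp Primrec.fst
  have h₂ : Primrec fun p : ExpPair × ExpPair => p.1.2 := Primrec.snd.comp Primrec.fst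
  have h₃ : Primrec fun p : ExpPair × ExpPair => p.2.1 := Primrec.fst.comp Primrec.snd
  have h₄ : Primrec fun p : ExpPair × ExpPair => p.2.2 := Primrec.snd.comp Primrec.snd
  exact Primrec.pair (Primrec.list_append.comp (hprod.comp h₁ h₃) (hprod.comp h₂ h₄))
    (Primrec.list_append.comp (hprod.comp h₁ h₄) (hprod.comp h₂ h₃))

end ExpPair

end ExpSum

section Zero

open Polynomial

lemma exists_dvd_map_iff_dvd (g : ℚ[X]) :
    ∃ m : ℤ[X], ∀ P : ℤ[X], g ∣ P.map (Int.castRingHom ℚ) ↔ m ∣ P := by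
  rcases eq_or_ne g 0 with rfl | hg
  · refine ⟨0, fun P => ?_⟩
    rw [zero_dvd_iff, zero_dvd_iff, Polynomial.map_eq_zero_iff Int.cast_injective]
  obtain ⟨b, hb, hmap⟩ := IsLocalization.integerNormalization_spec (nonZeroDivisors ℤ) g
  set G := IsLocalization.integerNormalization (nonZeroDivisors ℤ) g
  have hb0 : (b : ℚ) ≠ 0 := Int.cast_ne_zero.2 (nonZeroDivisors.ne_zero hb)
  have hG : G.map (Int.castRingHom ℚ) = C (b : ℚ) * g := by
    rw [← smul_eq_C_mul, Int.cast_smul_eq_zsmul]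
    exact hmap
  have hcontent : (G.content : ℚ) ≠ 0 := by
    rw [Int.cast_ne_zero, Ne, content_eq_zero_iff]
    rintro hG0
    rw [hG0, Polynomial.map_zero, zero_eq_mul, C_eq_zero] at hG
    exact hG.elim hb0 hg
  have hassoc : G.primPart.map (Int.castRingHom ℚ) = C ((b : ℚ) / G.content) * g := by
    rw [div_eq_inv_mul, C_mul, mul_assoc, ← hG]
    conv_rhs => enter [2, 2]; rw [G.eq_C_content_mul_primPart]
    rw [Polynomial.map_mul, map_C, ← mul_assoc, ← C_mul, eq_intCast, inv_mul_cancel₀ hcontent,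
      C_1, one_mul]
  refine ⟨G.primPart, fun P => ?_⟩
  rw [IsPrimitive.Int.dvd_iff_map_cast_dvd_map_cast _ _ G.isPrimitive_primPart, hassoc]
  exact ((isUnit_C.2 (div_ne_zero hb0 hcontent).isUnit).mul_left_dvd).symm

lemma rePred_eval_eq_zero (x : ℝ) : REPred fun q : ExpPair => q.eval x = 0 := by
  obtain ⟨m, hm⟩ := exists_dvd_map_iff_dvd (minpoly ℚ x)
  obtain ⟨m, rfl⟩ := ExpPair.exists_eval_X_eq m
  have hdiff : Primrec₂ fun q r : ExpPair => q.add (m.mul r).swap :=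
    ExpPair.primrec₂_add.comp₂ Primrec₂.left
      (Primrec.pair (Primrec.snd.comp₂ (ExpPair.primrec₂_mul.comp₂ (.const m) Primrec₂.right))
        (Primrec.fst.comp₂ (ExpPair.primrec₂_mul.comp₂ (.const m) Primrec₂.right)))
  have hperm : Primrec₂ fun q r : ExpPair =>
      decide ((q.add (m.mul r).swap).1.Perm (q.add (m.mul r).swap).2) :=
    (primrecRel_list_perm.comp₂ (Primrec.fst.comp₂ hdiff) (Primrec.snd.comp₂ hdiff)).decide
  refine (rePred_exists hperm.to_comp).of_eq fun q => ?_
  simp only [decide_eq_true_eq, ← ExpPair.eval_X_eq_zero, ExpPair.eval_add, ExpPair.eval_swap,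
    ExpPair.eval_mul, ← sub_eq_add_neg, sub_eq_zero]
  rw [← q.aeval_eval_X x, ← aeval_map_algebraMap ℚ x, ← minpoly.dvd_iff, algebraMap_int_eq, hm]
  constructor
  · rintro ⟨r, hr⟩
    exact ⟨_, hr⟩
  · rintro ⟨R, hR⟩
    obtain ⟨r, rfl⟩ := ExpPair.exists_eval_X_eq R
    exact ⟨r, hR⟩

end Zero

section Sign

open Filter Topology

/-- `D ^ E * expSum (x / D) l`, which is a natural number if all exponents are at most `E`. -/
def scaledExpSum (x D E : ℕ) (l : List ℕ) : ℕ :=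
  (l.map fun e => x ^ e * D ^ (E - e)).sum

lemma cast_scaledExpSum {D : ℕ} (hD : D ≠ 0) (x : ℕ) {E : ℕ} {l : List ℕ} (hE : ∀ e ∈ l, e ≤ E) :
    (scaledExpSum x D E l : ℝ) = D ^ E * expSum (x / D : ℝ) l := by
  have hterm : ∀ e ∈ l, ((x ^ e * D ^ (E - e) : ℕ) : ℝ) = D ^ E * (x / D : ℝ) ^ e := by
    intro e he
    have hpow : (D : ℝ) ^ e ≠ 0 := pow_ne_zero e (Nat.cast_ne_zero.2 hD)
    rw [← Nat.sub_add_cancel (hE e he), Nat.add_sub_cancel, div_pow, pow_add, Nat.cast_mul,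
      Nat.cast_pow, Nat.cast_pow, mul_assoc, mul_div_cancel₀ _ hpow, mul_comm]
  rw [scaledExpSum, expSum, ← List.sum_map_mul_left, Nat.cast_list_sum, List.map_map]
  exact congrArg List.sum (List.map_congr_left hterm)

lemma expSum_le_expSum {x y : ℝ} (hx : 0 ≤ x) (hxy : x ≤ y) (l : List ℕ) :
    expSum x l ≤ expSum y l :=
  List.sum_le_sum fun e _ => pow_le_pow_left₀ hx hxy e

lemma continuous_expSum (l : List ℕ) : Continuous fun x : ℝ => expSum x l :=
  continuous_list_sum l fun e _ => continuous_pow e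

lemma IsComputableReal.exists_nat {x : ℝ} (hx : IsComputableReal x) (hx0 : 0 ≤ x) :
    ∃ a : ℕ → ℕ, Computable a ∧ ∀ k, (a k : ℝ) / 2 ^ k ≤ x ∧ x ≤ ((a k + 2 : ℕ) : ℝ) / 2 ^ k := by
  obtain ⟨f, hf, happrox⟩ := hx
  refine ⟨fun k => (f k).toNat - 1,
    (Primrec.pred.to_comp.comp (computable_int_toNat.comp hf)).of_eq fun k => rfl, fun k => ?_⟩
  have hpow : (0 : ℝ) < 2 ^ k := by positivity
  have hbound := abs_le.1 (happrox k)
  rw [div_le_iff₀ hpow, le_div_iff₀ hpow]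
  have hlo : (f k : ℝ) - 1 ≤ x * 2 ^ k := by
    have := hbound.1
    field_simp at this
    linarith
  have hhi : x * 2 ^ k ≤ f k + 1 := by
    have := hbound.2
    field_simp at this
    linarith
  dsimp only
  constructor
  · rcases le_total (f k) 1 with h | h
    · rw [show (f k).toNat - 1 = 0 by omega, Nat.cast_zero]
      positivity
    · refine le_trans (le_of_eq ?_) hlo
      rw [← Int.cast_natCast, show (((f k).toNat - 1 : ℕ) : ℤ) = f k - 1 by omega]
      push_cast
      rfl
  · refine hhi.trans ?_
    rw [← Int.cast_natCast, ← Int.cast_one, ← Int.cast_add, Int.cast_le]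
    omega

lemma ExpPair.eval_pos_iff_exists_expSum_lt {x : ℝ} {lo hi : ℕ → ℝ}
    (hlo : ∀ k, 0 ≤ lo k ∧ lo k ≤ x) (hhi : ∀ k, x ≤ hi k)
    (hlim_lo : Tendsto lo atTop (𝓝 x)) (hlim_hi : Tendsto hi atTop (𝓝 x))
    (q : ExpPair) : 0 < q.eval x ↔ ∃ k, expSum (hi k) q.2 < expSum (lo k) q.1 := by
  constructor
  · intro h
    exact (((continuous_expSum q.2).tendsto x).comp hlim_hi).eventually_lt
      (((continuous_expSum q.1).tendsto x).comp hlim_lo) (sub_pos.1 h) |>.exists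
  · rintro ⟨k, hk⟩
    refine sub_pos.2 ?_
    calc expSum x q.2 ≤ expSum (hi k) q.2 :=
          expSum_le_expSum ((hlo k).1.trans (hlo k).2) (hhi k) _
      _ < expSum (lo k) q.1 := hk
      _ ≤ expSum x q.1 := expSum_le_expSum (hlo k).1 (hlo k).2 _

lemma ExpPair.eval_pos_iff_exists_scaledExpSum_lt {x : ℝ} {a : ℕ → ℕ}
    (hax : ∀ k, (a k : ℝ) / 2 ^ k ≤ x ∧ x ≤ ((a k + 2 : ℕ) : ℝ) / 2 ^ k) (q : ExpPair) :
    0 < q.eval x ↔ ∃ k, scaledExpSum (a k + 2) (2 ^ k) (q.1 ++ q.2).sum q.2 <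
      scaledExpSum (a k) (2 ^ k) (q.1 ++ q.2).sum q.1 := by
  have hlo : ∀ k, 0 ≤ (a k / 2 ^ k : ℝ) ∧ (a k / 2 ^ k : ℝ) ≤ x := fun k =>
    ⟨by positivity, (hax k).1⟩
  have hgap : Tendsto (fun k : ℕ => 2 * (1 / 2 : ℝ) ^ k) atTop (𝓝 0) := by
    simpa only [mul_zero] using
      (tendsto_pow_atTop_nhds_zero_of_lt_one one_half_pos.le one_half_lt_one).const_mul (2 : ℝ)
  have hhi_sub_lo (k : ℕ) : ((a k + 2 : ℕ) : ℝ) / 2 ^ k = a k / 2 ^ k + 2 * (1 / 2) ^ k := by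
    rw [Nat.cast_add, Nat.cast_ofNat, add_div, one_div, inv_pow, ← div_eq_mul_inv]
  rw [eval_pos_iff_exists_expSum_lt hlo (fun k => (hax k).2)]
  · refine exists_congr fun k => ?_
    have hle {l : List ℕ} (hl : l ⊆ q.1 ++ q.2) : ∀ e ∈ l, e ≤ (q.1 ++ q.2).sum := fun e he =>
      List.single_le_sum (fun _ _ => Nat.zero_le _) e (hl he)
    have hD : 2 ^ k ≠ 0 := by positivity
    rw [← Nat.cast_lt (α := ℝ),
      cast_scaledExpSum hD _ (hle (List.subset_append_right _ _)),
      cast_scaledExpSum hD _ (hle (List.subset_append_left _ _)),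
      mul_lt_mul_iff_right₀ (by positivity), Nat.cast_pow, Nat.cast_ofNat]
  · refine tendsto_of_tendsto_of_tendsto_of_le_of_le
      (by simpa only [sub_zero] using hgap.const_sub x) tendsto_const_nhds (fun k => ?_)
      fun k => (hlo k).2
    linarith [(hax k).2, hhi_sub_lo k]
  · refine tendsto_of_tendsto_of_tendsto_of_le_of_le tendsto_const_nhds
      (by simpa only [add_zero] using hgap.const_add x) (fun k => (hax k).2) fun k => ?_
    linarith [(hax k).1, hhi_sub_lo k]

lemma primrec_scaledExpSum :
    Primrec fun p : (ℕ × ℕ × ℕ) × List ℕ => scaledExpSum p.1.1 p.1.2.1 p.1.2.2 p.2 := by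
  have hx : Primrec fun q : ((ℕ × ℕ × ℕ) × List ℕ) × ℕ => q.1.1.1 :=
    Primrec.fst.comp (Primrec.fst.comp Primrec.fst)
  have hDE : Primrec fun q : ((ℕ × ℕ × ℕ) × List ℕ) × ℕ => q.1.1.2 :=
    Primrec.snd.comp (Primrec.fst.comp Primrec.fst)
  exact primrec_list_sum.comp <| Primrec.list_map Primrec.snd <|
    Primrec.nat_mul.comp (primrec₂_nat_pow.comp hx Primrec.snd)
      (primrec₂_nat_pow.comp (Primrec.fst.comp hDE)
        (Primrec.nat_sub.comp (Primrec.snd.comp hDE) Primrec.snd))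

lemma rePred_eval_pos {x : ℝ} (hx : IsComputableReal x) (hx0 : 0 ≤ x) :
    REPred fun q : ExpPair => 0 < q.eval x := by
  obtain ⟨a, ha, hax⟩ := hx.exists_nat hx0
  have hdeg : Primrec fun q : ExpPair => (q.1 ++ q.2).sum :=
    primrec_list_sum.comp (Primrec.list_append.comp Primrec.fst Primrec.snd)
  have hpow : Primrec fun k : ℕ => 2 ^ k := primrec₂_nat_pow.comp (.const 2) .id
  have hscaled {b : ℕ → ℕ} (hb : Computable b) {l : ExpPair → List ℕ} (hl : Computable l) :
      Computable fun p : ExpPair × ℕ =>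
        scaledExpSum (b p.2) (2 ^ p.2) (p.1.1 ++ p.1.2).sum (l p.1) :=
    primrec_scaledExpSum.to_comp.comp (((hb.comp .snd).pair ((hpow.to_comp.comp .snd).pair
      (hdeg.to_comp.comp .fst))).pair (hl.comp .fst))
  have htest : Computable₂ fun (q : ExpPair) (k : ℕ) =>
      decide (scaledExpSum (a k + 2) (2 ^ k) (q.1 ++ q.2).sum q.2 <
        scaledExpSum (a k) (2 ^ k) (q.1 ++ q.2).sum q.1) :=
    Primrec.nat_lt.decide.to_comp.comp
      (hscaled ((Primrec.nat_add.comp .id (.const 2)).to_comp.comp ha) .snd) (hscaled ha .fst)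
  refine (rePred_exists htest).of_eq fun q => ?_
  rw [q.eval_pos_iff_exists_scaledExpSum_lt hax]
  simp only [decide_eq_true_eq]

theorem computablePred_eval_pos {x : ℝ} (hx : IsComputableReal x) (hx0 : 0 ≤ x) :
    ComputablePred fun q : ExpPair => 0 < q.eval x := by
  have hpos := rePred_eval_pos hx hx0
  refine ComputablePred.computable_iff_re_compl_re'.2 ⟨hpos, ?_⟩
  refine (rePred_or (rePred_eval_eq_zero x)
    (rePred_comp hpos (Computable.snd.pair Computable.fst))).of_eq fun q => ?_
  rw [← Prod.swap, ExpPair.eval_swap, neg_pos, not_lt, le_iff_eq_or_lt]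

end Sign

/-! ### Output streams -/

section Stream

/-- The bits `bit i` at the iterations `1 ≤ i ≤ t` at which `emit i` holds, in order. -/
def emittedBits (emit bit : ℕ → Bool) : ℕ → List Bool
  | 0 => []
  | t + 1 => emittedBits emit bit t ++ bif emit (t + 1) then [bit (t + 1)] else []

/-- The bits emitted before the first iteration `t + 1` at which `halt (t + 1)` holds. -/
def streamOutput (halt emit bit : ℕ → Bool) : Part (List Bool) :=
  (Nat.rfind fun t => Part.some (halt (t + 1))).map (emittedBits emit bit)

lemma mem_streamOutput {halt emit bit : ℕ → Bool} {s : List Bool} :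
    s ∈ streamOutput halt emit bit ↔
      ∃ t, halt (t + 1) ∧ (∀ i < t, ¬ halt (i + 1)) ∧ emittedBits emit bit t = s := by
  have hfind (t : ℕ) : (t ∈ Nat.rfind fun t => Part.some (halt (t + 1))) ↔
      halt (t + 1) ∧ ∀ i < t, ¬ halt (i + 1) := by
    refine Nat.mem_rfind.trans ?_
    simp only [Part.mem_some_iff, eq_comm (a := true), eq_comm (a := false),
      Bool.not_eq_true]
  rw [streamOutput, Part.mem_map_iff]
  simp only [hfind, and_assoc]

lemma LNN.emitted_eq_emittedBits (N : LNN) (t : ℕ) :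
    N.emitted t = emittedBits (fun i => decide (0 < N.state i N.emitCh))
      (fun i => decide (0 < N.state i N.bitCh)) t := by
  induction t with
  | zero => rfl
  | succ t ih => rw [emitted, emittedBits, ih, Bool.cond_decide]

lemma LNN.outputs_iff_mem_streamOutput {N : LNN} {s : List Bool} :
    N.Outputs s ↔ s ∈ streamOutput (fun i => decide (0 < N.state i N.haltCh))
      (fun i => decide (0 < N.state i N.emitCh)) fun i => decide (0 < N.state i N.bitCh) := by
  simp only [Outputs, mem_streamOutput, decide_eq_true_eq, N.emitted_eq_emittedBits]

variable {halt emit bit : ℕ → Bool} {s : List Bool}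

lemma emittedBits_succ' (emit bit : ℕ → Bool) (t : ℕ) :
    emittedBits emit bit (t + 1) = (bif emit 1 then [bit 1] else []) ++
      emittedBits (fun i => emit (i + 1)) (fun i => bit (i + 1)) t := by
  induction t with
  | zero => simp only [emittedBits, List.nil_append, List.append_nil]
  | succ t ih => rw [emittedBits, ih, emittedBits, List.append_assoc]

lemma append_mem_streamOutput (hhalt : halt 1 = false)
    (hs : s ∈ streamOutput (fun i => halt (i + 1)) (fun i => emit (i + 1)) fun i => bit (i + 1)) :
    (bif emit 1 then [bit 1] else []) ++ s ∈ streamOutput halt emit bit := by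
  obtain ⟨t, ht, hbefore, rfl⟩ := mem_streamOutput.1 hs
  refine mem_streamOutput.2 ⟨t + 1, ht, fun i hi => ?_, emittedBits_succ' emit bit t⟩
  cases i with
  | zero => exact Bool.eq_false_iff.1 hhalt
  | succ i => exact hbefore i (Nat.lt_of_succ_lt_succ hi)

lemma mem_streamOutput_of_silent (n : ℕ) (hhalt : ∀ i < n, halt (i + 1) = false)
    (hemit : ∀ i < n, emit (i + 1) = false)
    (hs : s ∈ streamOutput (fun i => halt (i + n)) (fun i => emit (i + n)) fun i => bit (i + n)) :
    s ∈ streamOutput halt emit bit := by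
  induction n generalizing halt emit bit with
  | zero => exact hs
  | succ n ih =>
    have htail := ih (halt := fun i => halt (i + 1)) (emit := fun i => emit (i + 1))
      (bit := fun i => bit (i + 1)) (fun i hi => hhalt (i + 1) (Nat.succ_lt_succ hi))
      (fun i hi => hemit (i + 1) (Nat.succ_lt_succ hi)) hs
    have hcons := append_mem_streamOutput (hhalt 0 n.succ_pos) htail
    rwa [hemit 0 n.succ_pos] at hcons

end Stream

/-! ### Straight-line programs over the reals -/

/-- What an instruction of a straight-line program reads: the constant `1` (`none`), the value
of a variable at the end of the previous round (`inl`), or the ReLU of the current value of a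
variable (`inr`). -/
abbrev Source (α : Type*) := Option (α ⊕ α)

/-- An instruction `(d, s, b)` of a straight-line program over a real number `δ`: it adds `δ`
times (minus `δ` times, if `b` is false) the value of the source `s` to the variable `d`. -/
abbrev Instr (α : Type*) := α × Source α × Bool

/-- The sign denoted by a Boolean. -/
def boolSign (b : Bool) : ℝ := bif b then 1 else -1

section Real

variable {α : Type*}

/-- The value of a source, for the values `P` at the end of the previous round and the current
values `V`. -/
noncomputable def sourceValue (P V : α → ℝ) : Source α → ℝ
  | none => 1
  | some (.inl a) => P a
  | some (.inr a) => max (V a) 0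

variable [DecidableEq α]

/-- What an instruction adds to the variables. -/
noncomputable def increment (δ : ℝ) (P V : α → ℝ) (I : Instr α) : α → ℝ :=
  Pi.single I.1 (boolSign I.2.2 * δ * sourceValue P V I.2.1)

/-- The effect of an instruction on the current values `V`. -/
noncomputable def instrStep (δ : ℝ) (P V : α → ℝ) (I : Instr α) : α → ℝ :=
  V + increment δ P V I

/-- The values of the variables after `t` rounds; each round starts from `0` and sees the values
at the end of the previous round through the sources `inl`. -/
noncomputable def progState (δ : ℝ) (prog : List (Instr α)) : ℕ → α → ℝ
  | 0 => 0
  | t + 1 => prog.foldl (instrStep δ (progState δ prog t)) 0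

end Real

section Symbolic

variable {α : Type*} [DecidableEq α]

/-- A symbolic state: an association list of variables and integer polynomials in `δ`, the first
entry of a variable being the valid one and absent variables having the value `0`. -/
abbrev Env (α : Type*) := List (α × ExpPair)

/-- The polynomial stored for a variable. -/
def envGet (E : Env α) (a : α) : ExpPair := (E.lookup a).getD ([], [])

variable (pos : ExpPair → Bool)

/-- The polynomial that denotes the value of a source, where `pos` decides positivity. -/
def symbolicSource (P V : Env α) : Source α → ExpPair
  | none => ([0], [])
  | some (.inl a) => envGet P a
  | some (.inr a) => bif pos (envGet V a) then envGet V a else ([], [])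

/-- The effect of an instruction on a symbolic state. -/
def symbolicStep (P V : Env α) (I : Instr α) : Env α :=
  (I.1, (envGet V I.1).add
    (ExpPair.mul (bif I.2.2 then ([1], []) else ([], [1])) (symbolicSource pos P V I.2.1))) :: V

/-- The symbolic state after `t` rounds. -/
def symbolicState (prog : List (Instr α)) : ℕ → Env α
  | 0 => []
  | t + 1 => prog.foldl (symbolicStep pos (symbolicState prog t)) []

/-- The output of a program that halts, emits and chooses the bits according to the signs of
three of its variables. -/
def progOutput (halt emit bit : α) (prog : List (Instr α)) : Part (List Bool) :=
  let isPos (a : α) (t : ℕ) : Bool := pos (envGet (symbolicState pos prog t) a)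
  streamOutput (isPos halt) (isPos emit) (isPos bit)

variable {pos} {δ : ℝ}

/-- The real values denoted by a symbolic state. -/
noncomputable def envValue (δ : ℝ) (E : Env α) (a : α) : ℝ := (envGet E a).eval δ

lemma envValue_nil : envValue δ ([] : Env α) = 0 := by
  funext a
  simp only [envValue, envGet, List.lookup_nil, Option.getD_none, ExpPair.eval, expSum_nil,
    sub_zero, Pi.zero_apply]

lemma envValue_cons (E : Env α) (a : α) (q : ExpPair) :
    envValue δ ((a, q) :: E) = Function.update (envValue δ E) a (q.eval δ) := by
  funext b
  rw [Function.update_apply, envValue, envGet, List.lookup_cons]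
  split <;> simp_all [envValue, envGet]

lemma eval_symbolicSource (hpos : ∀ q : ExpPair, pos q ↔ 0 < q.eval δ) (P V : Env α)
    (s : Source α) :
    (symbolicSource pos P V s).eval δ = sourceValue (envValue δ P) (envValue δ V) s := by
  match s with
  | none => simp [symbolicSource, sourceValue, ExpPair.eval]
  | some (.inl a) => rfl
  | some (.inr a) =>
    by_cases h : 0 < (envGet V a).eval δ
    · rw [symbolicSource, (hpos _).2 h, cond_true]
      exact (max_eq_left h.le).symm
    · rw [symbolicSource, Bool.eq_false_iff.2 (mt (hpos _).1 h), cond_false]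
      exact (sub_self _).trans (max_eq_right (not_lt.1 h)).symm

lemma envValue_symbolicStep (hpos : ∀ q : ExpPair, pos q ↔ 0 < q.eval δ) (P V : Env α)
    (I : Instr α) :
    envValue δ (symbolicStep pos P V I) = instrStep δ (envValue δ P) (envValue δ V) I := by
  have hsign : ExpPair.eval (bif I.2.2 then ([1], []) else ([], [1])) δ = boolSign I.2.2 * δ := by
    cases I.2.2 <;> simp [ExpPair.eval, boolSign]
  rw [symbolicStep, envValue_cons, ExpPair.eval_add, ExpPair.eval_mul, eval_symbolicSource hpos,
    hsign]
  funext a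
  rw [instrStep, increment, Pi.add_apply, Function.update_apply, Pi.single_apply]
  split_ifs with h
  · rw [h]
    rfl
  · rw [add_zero]

lemma envValue_symbolicState (hpos : ∀ q : ExpPair, pos q ↔ 0 < q.eval δ) (prog : List (Instr α))
    (t : ℕ) : envValue δ (symbolicState pos prog t) = progState δ prog t := by
  induction t with
  | zero => exact envValue_nil
  | succ t ih =>
    rw [symbolicState, progState, ← ih, ← envValue_nil]
    exact (List.foldl_hom _ fun V I => (envValue_symbolicStep hpos _ V I).symm).symm

lemma progOutput_eq_streamOutput (hpos : ∀ q : ExpPair, pos q ↔ 0 < q.eval δ)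
    (halt emit bit : α) (prog : List (Instr α)) :
    progOutput pos halt emit bit prog = streamOutput (fun t => decide (0 < progState δ prog t halt))
      (fun t => decide (0 < progState δ prog t emit))
      fun t => decide (0 < progState δ prog t bit) := by
  have hiff (a : α) (t : ℕ) : pos (envGet (symbolicState pos prog t) a) =
      decide (0 < progState δ prog t a) := by
    rw [Bool.eq_iff_iff, hpos, decide_eq_true_iff, ← envValue_symbolicState hpos]
    rfl
  simp only [progOutput, hiff]

end Symbolic

section Computability

variable {α β : Type*} [DecidableEq α] [Primcodable α] [Primcodable β]

lemma computable₂_emittedBits {emit bit : β → ℕ → Bool} (hemit : Computable₂ emit)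
    (hbit : Computable₂ bit) : Computable₂ fun b t => emittedBits (emit b) (bit b) t := by
  have hsucc : Computable fun q : (β × ℕ) × ℕ × List Bool => q.2.1 + 1 :=
    Computable.succ.comp (.comp .fst .snd)
  have harg : Computable fun q : (β × ℕ) × ℕ × List Bool => q.1.1 := .comp .fst .fst
  have hstep : Computable₂ fun (q : β × ℕ) (r : ℕ × List Bool) =>
      r.2 ++ bif emit q.1 (r.1 + 1) then [bit q.1 (r.1 + 1)] else [] :=
    Computable.list_append.comp (.comp .snd .snd) (.cond (hemit.comp harg hsucc)
      (Computable.list_cons.comp (hbit.comp harg hsucc) (.const [])) (.const []))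
  refine (Computable.nat_rec .snd (.const []) hstep).of_eq fun q => ?_
  induction q.2 with
  | zero => rfl
  | succ t ih => exact congrArg (· ++ _) ih

lemma partrec_streamOutput {halt emit bit : β → ℕ → Bool} (hhalt : Computable₂ halt)
    (hemit : Computable₂ emit) (hbit : Computable₂ bit) :
    Partrec fun b => streamOutput (halt b) (emit b) (bit b) := by
  have hnext : Computable₂ fun b t => halt b (t + 1) :=
    hhalt.comp .fst (Computable.succ.comp .snd)
  exact (Partrec.rfind hnext.partrec₂).map (computable₂_emittedBits hemit hbit)

lemma primrec₂_envGet : Primrec₂ (envGet : Env α → α → ExpPair) :=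
  Primrec.option_getD.comp (primrec₂_list_lookup.comp Primrec.snd Primrec.fst) (.const _)

variable {pos : ExpPair → Bool}

lemma computable_symbolicSource (hpos : Computable pos) {P V : β → Env α} {s : β → Source α}
    (hP : Computable P) (hV : Computable V) (hs : Computable s) :
    Computable fun b => symbolicSource pos (P b) (V b) (s b) := by
  have hget {E : β → Env α} (hE : Computable E) :
      Computable fun q : (β × (α ⊕ α)) × α => envGet (E q.1.1) q.2 :=
    primrec₂_envGet.to_comp.comp (hE.comp (.comp .fst .fst)) .snd
  have hprevious : Computable₂ fun (q : β × (α ⊕ α)) (a : α) => envGet (P q.1) a := hget hP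
  have hrelu : Computable₂ fun (q : β × (α ⊕ α)) (a : α) =>
      bif pos (envGet (V q.1) a) then envGet (V q.1) a else ([], []) :=
    .cond (hpos.comp (hget hV)) (hget hV) (.const ([], []))
  have hvar : Computable₂ fun (b : β) (r : α ⊕ α) => symbolicSource pos (P b) (V b) (some r) :=
    (Computable.sumCasesOn .snd hprevious hrelu).of_eq fun q => by rcases q.2 with _ | _ <;> rfl
  refine (Computable.option_casesOn hs (.const ([0], [])) hvar).of_eq fun b => ?_
  rcases s b with _ | _ <;> rfl

lemma computable_symbolicStep (hpos : Computable pos) {P V : β → Env α} {I : β → Instr α}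
    (hP : Computable P) (hV : Computable V) (hI : Computable I) :
    Computable fun b => symbolicStep pos (P b) (V b) (I b) := by
  have hsource := computable_symbolicSource hpos hP hV (Computable.fst.comp (.comp .snd hI))
  have hsign : Computable fun b : β => (bif (I b).2.2 then ([1], []) else ([], [1]) : ExpPair) :=
    .cond (.comp .snd (.comp .snd hI)) (.const _) (.const _)
  have hold : Computable fun b : β => envGet (V b) (I b).1 :=
    primrec₂_envGet.to_comp.comp hV (.comp .fst hI)
  exact Computable.list_cons.comp (.pair (.comp .fst hI) (ExpPair.primrec₂_add.to_comp.comp hold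
    (ExpPair.primrec₂_mul.to_comp.comp hsign hsource))) hV

lemma computable₂_symbolicState (hpos : Computable pos) :
    Computable₂ (symbolicState pos : List (Instr α) → ℕ → Env α) := by
  have hstep : Computable₂ fun (q : (List (Instr α) × ℕ) × ℕ × Env α) (r : Env α × Instr α) =>
      symbolicStep pos q.2.2 r.1 r.2 :=
    computable_symbolicStep hpos (Computable.snd.comp (Computable.snd.comp .fst))
      (Computable.fst.comp .snd) (Computable.snd.comp .snd)
  have hround : Computable₂ fun (q : List (Instr α) × ℕ) (r : ℕ × Env α) =>
      q.1.foldl (symbolicStep pos r.2) [] :=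
    computable_list_foldl (Computable.fst.comp .fst) (.const []) hstep
  refine (Computable.nat_rec .snd (.const []) hround).of_eq fun q => ?_
  induction q.2 with
  | zero => rfl
  | succ t ih => exact congrArg (fun P => q.1.foldl (symbolicStep pos P) []) ih

theorem partrec_progOutput (hpos : Computable pos) (halt emit bit : α) :
    Partrec fun prog : List (Instr α) => progOutput pos halt emit bit prog := by
  have hisPos (a : α) : Computable₂ fun (prog : List (Instr α)) (t : ℕ) =>
      pos (envGet (symbolicState pos prog t) a) :=
    hpos.comp (primrec₂_envGet.to_comp.comp (computable₂_symbolicState hpos) (.const a))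
  exact partrec_streamOutput (hisPos halt) (hisPos emit) (hisPos bit)

end Computability

/-! ### Prefix codes and prefix complexity -/

section PrefixCode

variable {α β : Type*}

/-- A prefix code: an end marker is never needed to find out where a code word ends. -/
def IsPrefixCode (f : α → List Bool) : Prop :=
  ∀ ⦃a b : α⦄ ⦃r r' : List Bool⦄, f a ++ r = f b ++ r' → a = b ∧ r = r'

/-- The code of pairs by concatenation. -/
def prodCode (f : α → List Bool) (g : β → List Bool) (p : α × β) : List Bool := f p.1 ++ g p.2

/-- The code of a disjoint union, with one tag bit. -/
def sumCode (f : α → List Bool) (g : β → List Bool) : α ⊕ β → List Bool :=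
  Sum.elim (fun a => false :: f a) fun b => true :: g b

/-- The code of `Option α`, with one tag bit. -/
def optionCode (f : α → List Bool) (o : Option α) : List Bool :=
  o.elim [false] fun a => true :: f a

/-- The code of lists, with one tag bit per entry and one at the end. -/
def listCode (f : α → List Bool) (l : List α) : List Bool :=
  l.foldr (fun a r => true :: (f a ++ r)) [false]

lemma isPrefixCode_singleton : IsPrefixCode fun b : Bool => [b] := fun _ _ _ _ h => by
  simpa only [List.cons_append, List.nil_append, List.cons.injEq] using h

namespace IsPrefixCode

variable {f : α → List Bool} {g : β → List Bool}

lemma eq_of_prefix (hf : IsPrefixCode f) {a b : α} (h : f a <+: f b) : a = b := by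
  obtain ⟨r, hr⟩ := h
  exact (hf (hr.trans (List.append_nil _).symm)).1

lemma injective (hf : IsPrefixCode f) : Function.Injective f := fun _ _ h =>
  hf.eq_of_prefix (h ▸ List.prefix_rfl)

lemma prodCode (hf : IsPrefixCode f) (hg : IsPrefixCode g) : IsPrefixCode (prodCode f g) := by
  rintro ⟨a, b⟩ ⟨a', b'⟩ r r' h
  simp only [LoopedNet.prodCode, List.append_assoc] at h
  obtain ⟨rfl, hrest⟩ := hf h
  obtain ⟨rfl, hr⟩ := hg hrest
  exact ⟨rfl, hr⟩

lemma sumCode (hf : IsPrefixCode f) (hg : IsPrefixCode g) : IsPrefixCode (sumCode f g) := by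
  rintro (a | b) (a' | b') r r' h <;>
    simp only [LoopedNet.sumCode, Sum.elim_inl, Sum.elim_inr, List.cons_append, List.cons.injEq,
      reduceCtorEq, true_and, false_and] at h
  · obtain ⟨rfl, hr⟩ := hf h
    exact ⟨rfl, hr⟩
  · obtain ⟨rfl, hr⟩ := hg h
    exact ⟨rfl, hr⟩

lemma optionCode (hf : IsPrefixCode f) : IsPrefixCode (optionCode f) := by
  rintro (_ | a) (_ | a') r r' h <;>
    simp only [LoopedNet.optionCode, Option.elim_none, Option.elim_some, List.cons_append,
      List.nil_append, List.cons.injEq, reduceCtorEq, true_and, false_and] at h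
  · exact ⟨rfl, h⟩
  · obtain ⟨rfl, hr⟩ := hf h
    exact ⟨rfl, hr⟩

lemma listCode (hf : IsPrefixCode f) : IsPrefixCode (listCode f) := by
  intro l
  induction l with
  | nil =>
    rintro (_ | ⟨a', l'⟩) r r' h <;> simp_all [LoopedNet.listCode]
  | cons a l ih =>
    rintro (_ | ⟨a', l'⟩) r r' h <;>
      simp only [LoopedNet.listCode, List.foldr_cons, List.foldr_nil, List.cons_append,
        List.append_assoc, List.cons.injEq, reduceCtorEq, true_and, false_and] at h
    obtain ⟨rfl, hrest⟩ := hf h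
    obtain ⟨rfl, hr⟩ := ih hrest
    exact ⟨rfl, hr⟩

end IsPrefixCode

lemma length_listCode_le {f : α → List Bool} {b : ℕ} {l : List α}
    (h : ∀ a ∈ l, (f a).length ≤ b) : (listCode f l).length ≤ l.length * (b + 1) + 1 := by
  induction l with
  | nil => exact le_add_self
  | cons a l ih =>
    rw [List.forall_mem_cons] at h
    have ih := ih h.2
    rw [listCode] at ih
    rw [listCode, List.foldr_cons, List.length_cons, List.length_append, List.length_cons,
      add_mul]
    linarith [h.1]

end PrefixCode

section Primrec

variable {α β : Type*} [Primcodable α] [Primcodable β] {f : α → List Bool} {g : β → List Bool}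

lemma primrec_prodCode (hf : Primrec f) (hg : Primrec g) : Primrec (prodCode f g) :=
  Primrec.list_append.comp (hf.comp .fst) (hg.comp .snd)

lemma primrec_sumCode (hf : Primrec f) (hg : Primrec g) : Primrec (sumCode f g) := by
  have hl : Primrec₂ fun (_ : α ⊕ β) (a : α) => false :: f a :=
    Primrec.list_cons.comp (.const false) (hf.comp .snd)
  have hr : Primrec₂ fun (_ : α ⊕ β) (b : β) => true :: g b :=
    Primrec.list_cons.comp (.const true) (hg.comp .snd)
  exact (Primrec.sumCasesOn .id hl hr).of_eq fun s => by cases s <;> rfl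

lemma primrec_optionCode (hf : Primrec f) : Primrec (optionCode f) := by
  have hsome : Primrec₂ fun (_ : Option α) (a : α) => true :: f a :=
    Primrec.list_cons.comp (.const true) (hf.comp .snd)
  exact (Primrec.option_casesOn .id (.const [false]) hsome).of_eq fun o => by cases o <;> rfl

lemma primrec_listCode (hf : Primrec f) : Primrec (listCode f) := by
  have hcons : Primrec₂ fun (_ : List α) (p : α × List Bool) => true :: (f p.1 ++ p.2) :=
    Primrec.list_cons.comp (.const true)
      (Primrec.list_append.comp (hf.comp (.comp .fst .snd)) (.comp .snd .snd))
  exact Primrec.list_foldr .id (.const [false]) hcons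

end Primrec

section Kolmogorov

variable {U : List Bool →. List Bool}

lemma kolmogorov_le {s p : List Bool} (h : s ∈ U p) : kolmogorov U s ≤ p.length :=
  Nat.sInf_le ⟨p, rfl, h⟩

lemma IsUniversal.exists_length_eq_kolmogorov (hU : IsUniversal U) (s : List Bool) :
    ∃ p : List Bool, s ∈ U p ∧ p.length = kolmogorov U s := by
  obtain ⟨p₀, hp₀⟩ := hU.exists_program s
  obtain ⟨p, hp, hs⟩ := Nat.sInf_mem (s := {k | ∃ p : List Bool, p.length = k ∧ s ∈ U p})
    ⟨_, p₀, rfl, hp₀⟩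
  exact ⟨p, hs, hp⟩

theorem IsUniversal.exists_kolmogorov_le (hU : IsUniversal U) {α : Type*} [Primcodable α]
    {code : α → List Bool} (hcode : Computable code) (hpre : IsPrefixCode code)
    {F : α →. List Bool} (hF : Partrec F) :
    ∃ c : ℕ, ∀ a, ∀ s ∈ F a, kolmogorov U s ≤ (code a).length + c := by
  obtain ⟨decode, hdecode, hmem⟩ := exists_partrec_inverse hcode hpre.injective
  have hV : IsPrefixMachine fun p => (decode p).bind F := by
    refine ⟨hdecode.bind (hF.comp Computable.snd).to₂, fun p hp q hq hpq => ?_⟩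
    obtain ⟨a, ha⟩ := Part.dom_iff_mem.1 (Part.bind_dom.1 hp).1
    obtain ⟨b, hb⟩ := Part.dom_iff_mem.1 (Part.bind_dom.1 hq).1
    rw [hmem] at ha hb
    subst ha hb
    rw [hpre.eq_of_prefix hpq]
  obtain ⟨q, hq⟩ := hU.simulates _ hV
  refine ⟨q.length, fun a s hs => ?_⟩
  have hout : s ∈ U (q ++ code a) := by
    rw [hq]
    exact Part.mem_bind ((hmem _ _).2 rfl) hs
  exact (kolmogorov_le hout).trans_eq (by rw [List.length_append, add_comm])

end Kolmogorov

section Program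

/-- The code of a straight-line program whose variables are named by binary strings. -/
def progCode : List (Instr (List Bool)) → List Bool :=
  let nameCode : List Bool → List Bool := listCode fun b => [b]
  listCode (prodCode nameCode (prodCode (optionCode (sumCode nameCode nameCode)) fun b => [b]))

lemma isPrefixCode_progCode : IsPrefixCode progCode := by
  have hname : IsPrefixCode (listCode fun b : Bool => [b]) := isPrefixCode_singleton.listCode
  exact (hname.prodCode ((hname.sumCode hname).optionCode.prodCode
    isPrefixCode_singleton)).listCode

lemma primrec_progCode : Primrec progCode := by
  have hbit : Primrec fun b : Bool => [b] := .dom_finite _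
  have hname := primrec_listCode hbit
  exact primrec_listCode (primrec_prodCode hname (primrec_prodCode
    (primrec_optionCode (primrec_sumCode hname hname)) hbit))

/-- The variables that occur in an instruction. -/
def instrNames {α : Type*} (I : Instr α) : List α :=
  I.1 :: (I.2.1.map (Sum.elim id id)).toList

lemma length_instrNames_le {α : Type*} (I : Instr α) : (instrNames I).length ≤ 2 := by
  rcases I with ⟨d, _ | s, b⟩ <;> simp [instrNames]

lemma length_progCode_le {prog : List (Instr (List Bool))} {b : ℕ}
    (h : ∀ I ∈ prog, ∀ a ∈ instrNames I, a.length ≤ b) :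
    (progCode prog).length ≤ prog.length * (4 * b + 6) + 1 := by
  have hname {a : List Bool} (ha : a.length ≤ b) :
      (listCode (fun b => [b]) a).length ≤ 2 * b + 1 := by
    have := length_listCode_le (l := a) (f := fun b : Bool => [b]) (b := 1) fun _ _ => le_rfl
    omega
  refine length_listCode_le fun I hI => ?_
  have hd := hname (h I hI I.1 List.mem_cons_self)
  have hs {a : List Bool} (ha : a ∈ (I.2.1.map (Sum.elim id id)).toList) :=
    hname (h I hI a (List.mem_cons_of_mem _ ha))
  rcases I with ⟨d, _ | a | a, c⟩ <;>
    simp [prodCode, optionCode, sumCode] at hs hd ⊢ <;> omega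

end Program

/-! ### Networks as straight-line programs -/

section Flatten

variable {α : Type*}

/-- The instructions `d += w s` of a parameter `w ∈ δℤ`. -/
noncomputable def paramProg (δ w : ℝ) (d : α) (s : Source α) : List (Instr α) :=
  List.replicate ⌊w / δ⌋.natAbs (d, s, decide (0 ≤ ⌊w / δ⌋))

/-- The instructions of an affine layer. -/
noncomputable def layerProg (δ : ℝ) {m k : ℕ} (W : Matrix (Fin k) (Fin m) ℝ) (b : Fin k → ℝ)
    (src : Fin m → α ⊕ α) (dst : Fin k → α) : List (Instr α) :=
  (List.finRange k).flatMap fun i =>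
    ((List.finRange m).flatMap fun j => paramProg δ (W i j) (dst i) (some (src j))) ++
      paramProg δ (b i) (dst i) none

lemma mem_layerProg {δ : ℝ} {m k : ℕ} {W : Matrix (Fin k) (Fin m) ℝ} {b : Fin k → ℝ}
    {src : Fin m → α ⊕ α} {dst : Fin k → α} {I : Instr α} (hI : I ∈ layerProg δ W b src dst) :
    (∃ i, I.1 = dst i) ∧ ∀ s ∈ I.2.1, ∃ j, s = src j := by
  simp only [layerProg, paramProg, List.mem_flatMap, List.mem_append, List.mem_finRange,
    List.mem_replicate, true_and] at hI
  obtain ⟨i, ⟨j, -, rfl⟩ | ⟨-, rfl⟩⟩ := hI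
  · exact ⟨⟨i, rfl⟩, fun s hs => ⟨j, (Option.some.inj hs).symm⟩⟩
  · exact ⟨⟨i, rfl⟩, by simp⟩

lemma length_layerProg (δ : ℝ) {m k : ℕ} (W : Matrix (Fin k) (Fin m) ℝ) (b : Fin k → ℝ)
    (src : Fin m → α ⊕ α) (dst : Fin k → α) :
    (layerProg δ W b src dst).length =
      ((layerParams W b).map fun w => ⌊w / δ⌋.natAbs).sum := by
  simp only [layerProg, layerParams, paramProg, List.length_append, List.length_flatMap,
    List.length_replicate, List.map_append, List.sum_append, List.map_flatten, List.sum_flatten,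
    List.map_ofFn, Function.comp_def, List.sum_ofFn, ← Fin.sum_univ_def, Finset.sum_add_distrib]

variable [DecidableEq α] {δ : ℝ} {P V : α → ℝ}

lemma sourceValue_add_increment {I J : Instr α} (h : J.2.1 ≠ some (.inr I.1)) :
    sourceValue P (V + increment δ P V I) J.2.1 = sourceValue P V J.2.1 := by
  rcases hs : J.2.1 with _ | a | a
  · rfl
  · rfl
  · have ha : a ≠ I.1 := fun ha => h (hs.trans (by rw [ha]))
    rw [sourceValue, sourceValue, Pi.add_apply, increment, Pi.single_eq_of_ne ha, add_zero]

lemma foldl_instrStep_eq_add {prog : List (Instr α)}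
    (h : ∀ I ∈ prog, ∀ J ∈ prog, J.2.1 ≠ some (.inr I.1)) (V : α → ℝ) :
    prog.foldl (instrStep δ P) V = V + (prog.map (increment δ P V)).sum := by
  induction prog generalizing V with
  | nil => simp
  | cons I prog ih =>
    have htail := ih (fun J hJ K hK => h J (.tail _ hJ) K (.tail _ hK)) (instrStep δ P V I)
    have hincrement : prog.map (increment δ P (instrStep δ P V I)) =
        prog.map (increment δ P V) := List.map_congr_left fun J hJ => by
      rw [increment, increment, instrStep,
        sourceValue_add_increment (h I List.mem_cons_self J (.tail _ hJ))]
    rw [List.foldl_cons, htail, hincrement, instrStep, List.map_cons, List.sum_cons, add_assoc]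

lemma boolSign_mul_natAbs (z : ℤ) : boolSign (decide (0 ≤ z)) * z.natAbs = z := by
  rw [Nat.cast_natAbs]
  rcases lt_or_ge z 0 with h | h
  · rw [decide_eq_false h.not_ge, abs_of_neg h]
    simp [boolSign]
  · rw [decide_eq_true h, abs_of_nonneg h]
    simp [boolSign]

lemma floor_mul_intCast_div (hδ : δ ≠ 0) (z : ℤ) : ⌊δ * z / δ⌋ = z := by
  rw [mul_div_cancel_left₀ _ hδ, Int.floor_intCast]

lemma sum_increment_paramProg (hδ : δ ≠ 0) {w : ℝ} (hw : ∃ z : ℤ, w = δ * z) (d : α)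
    (s : Source α) : ((paramProg δ w d s).map (increment δ P V)).sum =
      Pi.single d (w * sourceValue P V s) := by
  obtain ⟨z, rfl⟩ := hw
  rw [paramProg, floor_mul_intCast_div hδ, List.map_replicate, List.sum_replicate, increment,
    ← Pi.single_smul, nsmul_eq_mul]
  congr 1
  linear_combination δ * sourceValue P V s * boolSign_mul_natAbs z

lemma foldl_layerProg (hδ : δ ≠ 0) {m k : ℕ} {W : Matrix (Fin k) (Fin m) ℝ} {b : Fin k → ℝ}
    {src : Fin m → α ⊕ α} {dst : Fin k → α} (hW : ∀ i j, ∃ z : ℤ, W i j = δ * z)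
    (hb : ∀ i, ∃ z : ℤ, b i = δ * z) (hsrc : ∀ j i, src j ≠ .inr (dst i)) :
    (layerProg δ W b src dst).foldl (instrStep δ P) V =
      V + ∑ i, Pi.single (dst i) ((W.mulVec (fun j => sourceValue P V (some (src j))) + b) i) := by
  rw [foldl_instrStep_eq_add]
  · have hsum {β : Type} (l : List β) (f : β → List (Instr α)) :
        ((l.flatMap f).map (increment δ P V)).sum =
          (l.map fun x => ((f x).map (increment δ P V)).sum).sum := by
      induction l <;> simp_all
    have hrow (d : α) (f : Fin m → ℝ) : ∑ j, Pi.single d (f j) = Pi.single (M := fun _ => ℝ) d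
        (∑ j, f j) := (map_sum (AddMonoidHom.single (fun _ : α => ℝ) d) f _).symm
    simp only [layerProg, hsum, List.map_append, List.sum_append, ← Fin.sum_univ_def,
      sum_increment_paramProg hδ (hW _ _), sum_increment_paramProg hδ (hb _), hrow,
      ← Pi.single_add, sourceValue, mul_one]
    rfl
  · intro I hI J hJ hread
    obtain ⟨⟨i, hi⟩, -⟩ := mem_layerProg hI
    obtain ⟨-, hJ⟩ := mem_layerProg hJ
    obtain ⟨j, hj⟩ := hJ _ hread
    exact hsrc j i (hj.symm.trans (by rw [hi]))

end Flatten

section Network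

/-- The instructions of a network whose layers are numbered from `l` on and whose inputs are
read from `src`. A variable `(l, i)` with `l ≠ 0` is the `i`-th neuron of the layer `l`, and
`(0, i)` is the `i`-th output. -/
noncomputable def FFNet.prog (δ : ℝ) : {m k : ℕ} → FFNet m k → ℕ →
    (Fin m → (ℕ × ℕ) ⊕ (ℕ × ℕ)) → List (Instr (ℕ × ℕ))
  | _, _, .last W b, _, src => layerProg δ W b src fun i => (0, i)
  | _, _, .cons W b rest, l, src => layerProg δ W b src (fun i => (l, i)) ++
      rest.prog δ (l + 1) fun i => .inr (l, i)

lemma FFNet.length_prog (δ : ℝ) {m k : ℕ} (N : FFNet m k) (l : ℕ)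
    (src : Fin m → (ℕ × ℕ) ⊕ (ℕ × ℕ)) :
    (N.prog δ l src).length = (N.params.map fun w => ⌊w / δ⌋.natAbs).sum := by
  induction N generalizing l with
  | last W b => exact length_layerProg δ W b _ _
  | cons W b rest ih =>
    simp only [FFNet.prog, FFNet.params, List.length_append, length_layerProg, List.map_append,
      List.sum_append, ih]

lemma forall_mem_layerParams {m k : ℕ} {W : Matrix (Fin k) (Fin m) ℝ} {b : Fin k → ℝ}
    {p : ℝ → Prop} : (∀ a ∈ layerParams W b, p a) ↔ (∀ i j, p (W i j)) ∧ ∀ i, p (b i) := by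
  simp only [layerParams, List.mem_append, List.mem_flatten, List.mem_ofFn, or_imp, forall_and,
    forall_exists_index, and_imp, forall_apply_eq_imp_iff]
  rw [forall_comm]
  exact and_congr_left' (forall_congr' fun i => ⟨fun h j => h _ j rfl, fun h _ j hj => hj ▸ h j⟩)

lemma sum_single_layer_apply {k : ℕ} (l : ℕ) (f : Fin k → ℝ) (i : Fin k) :
    (∑ j : Fin k, Pi.single (l, (j : ℕ)) (f j) : ℕ × ℕ → ℝ) (l, i) = f i := by
  rw [Finset.sum_apply, Finset.sum_eq_single i]
  · exact Pi.single_eq_same _ _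
  · intro j _ hj
    exact Pi.single_eq_of_ne (fun h => hj (Fin.ext (Prod.ext_iff.1 h).2.symm)) _
  · simp

lemma sum_single_layer_apply_of_ne {k : ℕ} {l : ℕ} (f : Fin k → ℝ) {a : ℕ × ℕ} (ha : a.1 ≠ l) :
    (∑ j : Fin k, Pi.single (l, (j : ℕ)) (f j) : ℕ × ℕ → ℝ) a = 0 := by
  rw [Finset.sum_apply]
  exact Finset.sum_eq_zero fun j _ =>
    Pi.single_eq_of_ne (fun h => ha (congrArg Prod.fst h)) _

lemma FFNet.foldl_prog {δ : ℝ} (hδ : δ ≠ 0) {m k : ℕ} (N : FFNet m k)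
    (hN : ∀ a ∈ N.params, ∃ z : ℤ, a = δ * z) {l : ℕ} (hl : 0 < l)
    {src : Fin m → (ℕ × ℕ) ⊕ (ℕ × ℕ)} (hsrc : ∀ j a, src j = .inr a → 0 < a.1 ∧ a.1 < l)
    {P V : ℕ × ℕ → ℝ} (hV : ∀ a : ℕ × ℕ, a.1 = 0 ∨ l ≤ a.1 → V a = 0) (i : Fin k) :
    (N.prog δ l src).foldl (instrStep δ P) V (0, i) =
      N.eval (fun j => sourceValue P V (some (src j))) i := by
  induction N generalizing l V with
  | last W b =>
    obtain ⟨hW, hb⟩ := forall_mem_layerParams.1 hN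
    rw [FFNet.prog, foldl_layerProg hδ hW hb fun j i h => (hsrc j _ h).1.ne rfl, Pi.add_apply,
      hV _ (.inl rfl), zero_add, sum_single_layer_apply]
    rfl
  | @cons m w k W b rest ih =>
    rw [FFNet.params, List.forall_mem_append, forall_mem_layerParams] at hN
    obtain ⟨⟨hW, hb⟩, hrest⟩ := hN
    have hlayer := foldl_layerProg (P := P) (V := V) (dst := fun i : Fin w => (l, (i : ℕ)))
      hδ hW hb fun j i h => (hsrc j _ h).2.ne rfl
    rw [FFNet.prog, List.foldl_append, hlayer, ih hrest l.succ_pos]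
    · refine congrFun (congrArg rest.eval (funext fun j => ?_)) i
      rw [sourceValue, Pi.add_apply, hV _ (.inr le_rfl), zero_add, sum_single_layer_apply]
    · rintro j _ ⟨⟩
      exact ⟨hl, l.lt_succ_self⟩
    · intro a ha
      rw [Pi.add_apply, hV a (by omega), zero_add, sum_single_layer_apply_of_ne]
      omega

lemma sum_map_ite_eq_countP_mul {ι R : Type*} [NonAssocSemiring R] (p : ι → Prop) [DecidablePred p]
    (c : R) (l : List ι) :
    (l.map fun a => if p a then c else 0).sum = (l.countP fun a => p a) * c := by
  induction l with
  | nil => simp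
  | cons a l ih => by_cases ha : p a <;> simp [ha, ih, add_mul, add_comm]

namespace LNN

variable {N : LNN} {δ M : ℝ}

/-- The instructions of a looped network: its first layer reads the outputs `(0, j)` of the
previous round. -/
noncomputable def prog (N : LNN) (δ : ℝ) : List (Instr (ℕ × ℕ)) :=
  N.block.prog δ 1 fun j => .inl (0, j)

lemma progState_prog (hδ : δ ≠ 0) (hN : N.FixedPrecision δ M) (t : ℕ) (i : Fin N.n) :
    progState δ (N.prog δ) t (0, i) = N.state t i := by
  induction t generalizing i with
  | zero => rfl
  | succ t ih =>
    have heval := N.block.foldl_prog hδ (fun a ha => (hN a ha).1) one_pos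
      (src := fun j => .inl (0, j)) (P := progState δ (N.prog δ) t) (V := 0) (by simp)
      (fun _ _ => rfl) i
    rw [progState, state, ← funext ih]
    exact heval

lemma length_prog_le (hδ : 0 < δ) (hN : N.FixedPrecision δ M) :
    (N.prog δ).length ≤ ⌊M / δ⌋₊ * N.zeroNorm := by
  classical
  have hparam : ∀ a ∈ N.block.params,
      ⌊a / δ⌋.natAbs ≤ if a ≠ 0 then ⌊M / δ⌋₊ else 0 := by
    intro a ha
    obtain ⟨⟨z, rfl⟩, hM⟩ := hN a ha
    rw [floor_mul_intCast_div hδ.ne']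
    split_ifs with h0
    · rw [Nat.le_floor_iff' (by simpa [hδ.ne'] using h0), le_div_iff₀ hδ,
        Nat.cast_natAbs, Int.cast_abs, mul_comm]
      rwa [abs_mul, abs_of_pos hδ] at hM
    · simpa [hδ.ne'] using h0
  rw [prog, FFNet.length_prog, zeroNorm]
  refine (List.sum_le_sum hparam).trans_eq ?_
  rw [sum_map_ite_eq_countP_mul, mul_comm, Nat.cast_id]

end LNN

end Network

/-! ### The complexity of the output of a network -/

section Rename

variable {α β : Type*}

/-- Renaming of the variables of an instruction. -/
def Instr.rename (ρ : α → β) (I : Instr α) : Instr β := (ρ I.1, I.2.1.map (Sum.map ρ ρ), I.2.2)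

lemma instrNames_rename (ρ : α → β) (I : Instr α) :
    instrNames (Instr.rename ρ I) = (instrNames I).map ρ := by
  rcases I with ⟨d, _ | s | s, b⟩ <;> rfl

variable [DecidableEq α] [DecidableEq β] {δ : ℝ} {ρ : α → β} {S : Set α} {prog : List (Instr α)}

lemma increment_rename (hρ : Set.InjOn ρ S) {P V : α → ℝ} {P' V' : β → ℝ}
    (hP : ∀ a ∈ S, P' (ρ a) = P a) (hV : ∀ a ∈ S, V' (ρ a) = V a) {I : Instr α}
    (hI : ∀ a ∈ instrNames I, a ∈ S) {a : α} (ha : a ∈ S) :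
    increment δ P' V' (Instr.rename ρ I) (ρ a) = increment δ P V I a := by
  rcases I with ⟨d, s, b⟩
  have hsource : sourceValue P' V' (s.map (Sum.map ρ ρ)) = sourceValue P V s := by
    rcases s with _ | s | s
    · rfl
    · exact hP s (hI s (by simp [instrNames]))
    · exact congrArg (max · 0) (hV s (hI s (by simp [instrNames])))
  simp only [increment, Instr.rename, hsource, Pi.single_apply,
    hρ.eq_iff ha (hI d List.mem_cons_self)]

lemma foldl_instrStep_rename (hρ : Set.InjOn ρ S) {P V : α → ℝ} {P' V' : β → ℝ}
    (hP : ∀ a ∈ S, P' (ρ a) = P a) (hV : ∀ a ∈ S, V' (ρ a) = V a)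
    (hS : ∀ I ∈ prog, ∀ a ∈ instrNames I, a ∈ S) {a : α} (ha : a ∈ S) :
    (prog.map (Instr.rename ρ)).foldl (instrStep δ P') V' (ρ a) =
      prog.foldl (instrStep δ P) V a := by
  induction prog generalizing V V' with
  | nil => exact hV a ha
  | cons I prog ih =>
    rw [List.forall_mem_cons] at hS
    refine ih (fun b hb => ?_) hS.2
    rw [instrStep, instrStep, Pi.add_apply, Pi.add_apply, hV b hb,
      increment_rename hρ hP hV hS.1 hb]

lemma progState_rename (hρ : Set.InjOn ρ S) (hS : ∀ I ∈ prog, ∀ a ∈ instrNames I, a ∈ S) (t : ℕ)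
    {a : α} (ha : a ∈ S) :
    progState δ (prog.map (Instr.rename ρ)) t (ρ a) = progState δ prog t a := by
  induction t generalizing a with
  | zero => rfl
  | succ t ih => exact foldl_instrStep_rename hρ (fun b hb => ih hb) (fun _ _ => rfl) hS ha

lemma nat_bits_injective : Function.Injective Nat.bits := fun m n h =>
  Nat.digits.injective 2 (by rw [Nat.digits_two_eq_bits, Nat.digits_two_eq_bits, h])

lemma exists_rename_bits (prog : List (Instr α)) {l : List α} (hl : l.Nodup) :
    ∃ prog' : List (Instr (List Bool)), prog'.length = prog.length ∧
      (∀ I ∈ prog', ∀ a ∈ instrNames I, a.length ≤ Nat.size (2 * prog.length + l.length)) ∧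
      ∀ (δ : ℝ) (t i : ℕ) (hi : i < l.length),
        progState δ prog' t (Nat.bits i) = progState δ prog t l[i] := by
  let names : List α := l ++ prog.flatMap instrNames
  let ρ (a : α) : List Bool := Nat.bits (names.idxOf a)
  have hρ : Set.InjOn ρ {a | a ∈ names} := fun a ha _ _ h =>
    (List.idxOf_inj ha).1 (nat_bits_injective h)
  have hnames : ∀ I ∈ prog, ∀ a ∈ instrNames I, a ∈ names := fun I hI a ha =>
    List.mem_append_right _ (List.mem_flatMap.2 ⟨I, hI, ha⟩)
  have hlength : names.length ≤ 2 * prog.length + l.length := by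
    have h := List.sum_le_card_nsmul (prog.map fun I => (instrNames I).length) 2
      (List.forall_mem_map.2 fun I _ => length_instrNames_le I)
    rw [List.length_map, smul_eq_mul] at h
    rw [List.length_append, List.length_flatMap]
    omega
  refine ⟨prog.map (Instr.rename ρ), List.length_map _, ?_, fun δ t i hi => ?_⟩
  · simp only [List.forall_mem_map, instrNames_rename]
    intro I hI a ha
    rw [Nat.size_eq_bits_len]
    exact Nat.size_le_size ((List.idxOf_lt_length_of_mem (hnames I hI a ha)).le.trans hlength)
  · have hi' : ρ l[i] = Nat.bits i := by
      exact congrArg Nat.bits ((List.idxOf_append_of_mem (List.getElem_mem hi)).trans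
        (hl.idxOf_getElem i hi))
    rw [← hi']
    exact progState_rename hρ hnames t (List.mem_append_left _ (List.getElem_mem hi))

end Rename

section Logarithm

lemma natCast_size_le_logb_add_one (n : ℕ) : (Nat.size n : ℝ) ≤ Real.logb 2 n + 1 := by
  have hsize : Nat.size n ≤ Nat.log 2 n + 1 := Nat.size_le.2 (Nat.lt_pow_succ_log_self one_lt_two n)
  calc (Nat.size n : ℝ) ≤ (Nat.log 2 n : ℝ) + 1 := by exact_mod_cast hsize
    _ ≤ Real.logb 2 n + 1 := by gcongr; exact_mod_cast Real.natLog_le_logb n 2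

lemma natCast_le_mul_logb_add_one {k : ℕ} (hk : 1 ≤ k) : (k : ℝ) ≤ k * Real.logb 2 k + 1 := by
  rcases hk.eq_or_lt with rfl | hk
  · simp
  · have hk' : (2 : ℝ) ≤ k := by exact_mod_cast hk
    have hlog : 1 ≤ Real.logb 2 k := by
      rwa [Real.le_logb_iff_rpow_le one_lt_two (by linarith), Real.rpow_one]
    linarith [le_mul_of_one_le_right (by linarith : (0 : ℝ) ≤ k) hlog]

lemma natCast_size_le_add_logb {Z k m a b : ℕ} (hk : 1 ≤ k) (hm : m ≤ Z * k) :
    (Nat.size (a * m + b) : ℝ) ≤ Real.logb 2 (a * Z + b + 1) + 1 + Real.logb 2 k := by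
  have hle : a * m + b ≤ (a * Z + b + 1) * k :=
    calc a * m + b ≤ a * (Z * k) + b * k := by gcongr; exact Nat.le_mul_of_pos_right b hk
      _ ≤ (a * Z + b + 1) * k := by linarith
  have hk' : (k : ℝ) ≠ 0 := Nat.cast_ne_zero.2 (by omega)
  calc (Nat.size (a * m + b) : ℝ)
      ≤ Nat.size ((a * Z + b + 1) * k) := Nat.cast_le.2 (Nat.size_le_size hle)
    _ ≤ Real.logb 2 ((a * Z + b + 1) * k) + 1 := by
      exact_mod_cast natCast_size_le_logb_add_one ((a * Z + b + 1) * k)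
    _ = _ := by rw [Real.logb_mul (by positivity) hk']; ring

lemma exists_mul_size_le (Z a b c : ℕ) : ∃ C : ℝ, 0 ≤ C ∧ ∀ k m : ℕ, 1 ≤ k → m ≤ Z * k →
    (m * (4 * Nat.size (a * m + b) + 6) + 1 + c : ℝ) ≤ C * (k * Real.logb 2 k) + C := by
  set A : ℝ := Real.logb 2 (a * Z + b + 1) + 1
  have hA : 0 ≤ A := by
    have harg : (0 : ℝ) ≤ a * Z + b := by positivity
    linarith [Real.logb_nonneg one_lt_two (le_add_of_nonneg_left harg)]
  refine ⟨Z * (4 * A + 10) + 1 + c, by positivity, fun k m hk hm => ?_⟩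
  have hlog : 0 ≤ Real.logb 2 k := Real.logb_nonneg one_lt_two (by exact_mod_cast hk)
  have hm' : (m : ℝ) ≤ Z * k := by exact_mod_cast hm
  calc (m * (4 * Nat.size (a * m + b) + 6) + 1 + c : ℝ)
      ≤ Z * k * (4 * (A + Real.logb 2 k) + 6) + 1 + c := by
        gcongr
        exact natCast_size_le_add_logb hk hm
    _ = Z * (4 * A + 6) * k + 4 * Z * (k * Real.logb 2 k) + (1 + c) := by ring
    _ ≤ Z * (4 * A + 6) * (k * Real.logb 2 k + 1) + 4 * Z * (k * Real.logb 2 k + 1) +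
          (1 + c) * (k * Real.logb 2 k + 1) := by
        gcongr
        · exact natCast_le_mul_logb_add_one hk
        · linarith
        · exact le_mul_of_one_le_right (by positivity) (le_add_of_nonneg_left (by positivity))
    _ = _ := by ring

end Logarithm

theorem IsUniversal.exists_kolmogorov_le_zeroNorm {U : List Bool →. List Bool}
    (hU : IsUniversal U) {δ : ℝ} (hδ : 0 < δ) (hδc : IsComputableReal δ) (M : ℝ) :
    ∃ C : ℝ, 0 ≤ C ∧ ∀ (N : LNN) (s : List Bool), N.FixedPrecision δ M → N.Outputs s →
      1 ≤ N.zeroNorm →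
      (kolmogorov U s : ℝ) ≤ C * (N.zeroNorm * Real.logb 2 N.zeroNorm) + C := by
  obtain ⟨pos, hposc, hpos⟩ := ComputablePred.computable_iff.1 (computablePred_eval_pos hδc hδ.le)
  have hpos : ∀ q : ExpPair, pos q ↔ 0 < q.eval δ := fun q => (iff_of_eq (congrFun hpos q)).symm
  obtain ⟨c, hK⟩ := hU.exists_kolmogorov_le primrec_progCode.to_comp isPrefixCode_progCode
    (partrec_progOutput hposc (Nat.bits 0) (Nat.bits 1) (Nat.bits 2))
  obtain ⟨C, hC, hbound⟩ := exists_mul_size_le ⌊M / δ⌋₊ 2 3 c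
  refine ⟨C, hC, fun N s hN hs hk => ?_⟩
  obtain ⟨prog, hlength, hnames, hstate⟩ := exists_rename_bits (N.prog δ)
    (l := [((0, 0) : ℕ × ℕ), (0, 1), (0, 2)]) (by decide)
  rw [← hlength] at hnames
  have hout : s ∈ progOutput pos (Nat.bits 0) (Nat.bits 1) (Nat.bits 2) prog := by
    have hhalt (t : ℕ) := (hstate δ t 0 (by simp)).trans (LNN.progState_prog hδ.ne' hN t N.haltCh)
    have hemit (t : ℕ) := (hstate δ t 1 (by simp)).trans (LNN.progState_prog hδ.ne' hN t N.emitCh)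
    have hbit (t : ℕ) := (hstate δ t 2 (by simp)).trans (LNN.progState_prog hδ.ne' hN t N.bitCh)
    rw [progOutput_eq_streamOutput hpos]
    simpa only [hhalt, hemit, hbit] using LNN.outputs_iff_mem_streamOutput.1 hs
  refine le_trans ?_ (hbound N.zeroNorm prog.length hk
    (hlength.trans_le (LNN.length_prog_le hδ hN)))
  exact_mod_cast (hK prog s hout).trans (Nat.add_le_add_right (length_progCode_le hnames) c)

/-! ### Looped networks over arbitrary index types -/

section Layers

/-- The number of nonzero entries of a matrix. -/
noncomputable def nnz {I J : Type*} [Fintype I] [Fintype J] (W : Matrix I J ℝ) : ℕ :=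
  ∑ i, hammingNorm (W i)

lemma hammingNorm_comp_equiv {I J : Type*} [Fintype I] [Fintype J] (b : I → ℝ) (e : J ≃ I) :
    hammingNorm (b ∘ e) = hammingNorm b := by
  simpa only [hammingNorm, Finset.card_filter, Function.comp_apply] using
    Equiv.sum_comp e fun i => if b i ≠ 0 then 1 else 0

lemma hammingNorm_sigma {I : Type*} [Fintype I] {κ : I → Type*} [∀ i, Fintype (κ i)]
    (b : (Σ i, κ i) → ℝ) : hammingNorm b = ∑ i, hammingNorm fun r => b ⟨i, r⟩ := by
  simp only [hammingNorm, Finset.card_filter, Fintype.sum_sigma]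

lemma nnz_submatrix {I J I' J' : Type*} [Fintype I] [Fintype J] [Fintype I'] [Fintype J']
    (W : Matrix I J ℝ) (e : I' ≃ I) (f : J' ≃ J) : nnz (W.submatrix e f) = nnz W := by
  rw [nnz, nnz, ← Equiv.sum_comp e]
  exact Finset.sum_congr rfl fun i _ => hammingNorm_comp_equiv (W (e i)) f

lemma countP_ofFn_ne_zero {k : ℕ} (b : Fin k → ℝ) :
    (List.ofFn b).countP (fun a => a ≠ 0) = hammingNorm b := by
  have h := sum_map_ite_eq_countP_mul (fun a : ℝ => a ≠ 0) 1 (List.ofFn b)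
  rw [mul_one, Nat.cast_id, List.map_ofFn, List.sum_ofFn] at h
  rw [← h, hammingNorm, Finset.card_filter]
  rfl

lemma countP_layerParams {m k : ℕ} (W : Matrix (Fin k) (Fin m) ℝ) (b : Fin k → ℝ) :
    (layerParams W b).countP (fun a => a ≠ 0) = nnz W + hammingNorm b := by
  rw [layerParams, List.countP_append, List.countP_flatten, List.map_ofFn, List.sum_ofFn,
    countP_ofFn_ne_zero]
  exact congrArg (· + _) (Finset.sum_congr rfl fun i _ => countP_ofFn_ne_zero (W i))

/-- One affine layer followed by ReLU. -/
noncomputable def reluLayer {I J : Type*} [Fintype J] (W : Matrix I J ℝ) (b : I → ℝ) (x : J → ℝ) :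
    I → ℝ := fun i => max ((W.mulVec x + b) i) 0

lemma reluLayer_submatrix {I J I' J' : Type*} [Fintype J] [Fintype J'] (W : Matrix I J ℝ)
    (b : I → ℝ) (e : I' → I) (f : J' ≃ J) (x : J → ℝ) :
    reluLayer (W.submatrix e f) (b ∘ e) (x ∘ f) = reluLayer W b x ∘ e := by
  funext i
  simp only [reluLayer, Matrix.submatrix_mulVec_equiv, Function.comp_assoc,
    Equiv.self_comp_symm, Function.comp_id]
  rfl

section LoopState

variable {T₀ T₁ T₂ T₃ : Type*} [Fintype T₀] [Fintype T₁] [Fintype T₂] [Fintype T₃]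

/-- The states of a looped network with three hidden layers and with biases in the first layer
only, over arbitrary index types. -/
noncomputable def loopState (W₁ : Matrix T₁ T₀ ℝ) (b : T₁ → ℝ) (W₂ : Matrix T₂ T₁ ℝ)
    (W₃ : Matrix T₃ T₂ ℝ) (W₄ : Matrix T₀ T₃ ℝ) : ℕ → T₀ → ℝ
  | 0 => 0
  | t + 1 => W₄.mulVec (reluLayer W₃ 0 (reluLayer W₂ 0 (reluLayer W₁ b
      (loopState W₁ b W₂ W₃ W₄ t))))

lemma loopState_submatrix {T₀' T₁' T₂' T₃' : Type*} [Fintype T₀'] [Fintype T₁'] [Fintype T₂']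
    [Fintype T₃'] (W₁ : Matrix T₁ T₀ ℝ) (b : T₁ → ℝ) (W₂ : Matrix T₂ T₁ ℝ) (W₃ : Matrix T₃ T₂ ℝ)
    (W₄ : Matrix T₀ T₃ ℝ) (e₀ : T₀' ≃ T₀) (e₁ : T₁' ≃ T₁) (e₂ : T₂' ≃ T₂) (e₃ : T₃' ≃ T₃)
    (t : ℕ) :
    loopState (W₁.submatrix e₁ e₀) (b ∘ e₁) (W₂.submatrix e₂ e₁) (W₃.submatrix e₃ e₂)
      (W₄.submatrix e₀ e₃) t = loopState W₁ b W₂ W₃ W₄ t ∘ e₀ := by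
  induction t with
  | zero => rfl
  | succ t ih =>
    have hlayer₂ := reluLayer_submatrix W₂ 0 e₂ e₁
    have hlayer₃ := reluLayer_submatrix W₃ 0 e₃ e₂
    rw [Pi.zero_comp] at hlayer₂ hlayer₃
    rw [loopState, ih, reluLayer_submatrix, hlayer₂, hlayer₃, Matrix.submatrix_mulVec_equiv,
      Function.comp_assoc, Equiv.self_comp_symm]
    rfl

end LoopState

namespace LNN

variable {n n₁ n₂ n₃ : ℕ} (hn : 3 ≤ n) (W₁ : Matrix (Fin n₁) (Fin n) ℝ) (b : Fin n₁ → ℝ)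
  (W₂ : Matrix (Fin n₂) (Fin n₁) ℝ) (W₃ : Matrix (Fin n₃) (Fin n₂) ℝ)
  (W₄ : Matrix (Fin n) (Fin n₃) ℝ)

/-- The looped network with three hidden layers and with biases in the first layer only. -/
def ofLayers : LNN :=
  ⟨n, hn, .cons W₁ b (.cons W₂ 0 (.cons W₃ 0 (.last W₄ 0)))⟩

lemma state_ofLayers (t : ℕ) :
    (ofLayers hn W₁ b W₂ W₃ W₄).state t = loopState W₁ b W₂ W₃ W₄ t := by
  induction t with
  | zero => rfl
  | succ t ih =>
    rw [state, ih]
    exact add_zero _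

lemma zeroNorm_ofLayers : (ofLayers hn W₁ b W₂ W₃ W₄).zeroNorm =
    nnz W₁ + hammingNorm b + nnz W₂ + nnz W₃ + nnz W₄ := by
  simp only [zeroNorm, ofLayers, FFNet.params, List.countP_append, countP_layerParams,
    hammingNorm_zero, add_zero, add_assoc]

lemma forall_mem_params_ofLayers {q : ℝ → Prop} (hq : q 0) (h₁ : ∀ i j, q (W₁ i j))
    (hb : ∀ i, q (b i)) (h₂ : ∀ i j, q (W₂ i j)) (h₃ : ∀ i j, q (W₃ i j))
    (h₄ : ∀ i j, q (W₄ i j)) : ∀ a ∈ (ofLayers hn W₁ b W₂ W₃ W₄).block.params, q a := by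
  simp only [ofLayers, FFNet.params, List.forall_mem_append, forall_mem_layerParams]
  exact ⟨⟨h₁, hb⟩, ⟨h₂, fun _ => hq⟩, ⟨h₃, fun _ => hq⟩, h₄, fun _ => hq⟩

end LNN

lemma exists_equiv_fin_castLE {T : Type*} [Finite T] {k : ℕ} {f : Fin k → T}
    (hf : Function.Injective f) :
    ∃ (n : ℕ) (hn : k ≤ n) (e : Fin n ≃ T), ∀ i, e (Fin.castLE hn i) = f i := by
  classical
  have := Fintype.ofFinite T
  let C : Set T := (Set.range f)ᶜ
  refine ⟨k + Fintype.card C, Nat.le_add_right _ _, finSumFinEquiv.symm.trans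
    ((Equiv.sumCongr (Equiv.ofInjective f hf) (Fintype.equivFin C).symm).trans
      (Equiv.Set.sumCompl (Set.range f))), fun i => ?_⟩
  have hi : finSumFinEquiv.symm (Fin.castAdd (Fintype.card C) i) = Sum.inl i := by simp
  rw [Equiv.trans_apply, show Fin.castLE _ i = Fin.castAdd (Fintype.card C) i from rfl, hi]
  rfl

lemma exists_looped_network {T₀ T₁ T₂ T₃ : Type*} [Fintype T₀] [Fintype T₁] [Fintype T₂]
    [Fintype T₃] (W₁ : Matrix T₁ T₀ ℝ) (b : T₁ → ℝ) (W₂ : Matrix T₂ T₁ ℝ) (W₃ : Matrix T₃ T₂ ℝ)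
    (W₄ : Matrix T₀ T₃ ℝ) {f : Fin 3 → T₀} (hf : Function.Injective f) :
    ∃ N : LNN,
      (∀ t i, N.state t (Fin.castLE N.three_le i) = loopState W₁ b W₂ W₃ W₄ t (f i)) ∧
      N.zeroNorm = nnz W₁ + hammingNorm b + nnz W₂ + nnz W₃ + nnz W₄ ∧
      ∀ q : ℝ → Prop, q 0 → (∀ i j, q (W₁ i j)) → (∀ i, q (b i)) → (∀ i j, q (W₂ i j)) →
        (∀ i j, q (W₃ i j)) → (∀ i j, q (W₄ i j)) → ∀ a ∈ N.block.params, q a := by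
  obtain ⟨n, hn, e₀, he₀⟩ := exists_equiv_fin_castLE hf
  let e₁ := (Fintype.equivFin T₁).symm
  let e₂ := (Fintype.equivFin T₂).symm
  let e₃ := (Fintype.equivFin T₃).symm
  refine ⟨.ofLayers hn (W₁.submatrix e₁ e₀) (b ∘ e₁) (W₂.submatrix e₂ e₁) (W₃.submatrix e₃ e₂)
    (W₄.submatrix e₀ e₃), fun t i => ?_, ?_, fun q hq h₁ hb h₂ h₃ h₄ => ?_⟩
  · rw [LNN.state_ofLayers, loopState_submatrix]
    exact congrArg _ (he₀ i)
  · simp only [LNN.zeroNorm_ofLayers, nnz_submatrix, hammingNorm_comp_equiv]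
  · exact LNN.forall_mem_params_ofLayers _ _ _ _ _ _ hq (fun _ _ => h₁ _ _) (fun _ => hb _)
      (fun _ _ => h₂ _ _) (fun _ _ => h₃ _ _) fun _ _ => h₄ _ _

end Layers

/-! ### Integer networks and copies of neurons -/

section Expand

variable {I J : Type*}

/-- The matrix with entries `0` and `± δ` in which neuron `i` has `μ i` copies and a weight `a`
is distributed over `|a|` copies of its source. -/
noncomputable def expandMat (δ : ℝ) (A : Matrix I J ℤ) (μ : I → ℕ) (ν : J → ℕ) :
    Matrix (Σ i, Fin (μ i)) (Σ j, Fin (ν j)) ℝ :=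
  fun x y => if (y.2 : ℕ) < (A x.1 y.1).natAbs then δ * (A x.1 y.1).sign else 0

lemma expandMat_apply_mem (δ : ℝ) (A : Matrix I J ℤ) (μ : I → ℕ) (ν : J → ℕ) (x : Σ i, Fin (μ i))
    (y : Σ j, Fin (ν j)) : expandMat δ A μ ν x y ∈ ({0, δ, -δ} : Set ℝ) := by
  rw [expandMat]
  split_ifs
  · rcases Int.sign_trichotomy (A x.1 y.1) with h | h | h <;> simp [h]
  · exact .inl rfl

lemma hammingNorm_expandMat_le [Fintype J] (δ : ℝ) (A : Matrix I J ℤ) (μ : I → ℕ) (ν : J → ℕ)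
    (x : Σ i, Fin (μ i)) :
    hammingNorm (expandMat δ A μ ν x) ≤ ∑ j, (A x.1 j).natAbs := by
  rw [hammingNorm_sigma]
  refine Finset.sum_le_sum fun j _ => ?_
  calc hammingNorm (fun r => expandMat δ A μ ν x ⟨j, r⟩)
      ≤ (Finset.univ.filter fun r : Fin (ν j) => (r : ℕ) < (A x.1 j).natAbs).card := by
        refine Finset.card_le_card (Finset.monotone_filter_right _ fun r _ hr => ?_)
        by_contra h
        exact hr (if_neg h)
    _ ≤ (A x.1 j).natAbs := by
        rw [Fin.card_filter_val_lt]
        exact min_le_right _ _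

lemma nnz_expandMat_le [Fintype I] [Fintype J] (δ : ℝ) (A : Matrix I J ℤ) (μ : I → ℕ) (ν : J → ℕ) :
    nnz (expandMat δ A μ ν) ≤ ∑ i, μ i * ∑ j, (A i j).natAbs := by
  refine (Finset.sum_le_sum fun x _ => hammingNorm_expandMat_le δ A μ ν x).trans_eq ?_
  simp only [Fintype.sum_sigma, Finset.sum_const, Finset.card_univ, Fintype.card_fin, smul_eq_mul]

lemma hammingNorm_copies_le [Fintype I] {b : I → ℝ} {c : I → ℕ} (h : ∀ i, b i ≠ 0 → 1 ≤ c i)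
    (μ : I → ℕ) : hammingNorm (fun x : Σ i, Fin (μ i) => b x.1) ≤ ∑ i, μ i * c i := by
  rw [hammingNorm_sigma]
  refine Finset.sum_le_sum fun i _ => ?_
  by_cases hi : b i = 0
  · simp [hammingNorm, hi]
  · refine hammingNorm_le_card_fintype.trans ?_
    rw [Fintype.card_fin]
    exact Nat.le_mul_of_pos_right _ (h i hi)

variable [Fintype J]

/-- The values at the point `x` of the linear forms with integer coefficients. -/
noncomputable abbrev evalForm (x : J → ℝ) : (J → ℤ) →ₗ[ℤ] ℝ := Fintype.linearCombination ℤ x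

lemma evalForm_apply (x : J → ℝ) (r : J → ℤ) : evalForm x r = ∑ j, r j * x j := by
  simp only [Fintype.linearCombination_apply, zsmul_eq_mul]

lemma evalForm_smul (a : ℝ) (x : J → ℝ) (r : J → ℤ) :
    evalForm (fun j => a * x j) r = a * evalForm x r := by
  simp only [evalForm_apply, Finset.mul_sum, mul_left_comm]

lemma expandMat_mulVec (δ : ℝ) {A : Matrix I J ℤ} {μ : I → ℕ} {ν : J → ℕ}
    (h : ∀ i j, (A i j).natAbs ≤ ν j) (v : J → ℝ) (x : Σ i, Fin (μ i)) :
    (expandMat δ A μ ν).mulVec (fun y => v y.1) x = δ * evalForm v (A x.1) := by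
  simp only [Matrix.mulVec, dotProduct, expandMat]
  rw [Fintype.sum_sigma, evalForm_apply, Finset.mul_sum]
  refine Finset.sum_congr rfl fun j _ => ?_
  have habs : ((A x.1 j).natAbs : ℝ) * (A x.1 j).sign = A x.1 j := by
    rw [← Int.cast_natCast, ← Int.cast_mul, mul_comm, Int.sign_mul_natAbs]
  simp only [ite_mul, zero_mul]
  rw [← Finset.sum_filter, Finset.sum_const, Fin.card_filter_val_lt, min_eq_right (h _ _),
    nsmul_eq_mul]
  linear_combination δ * v j * habs

/-- One layer of an integer network. -/
noncomputable def intLayer (A : Matrix I J ℤ) (b : I → ℝ) (x : J → ℝ) (i : I) : ℝ :=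
  max (evalForm x (A i) + b i) 0

variable {δ c : ℝ} {A : Matrix I J ℤ} {μ : I → ℕ} {ν : J → ℕ}

lemma reluLayer_expandMat (hδ : 0 ≤ δ) (hc : 0 < c) (h : ∀ i j, (A i j).natAbs ≤ ν j)
    (b : I → ℝ) (v : J → ℝ) :
    reluLayer (expandMat δ A μ ν) (fun x => δ * b x.1) (fun y => c * v y.1) =
      fun x => c * δ * intLayer A (fun i => c⁻¹ * b i) v x.1 := by
  funext x
  rw [reluLayer, Pi.add_apply, expandMat_mulVec δ h fun j => c * v j, intLayer, evalForm_smul,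
    mul_max_of_nonneg _ _ (by positivity), mul_zero]
  congr 1
  field_simp

lemma reluLayer_expandMat_zero (hδ : 0 ≤ δ) (hc : 0 < c) (h : ∀ i j, (A i j).natAbs ≤ ν j)
    (v : J → ℝ) :
    reluLayer (expandMat δ A μ ν) 0 (fun y => c * v y.1) =
      fun x => c * δ * intLayer A 0 v x.1 := by
  have h0 := reluLayer_expandMat hδ hc (μ := μ) h 0 v
  simp only [Pi.zero_apply, mul_zero] at h0
  exact h0

variable {I₁ I₂ I₃ : Type*} [Fintype I₁] [Fintype I₂] [Fintype I₃]

/-- The states of an integer network with three hidden layers, the bias of the first layer being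
divided by `ε` at each iteration. -/
noncomputable def intState (ε : ℝ) (A₁ : Matrix I₁ J ℤ) (b : I₁ → ℕ) (A₂ : Matrix I₂ I₁ ℤ)
    (A₃ : Matrix I₃ I₂ ℤ) (A₄ : Matrix J I₃ ℤ) : ℕ → J → ℝ
  | 0 => 0
  | t + 1 => fun j => evalForm (intLayer A₃ 0 (intLayer A₂ 0 (intLayer A₁
      (fun i => (ε ^ t)⁻¹ * b i) (intState ε A₁ b A₂ A₃ A₄ t)))) (A₄ j)

variable {A₁ : Matrix I₁ J ℤ} {A₂ : Matrix I₂ I₁ ℤ} {A₃ : Matrix I₃ I₂ ℤ} {A₄ : Matrix J I₃ ℤ}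
  {μ : J → ℕ} {μ₁ : I₁ → ℕ} {μ₂ : I₂ → ℕ} {μ₃ : I₃ → ℕ}

lemma loopState_expandMat (hδ : 0 < δ) (b : I₁ → ℕ)
    (h₁ : ∀ i j, (A₁ i j).natAbs ≤ μ j) (h₂ : ∀ i j, (A₂ i j).natAbs ≤ μ₁ j)
    (h₃ : ∀ i j, (A₃ i j).natAbs ≤ μ₂ j) (h₄ : ∀ i j, (A₄ i j).natAbs ≤ μ₃ j) (t : ℕ) :
    loopState (expandMat δ A₁ μ₁ μ) (fun x => δ * b x.1) (expandMat δ A₂ μ₂ μ₁)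
      (expandMat δ A₃ μ₃ μ₂) (expandMat δ A₄ μ μ₃) t =
      fun x => (δ ^ 4) ^ t * intState (δ ^ 4) A₁ b A₂ A₃ A₄ t x.1 := by
  induction t with
  | zero => simp only [loopState, intState, Pi.zero_apply, mul_zero]; rfl
  | succ t ih =>
    have hc : 0 < (δ ^ 4) ^ t := by positivity
    rw [loopState, ih, reluLayer_expandMat hδ.le hc h₁ fun i => (b i : ℝ),
      reluLayer_expandMat_zero hδ.le (by positivity) h₂,
      reluLayer_expandMat_zero hδ.le (by positivity) h₃]
    funext x
    refine (expandMat_mulVec δ (μ := μ) h₄ (fun i => (δ ^ 4) ^ t * δ * δ * δ * intLayer A₃ 0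
      (intLayer A₂ 0 (intLayer A₁ _ (intState (δ ^ 4) A₁ b A₂ A₃ A₄ t))) i) x).trans ?_
    rw [intState, evalForm_smul]
    ring

lemma fixedPrecision_of_mem {M a : ℝ} (hδ : 0 ≤ δ) (hδM : δ ≤ M) (ha : a ∈ ({0, δ, -δ} : Set ℝ)) :
    (∃ z : ℤ, a = δ * z) ∧ |a| ≤ M := by
  rcases ha with rfl | rfl | rfl
  · exact ⟨⟨0, by simp⟩, by simpa using hδ.trans hδM⟩
  · exact ⟨⟨1, by simp⟩, by rwa [abs_of_nonneg hδ]⟩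
  · exact ⟨⟨-1, by simp⟩, by rwa [abs_neg, abs_of_nonneg hδ]⟩

lemma exists_network_of_int {M : ℝ} (hδ : 0 < δ) (hδM : δ ≤ M) {b : I₁ → ℕ} (hb : ∀ i, b i ≤ 1)
    (h₁ : ∀ i j, (A₁ i j).natAbs ≤ μ j) (h₂ : ∀ i j, (A₂ i j).natAbs ≤ μ₁ j)
    (h₃ : ∀ i j, (A₃ i j).natAbs ≤ μ₂ j) (h₄ : ∀ i j, (A₄ i j).natAbs ≤ μ₃ j)
    {f : Fin 3 → J} (hf : Function.Injective f) (hμ : ∀ i, 0 < μ (f i)) :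
    ∃ N : LNN, N.FixedPrecision δ M ∧
      (∀ t i, 0 < N.state t (Fin.castLE N.three_le i) ↔
        0 < intState (δ ^ 4) A₁ b A₂ A₃ A₄ t (f i)) ∧
      N.zeroNorm ≤ (∑ i, μ₁ i * ∑ j, (A₁ i j).natAbs) + (∑ i, μ₁ i * b i) +
        (∑ i, μ₂ i * ∑ j, (A₂ i j).natAbs) + (∑ i, μ₃ i * ∑ j, (A₃ i j).natAbs) +
        (∑ i, μ i * ∑ j, (A₄ i j).natAbs) := by
  obtain ⟨N, hstate, hnorm, hparams⟩ := exists_looped_network (expandMat δ A₁ μ₁ μ)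
    (fun x => δ * b x.1) (expandMat δ A₂ μ₂ μ₁) (expandMat δ A₃ μ₃ μ₂) (expandMat δ A₄ μ μ₃)
    (f := fun i => ⟨f i, ⟨0, hμ i⟩⟩) fun i j h => hf (congrArg Sigma.fst h)
  refine ⟨N, fun a ha => fixedPrecision_of_mem hδ.le hδM ?_, fun t i => ?_, hnorm.trans_le ?_⟩
  · refine hparams (· ∈ ({0, δ, -δ} : Set ℝ)) (.inl rfl) (expandMat_apply_mem δ A₁ μ₁ μ)
      (fun x => ?_) (expandMat_apply_mem δ A₂ μ₂ μ₁) (expandMat_apply_mem δ A₃ μ₃ μ₂)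
      (expandMat_apply_mem δ A₄ μ μ₃) a ha
    rcases Nat.le_one_iff_eq_zero_or_eq_one.1 (hb x.1) with h | h <;> simp [h]
  · rw [hstate, loopState_expandMat hδ b h₁ h₂ h₃ h₄]
    exact mul_pos_iff_of_pos_left (by positivity)
  · have hbias : hammingNorm (fun x : Σ i, Fin (μ₁ i) => δ * (b x.1 : ℝ)) ≤ ∑ i, μ₁ i * b i :=
      hammingNorm_copies_le (b := fun i => δ * (b i : ℝ))
        (fun i hi => Nat.one_le_iff_ne_zero.2 (by simpa [hδ.ne'] using hi)) μ₁
    gcongr <;> exact nnz_expandMat_le ..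

end Expand

/-! ### Stack machines -/

/-- A finite multi-stack machine. A state reads the top of one stack, and then keeps that stack
(`none`), pops it (`some none`) or pushes a symbol (`some (some a)`). A state may emit a bit or
halt. -/
structure StackMachine (Q K Γ : Type) where
  start : Q
  input : K
  stack : Q → K
  next : Q → Option Γ → Q
  act : Q → Option Γ → Option (Option Γ)
  halts : Q → Bool
  emits : Q → Option Bool

/-- The effect on a stack of an action of a stack machine. -/
def applyAct {Γ : Type} : Option (Option Γ) → List Γ → List Γ
  | none, l => l
  | some none, l => l.tail
  | some (some a), l => a :: l

namespace StackMachine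

variable {Q K Γ : Type} (M : StackMachine Q K Γ)

/-- The values of the channels `halt`, `emit` and `bit` in a state of a stack machine. -/
def channel (q : Q) : Fin 3 → Bool :=
  ![M.halts q, (M.emits q).isSome, (M.emits q).getD false]

variable [DecidableEq K]

/-- One step of a stack machine. -/
def step (c : Q × (K → List Γ)) : Q × (K → List Γ) :=
  (M.next c.1 (c.2 (M.stack c.1)).head?, Function.update c.2 (M.stack c.1)
    (applyAct (M.act c.1 (c.2 (M.stack c.1)).head?) (c.2 (M.stack c.1))))

/-- `M.Run c s` holds if the stack machine `M`, started in the configuration `c`, halts after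
emitting the bits `s`. -/
inductive Run : Q × (K → List Γ) → List Bool → Prop
  | halt {c} (h : M.halts c.1 = true) : Run c []
  | step {c s} (h : M.halts c.1 = false) (hs : Run (M.step c) s) :
      Run c ((M.emits c.1).toList ++ s)

variable {M}

lemma Run.mem_streamOutput {c : Q × (K → List Γ)} {s : List Bool} (hrun : M.Run c s)
    {χ : ℕ → Fin 3 → Bool} (hχ : ∀ i, χ (i + 1) = M.channel (M.step^[i] c).1) :
    s ∈ streamOutput (χ · 0) (χ · 1) (χ · 2) := by
  induction hrun generalizing χ with
  | halt hhalts =>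
    have hfirst := hχ 0
    exact LoopedNet.mem_streamOutput.2
      ⟨0, (congrFun hfirst 0).trans hhalts, fun i hi => absurd hi i.not_lt_zero, rfl⟩
  | @step c s hhalts _ ih =>
    have hfirst : χ 1 = M.channel c.1 := hχ 0
    have hbits : (bif χ 1 1 then [χ 1 2] else []) = (M.emits c.1).toList := by
      rw [hfirst]
      rcases hemits : M.emits c.1 with _ | b <;> simp [channel, hemits]
    rw [← hbits]
    exact append_mem_streamOutput (emit := (χ · 1)) (bit := (χ · 2))
      ((congrFun hfirst 0).trans hhalts) (ih fun i => hχ (i + 1))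

end StackMachine

section Frac

variable {Γ : Type} [Fintype Γ]

/-- The digit that codes an optional symbol, `0` for no symbol. -/
noncomputable def digit : Option Γ → ℕ
  | none => 0
  | some a => (Fintype.equivFin Γ a : ℕ) + 1

lemma digit_le (o : Option Γ) : digit o ≤ Fintype.card Γ := by
  cases o with
  | none => exact Nat.zero_le _
  | some a => exact (Fintype.equivFin Γ a).2

lemma digit_injective : Function.Injective (digit : Option Γ → ℕ) := by
  rintro (_ | a) (_ | b) h
  · rfl
  · exact absurd h (Nat.succ_ne_zero _).symm
  · exact absurd h (Nat.succ_ne_zero _)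
  · rw [(Fintype.equivFin Γ).injective (Fin.ext (Nat.succ_injective h))]

/-- The fraction in base `B` that codes a stack, its top being the leading digit. -/
noncomputable def frac (B : ℕ) : List Γ → ℝ
  | [] => 0
  | a :: l => (digit (some a) + frac B l) / B

variable {B : ℕ} (hB : 2 * Fintype.card Γ + 2 ≤ B)
include hB

lemma two_mul_digit_add_two_le (o : Option Γ) : 2 * (digit o : ℝ) + 2 ≤ B := by
  have hdigit := digit_le o
  exact_mod_cast (by omega : 2 * digit o + 2 ≤ B)

lemma base_pos : (0 : ℝ) < B := by
  exact_mod_cast (by omega : 0 < B)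

lemma frac_nonneg (l : List Γ) : 0 ≤ frac B l := by
  induction l with
  | nil => exact le_rfl
  | cons a l ih => exact div_nonneg (add_nonneg (Nat.cast_nonneg _) ih) (base_pos hB).le

lemma frac_le_half (l : List Γ) : frac B l ≤ 1 / 2 := by
  induction l with
  | nil => norm_num [frac]
  | cons a l ih =>
    rw [frac, div_le_iff₀ (base_pos hB)]
    linarith [two_mul_digit_add_two_le hB (some a)]

lemma mul_frac (l : List Γ) : B * frac B l = digit l.head? + frac B l.tail := by
  cases l with
  | nil => simp [frac, digit]
  | cons a l => exact mul_div_cancel₀ _ (base_pos hB).ne'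

/-- With `d` the top digit, `2 * B * (v * frac B l)` lies between `2 * d * v` and
`(2 * d + 1) * v`, hence above both thresholds or below both. -/
lemma relu_sub_relu_frac {v : ℝ} (hv : 0 ≤ v) (l : List Γ) (j : ℕ) :
    max (2 * B * (v * frac B l) - (2 * j - 1) * v) 0 - max (2 * B * (v * frac B l) - 2 * j * v) 0 =
      if j ≤ digit l.head? then v else 0 := by
  have hcode : 2 * B * (v * frac B l) = v * (2 * (digit l.head? + frac B l.tail)) := by
    rw [← mul_frac hB l]
    ring
  have hnonneg := frac_nonneg hB l.tail
  have hhalf := frac_le_half hB l.tail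
  rw [hcode]
  split_ifs with h
  · have h' : (j : ℝ) ≤ digit l.head? := by exact_mod_cast h
    rw [max_eq_left (by nlinarith), max_eq_left (by nlinarith)]
    ring
  · have h' : (digit l.head? : ℝ) + 1 ≤ j := by exact_mod_cast not_le.1 h
    rw [max_eq_right (by nlinarith), max_eq_right (by nlinarith), sub_zero]

lemma relu_head_eq [DecidableEq Γ] {v : ℝ} (hv : 0 ≤ v) (l : List Γ) (o : Option Γ)
    {θ : Fin 4 → ℝ}
    (hθ : ∀ i, θ i = max (2 * B * (v * frac B l) - (2 * digit o - 1 + i.val) * v) 0) :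
    θ 0 - θ 1 - (θ 2 - θ 3) = if l.head? = o then v else 0 := by
  have hle : θ 0 - θ 1 = if digit o ≤ digit l.head? then v else 0 := by
    rw [hθ, hθ, ← relu_sub_relu_frac hB hv l (digit o), Fin.val_zero, Fin.val_one]
    push_cast
    ring_nf
  have hlt : θ 2 - θ 3 = if digit o + 1 ≤ digit l.head? then v else 0 := by
    rw [hθ, hθ, ← relu_sub_relu_frac hB hv l (digit o + 1), Fin.val_two,
      show ((3 : Fin 4) : ℕ) = 3 from rfl]
    push_cast
    ring_nf
  have heq : l.head? = o ↔ digit o = digit l.head? := digit_injective.eq_iff.symm.trans eq_comm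
  rw [hle, hlt, if_congr heq rfl rfl]
  split_ifs <;> first | omega | simp

lemma frac_take_succ (l : List Γ) (i : ℕ) :
    (B : ℝ) ^ (i + 1) * frac B (l.take (i + 1)) =
      B * (B ^ i * frac B (l.take i)) + digit l[i]? := by
  have hB0 := (base_pos hB).ne'
  induction l generalizing i with
  | nil => simp [frac, digit]
  | cons a l ih =>
    cases i with
    | zero => simp [frac, mul_div_cancel₀ _ hB0]
    | succ i =>
      simp only [List.take_succ_cons, frac, List.getElem?_cons_succ]
      rw [pow_succ (B : ℝ) (i + 1), mul_assoc, mul_div_cancel₀ _ hB0, mul_add, ih i]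
      field_simp
      ring

lemma frac_take_add (l : List Γ) (i n : ℕ) :
    (B : ℝ) ^ (i + n) * frac B (l.take (i + n)) =
      B ^ n * (B ^ i * frac B (l.take i)) +
        ∑ j : Fin n, (digit l[i + (j : ℕ)]? : ℝ) * B ^ (n - 1 - (j : ℕ)) := by
  induction n with
  | zero => simp
  | succ n ih =>
    have hshift (j : Fin n) : (B : ℝ) * (digit l[i + (j : ℕ)]? * B ^ (n - 1 - (j : ℕ))) =
        digit l[i + (j : ℕ)]? * B ^ (n - (j : ℕ)) := by
      rw [show n - (j : ℕ) = n - 1 - j + 1 by omega, pow_succ']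
      ring
    rw [← add_assoc, frac_take_succ hB, ih, Fin.sum_univ_castSucc, mul_add, Finset.mul_sum]
    simp only [Fin.val_castSucc, Fin.val_last, Nat.add_sub_cancel, Nat.sub_self, pow_zero, mul_one,
      hshift]
    ring

end Frac

/-! ### The network that simulates a stack machine -/

section Forms

variable {I J ι : Type*} [Fintype J] {m : ℕ}

/-- The coordinate `j`, as an integer linear form. -/
def coord [DecidableEq J] (j : J) : J → ℤ := Pi.single j 1

lemma evalForm_ite (x : J → ℝ) (p : Prop) [Decidable p] (r r' : J → ℤ) :
    evalForm x (if p then r else r') = if p then evalForm x r else evalForm x r' :=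
  apply_ite _ _ _ _

lemma evalForm_zsmul (x : J → ℝ) (n : ℤ) (r : J → ℤ) : evalForm x (n • r) = n * evalForm x r := by
  rw [map_zsmul, zsmul_eq_mul]

lemma evalForm_coord [DecidableEq J] (x : J → ℝ) (j : J) : evalForm x (coord j) = x j := by
  rw [coord, Fintype.linearCombination_apply_single, one_smul]

/-- The sum of the coordinates `f a` over all `a` that satisfy `p`. -/
def coordSum [DecidableEq J] [Fintype ι] (p : ι → Prop) [DecidablePred p] (f : ι → J) : J → ℤ :=
  ∑ a, if p a then coord (f a) else 0

lemma evalForm_coordSum [DecidableEq J] [Fintype ι] (x : J → ℝ) (p : ι → Prop) [DecidablePred p]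
    (f : ι → J) : evalForm x (coordSum p f) = ∑ a, if p a then x (f a) else 0 := by
  simp only [coordSum, map_sum, evalForm_ite, evalForm_coord, map_zero]

lemma evalForm_sumElim (x : J → ℝ) (τ : Fin m → ℝ) (r : J ⊕ Fin m → ℤ) :
    evalForm (Sum.elim x τ) r = evalForm x (r ∘ .inl) + evalForm τ (r ∘ .inr) := by
  simp only [evalForm_apply, Fintype.sum_sum_type, Sum.elim_inl, Sum.elim_inr, Function.comp_apply]

lemma intLayer_fromBlocks {τ : Fin m → ℝ} (hτ : 0 ≤ τ) (A : Matrix I J ℤ)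
    (T : Matrix I (Fin m) ℤ) (b : I → ℝ) (x : J → ℝ) :
    intLayer (.fromBlocks A T 0 1) (Sum.elim b 0) (Sum.elim x τ) =
      Sum.elim (intLayer A (fun i => evalForm τ (T i) + b i) x) τ := by
  funext i
  rcases i with i | i
  · simp only [intLayer, evalForm_sumElim, Sum.elim_inl, ← add_assoc]
    rfl
  · have htape : evalForm τ ((1 : Matrix (Fin m) (Fin m) ℤ) i) = τ i := by
      rw [← evalForm_coord τ i]
      congr 1
      funext j
      simp only [Matrix.one_apply, coord, Pi.single_apply, eq_comm]
    simp only [intLayer, evalForm_sumElim, Sum.elim_inr, Pi.zero_apply, add_zero]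
    refine (congrArg (max · 0) ?_).trans (max_eq_left (hτ i))
    exact (congrArg₂ (· + ·) (map_zero (evalForm x)) htape).trans (zero_add _)

/-- The matrix that acts as `A` on the first coordinates and copies the `m` others. -/
def copyMatrix (m : ℕ) (A : Matrix I J ℤ) : Matrix (I ⊕ Fin m) (J ⊕ Fin m) ℤ :=
  .fromBlocks A 0 0 1

lemma intLayer_copyMatrix {τ : Fin m → ℝ} (hτ : 0 ≤ τ) (A : Matrix I J ℤ) (x : J → ℝ) :
    intLayer (copyMatrix m A) 0 (Sum.elim x τ) = Sum.elim (intLayer A 0 x) τ := by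
  have h := intLayer_fromBlocks hτ A 0 0 x
  rw [Sum.elim_zero_zero] at h
  rw [copyMatrix, h]
  congr 2
  funext i
  exact (add_zero _).trans (map_zero (evalForm τ))

end Forms

/-- The blocks of five input symbols that the network loads in one iteration, with a flag that
marks the last block. -/
abbrev Block (Γ : Type) : Type := (Fin 5 → Option Γ) × Bool

/-- The coordinates of the state of the network. In a configuration with unit `v`, a control
coordinate is `v` or `0`, and a stack coordinate is `v` times the fraction that codes the stack. -/
inductive StateIx (Q K : Type)
  | channel (i : Fin 3)
  | unit
  | clock
  | control (q : Q)
  | stack (k : K)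
  deriving DecidableEq, Fintype

/-- The neurons of the first hidden layer, which compare the stacks with thresholds, read the
input tape and test whether the clock has run out. -/
inductive ReadIx (Q K Γ : Type)
  | unit
  | threshold (k : K) (o : Option Γ) (i : Fin 4)
  | control (q : Q)
  | stack (k : K)
  | clock
  | clockExcess
  | launch
  | init
  | block (b : Block Γ)
  deriving DecidableEq, Fintype

/-- The neurons of the second hidden layer. The neuron `active (q, o)` is on if `q` is the control
state and `o` is the symbol that it reads. -/
inductive MatchIx (Q K Γ : Type)
  | unit
  | stack (k : K)
  | active (a : Q × Option Γ)
  | nextClock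
  | launch
  | init
  | block (b : Block Γ)
  deriving DecidableEq, Fintype

/-- The neurons of the third hidden layer, which hold the stack that the active state updates and
the stacks that it keeps. -/
inductive ActIx (Q K Γ : Type)
  | unit
  | active (a : Q × Option Γ)
  | updated (a : Q × Option Γ)
  | kept (k : K)
  | nextClock
  | launch
  | init
  | block (b : Block Γ)
  deriving DecidableEq, Fintype

namespace StackMachine

variable {Q K Γ : Type} [Fintype Γ]

/-- The coefficients of the affine map that an action performs on the fraction of a stack with
top `o`, up to the factor `B ^ 5` by which the unit grows in each iteration. -/
noncomputable def actCoeff (B : ℕ) (o : Option Γ) : Option (Option Γ) → ℤ × ℤ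
  | none => (B ^ 5, 0)
  | some none => (B ^ 6, -(B ^ 5 * digit o))
  | some (some a) => (B ^ 4, B ^ 4 * digit (some a))

/-- The number with the digits of a block. -/
noncomputable def blockValue (B : ℕ) (b : Block Γ) : ℕ :=
  ∑ j : Fin 5, digit (b.1 j) * B ^ (4 - (j : ℕ))

section ActCoeff

variable {B : ℕ} (hB : 2 * Fintype.card Γ + 2 ≤ B)
include hB

lemma actCoeff_mul_frac_add (l : List Γ) (a : Option (Option Γ)) :
    ((actCoeff B l.head? a).1 : ℝ) * frac B l + (actCoeff B l.head? a).2 =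
      B ^ 5 * frac B (applyAct a l) := by
  have hB0 := (base_pos hB).ne'
  rcases a with _ | _ | a
  · simp [actCoeff, applyAct]
  · simp only [actCoeff, applyAct]
    push_cast
    linear_combination (B : ℝ) ^ 5 * mul_frac hB l
  · simp only [actCoeff, applyAct, frac]
    push_cast
    field_simp
    ring

lemma actCoeff_mul_add_le {f : ℝ} (hf : f ≤ 1 / 2) (o : Option Γ) (a : Option (Option Γ)) :
    ((actCoeff B o a).1 : ℝ) * f + (actCoeff B o a).2 ≤ B ^ 6 := by
  have hB1 : (1 : ℝ) ≤ B := by exact_mod_cast (by omega : 1 ≤ B)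
  have hpow : (B : ℝ) ^ 5 ≤ B ^ 6 := pow_le_pow_right₀ hB1 (by norm_num)
  rcases a with _ | _ | a
  · simp only [actCoeff, Int.cast_pow, Int.cast_natCast, Int.cast_zero, add_zero]
    nlinarith [pow_nonneg (base_pos hB).le 5]
  · simp only [actCoeff, Int.cast_pow, Int.cast_natCast, Int.cast_neg, Int.cast_mul]
    have hdigit : (0 : ℝ) ≤ B ^ 5 * digit o := by positivity
    nlinarith [pow_nonneg (base_pos hB).le 6]
  · simp only [actCoeff, Int.cast_pow, Int.cast_natCast, Int.cast_mul]
    calc (B : ℝ) ^ 4 * f + B ^ 4 * digit (some a) = B ^ 4 * (f + digit (some a)) := by ring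
      _ ≤ (B : ℝ) ^ 4 * B := by
        gcongr
        linarith [two_mul_digit_add_two_le hB (some a), (digit (some a)).cast_nonneg (α := ℝ)]
      _ = (B : ℝ) ^ 5 := by ring
      _ ≤ (B : ℝ) ^ 6 := hpow

end ActCoeff

variable [Fintype Q] [DecidableEq Q] [DecidableEq K] [DecidableEq Γ] (M : StackMachine Q K Γ)
  (B C : ℕ)

/-- The weights of the first layer. -/
noncomputable def readMatrix : Matrix (ReadIx Q K Γ) (StateIx Q K) ℤ
  | .unit => coord .unit
  | .threshold k o i => (2 * B : ℤ) • coord (.stack k) - (2 * digit o - 1 + i.val : ℤ) • coord .unit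
  | .control q => coord (.control q)
  | .stack k => coord (.stack k)
  | .clock => coord .clock
  | .clockExcess => (B ^ 5 : ℤ) • coord .clock - coord .unit
  | .launch => (2 : ℤ) • coord .clock - coord .unit - (2 : ℤ) • ∑ q, coord (.control q)
  | .init => (-C : ℤ) • coord .unit
  | .block _ => 0

/-- The weights of the second layer. -/
def matchMatrix : Matrix (MatchIx Q K Γ) (ReadIx Q K Γ) ℤ
  | .unit => coord .unit
  | .stack k => coord (.stack k)
  | .active a => coord (.control a.1) + coord (.threshold (M.stack a.1) a.2 0) -
      coord (.threshold (M.stack a.1) a.2 1) - (coord (.threshold (M.stack a.1) a.2 2) -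
      coord (.threshold (M.stack a.1) a.2 3)) - coord .unit
  | .nextClock => (B ^ 5 : ℤ) • coord .clock - coord .clockExcess
  | .launch => coord .launch
  | .init => coord .init
  | .block b => coord (.block b)

/-- The weights of the third layer. -/
noncomputable def actMatrix : Matrix (ActIx Q K Γ) (MatchIx Q K Γ) ℤ
  | .unit => coord .unit
  | .active a => coord (.active a)
  | .updated a => (actCoeff B a.2 (M.act a.1 a.2)).1 • coord (.stack (M.stack a.1)) +
      (actCoeff B a.2 (M.act a.1 a.2)).2 • coord .unit -
      (B ^ 6 : ℤ) • (coord .unit - coord (.active a))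
  | .kept k => (B ^ 5 : ℤ) • coord (.stack k) -
      (B ^ 5 : ℤ) • coordSum (fun a => M.stack a.1 = k) .active
  | .nextClock => coord .nextClock
  | .launch => coord .launch
  | .init => coord .init
  | .block b => coord (.block b)

/-- The weights of the output layer. -/
noncomputable def outMatrix : Matrix (StateIx Q K) (ActIx Q K Γ) ℤ
  | .channel i => coordSum (fun a => M.channel a.1 i) .active
  | .unit => (B ^ 5 : ℤ) • coord .unit + coord .init
  | .clock => (B ^ 5 : ℤ) • coord .nextClock + coordSum (fun b : Block Γ => b.2) .block
  | .control q => (B ^ 5 : ℤ) • coordSum (fun a => M.next a.1 a.2 = q) .active +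
      if M.start = q then (B ^ 5 : ℤ) • coord .launch else 0
  | .stack k => coord (.kept k) + coordSum (fun a => M.stack a.1 = k) .updated +
      if M.input = k then ∑ b, (blockValue B b : ℤ) • coord (.block b) else 0

end StackMachine

lemma sum_ite_eq_some {α : Type*} [Fintype α] [DecidableEq α] (a₀ : Option α) (p : α → Prop)
    [DecidablePred p] (F : α → ℝ) :
    (∑ a, if p a then if a₀ = some a then F a else 0 else 0) =
      a₀.elim 0 fun a => if p a then F a else 0 := by
  rcases a₀ with _ | a₀
  · simp
  · rw [Finset.sum_eq_single_of_mem a₀ (Finset.mem_univ _)]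
    · simp
    · intro a _ ha
      simp [ha.symm]

namespace StackMachine

variable {Q K Γ : Type} (M : StackMachine Q K Γ)

/-- The control state together with the symbol that it reads. -/
def reading (σ : Option Q) (S : K → List Γ) : Option (Q × Option Γ) :=
  σ.map fun q => (q, (S (M.stack q)).head?)

variable [DecidableEq K]

/-- The stacks after a step, which are unchanged if the machine has not started. -/
def nextStacks (σ : Option Q) (S : K → List Γ) : K → List Γ :=
  σ.elim S fun q => (M.step (q, S)).2

/-- The control state after a step; the machine starts when the clock reaches the unit. -/
noncomputable def nextControl (v ζ : ℝ) (σ : Option Q) (S : K → List Γ) : Option Q :=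
  σ.elim (if ζ = v then some M.start else none) fun q => some (M.step (q, S)).1

variable {M} {σ : Option Q} {S : K → List Γ}

omit [DecidableEq K] in
lemma reading_eq_some_iff {a : Q × Option Γ} :
    M.reading σ S = some a ↔ σ = some a.1 ∧ (S (M.stack a.1)).head? = a.2 := by
  rcases σ with _ | q
  · simp [reading]
  · simp only [reading, Option.map_some, Option.some.injEq, Prod.ext_iff]
    constructor <;> rintro ⟨rfl, h⟩ <;> exact ⟨rfl, h⟩

lemma nextStacks_of_reading {a : Q × Option Γ} (ha : M.reading σ S = some a) :
    M.nextStacks σ S (M.stack a.1) = applyAct (M.act a.1 a.2) (S (M.stack a.1)) := by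
  obtain ⟨rfl, hhead⟩ := reading_eq_some_iff.1 ha
  rw [← hhead]
  exact Function.update_self ..

lemma nextStacks_of_ne {k : K} (hk : (M.reading σ S).map (fun a => M.stack a.1) ≠ some k) :
    M.nextStacks σ S k = S k := by
  rcases σ with _ | q
  · rfl
  · exact Function.update_of_ne (fun h => hk (congrArg some h.symm)) ..

section Vectors

variable [DecidableEq Q] [DecidableEq Γ]

/-- The network state with channels `χ`, unit `v`, clock `ζ`, control state `σ` (at level `c`) and
stack coordinates `y`. -/
def stateVec (χ : Fin 3 → ℝ) (v ζ c : ℝ) (σ : Option Q) (y : K → ℝ) : StateIx Q K → ℝ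
  | .channel i => χ i
  | .unit => v
  | .clock => ζ
  | .control q => if σ = some q then c else 0
  | .stack k => y k

/-- The amount of the block `b` on a tape `τ` whose cells carry the blocks `sym`. -/
def blockLoad {m : ℕ} (sym : Fin m → Block Γ) (τ : Fin m → ℝ) (b : Block Γ) : ℝ :=
  ∑ j, if b = sym j then τ j else 0

lemma sum_mul_blockLoad [Fintype Γ] {m : ℕ} (sym : Fin m → Block Γ) (τ : Fin m → ℝ)
    (c : Block Γ → ℝ) : ∑ b, c b * blockLoad sym τ b = ∑ j, c (sym j) * τ j := by
  simp only [blockLoad, Finset.mul_sum, mul_ite, mul_zero]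
  rw [Finset.sum_comm]
  simp only [Finset.sum_ite_eq', Finset.mem_univ, if_true]

/-- The values of the first hidden layer in the state `stateVec χ v ζ v σ y` with bias `β`, when
the tape delivers the blocks `w`. -/
noncomputable def readVec [Fintype Γ] (B C : ℕ) (v ζ β : ℝ) (σ : Option Q) (y : K → ℝ)
    (w : Block Γ → ℝ) : ReadIx Q K Γ → ℝ
  | .unit => v
  | .threshold k o i => max (2 * B * y k - (2 * digit o - 1 + i.val) * v) 0
  | .control q => if σ = some q then v else 0
  | .stack k => y k
  | .clock => ζ
  | .clockExcess => max (B ^ 5 * ζ - v) 0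
  | .launch => if σ = none ∧ ζ = v then v else 0
  | .init => max (β - C * v) 0
  | .block b => w b

/-- The values of the second hidden layer, where `a` is the control state with the symbol that it
reads. -/
noncomputable def matchVec (v ζ' l ι : ℝ) (a : Option (Q × Option Γ)) (y : K → ℝ)
    (w : Block Γ → ℝ) : MatchIx Q K Γ → ℝ
  | .unit => v
  | .stack k => y k
  | .active a' => if a = some a' then v else 0
  | .nextClock => ζ'
  | .launch => l
  | .init => ι
  | .block b => w b

variable (M)

/-- The values of the third hidden layer, where `y'` are the codes of the stacks after the
transition `a`. -/
noncomputable def actVec (v ζ' l ι : ℝ) (a : Option (Q × Option Γ))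
    (y' : K → ℝ) (w : Block Γ → ℝ) : ActIx Q K Γ → ℝ
  | .unit => v
  | .active a' => if a = some a' then v else 0
  | .updated a' => if a = some a' then y' (M.stack a'.1) else 0
  | .kept k => if a.map (fun a' => M.stack a'.1) = some k then 0 else y' k
  | .nextClock => ζ'
  | .launch => l
  | .init => ι
  | .block b => w b

end Vectors

variable [Fintype Γ] {B C : ℕ} {v ζ ζ' β l ι : ℝ} {w : Block Γ → ℝ}

section Relu

variable [DecidableEq Q]

/-- The term with `B ^ 6` vanishes for the active transition, and switches off all others. -/
lemma relu_updated [DecidableEq Γ] (hB : 2 * Fintype.card Γ + 2 ≤ B) (hv : 0 ≤ v)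
    (a : Q × Option Γ) :
    max ((actCoeff B a.2 (M.act a.1 a.2)).1 * (v * frac B (S (M.stack a.1))) +
        (actCoeff B a.2 (M.act a.1 a.2)).2 * v -
        B ^ 6 * (v - if M.reading σ S = some a then v else 0)) 0 =
      if M.reading σ S = some a then B ^ 5 * v * frac B (M.nextStacks σ S (M.stack a.1))
      else 0 := by
  split_ifs with ha
  · rw [nextStacks_of_reading ha]
    obtain ⟨-, hhead⟩ := reading_eq_some_iff.1 ha
    have hcode := actCoeff_mul_frac_add hB (S (M.stack a.1)) (M.act a.1 a.2)
    have hnonneg := frac_nonneg hB (applyAct (M.act a.1 a.2) (S (M.stack a.1)))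
    rw [hhead] at hcode
    rw [sub_self, mul_zero, sub_zero, mul_right_comm, ← hcode, max_eq_left]
    · ring
    · rw [mul_left_comm, mul_comm _ v, ← mul_add, hcode]
      positivity
  · refine max_eq_right ?_
    have hle := mul_le_mul_of_nonneg_left
      (actCoeff_mul_add_le hB (frac_le_half hB (S (M.stack a.1))) a.2 (M.act a.1 a.2)) hv
    linarith

variable [Fintype Q]

lemma relu_launch (hζ₀ : 0 ≤ ζ) (hζ₁ : ζ ≤ v) (hσ : σ = none → ζ = v ∨ 2 * ζ ≤ v) :
    max (2 * ζ - v - 2 * ∑ q, if σ = some q then v else 0) 0 =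
      if σ = none ∧ ζ = v then v else 0 := by
  rcases σ with _ | q
  · simp only [reduceCtorEq, if_false, Finset.sum_const_zero, mul_zero, sub_zero, true_and]
    rcases hσ rfl with rfl | hlow
    · rw [if_pos rfl, max_eq_left (by linarith)]
      ring
    · rw [max_eq_right (by linarith)]
      split_ifs with h <;> linarith
  · simp only [Option.some.injEq, Finset.sum_ite_eq, Finset.mem_univ, if_true, reduceCtorEq,
      false_and, if_false]
    exact max_eq_right (by linarith)

lemma relu_kept [DecidableEq Γ] (hB : 2 * Fintype.card Γ + 2 ≤ B) (hv : 0 ≤ v) (k : K) :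
    max (B ^ 5 * (v * frac B (S k)) -
        B ^ 5 * ∑ a, if M.stack a.1 = k then if M.reading σ S = some a then v else 0 else 0) 0 =
      if (M.reading σ S).map (fun a => M.stack a.1) = some k then 0
      else B ^ 5 * v * frac B (M.nextStacks σ S k) := by
  have hcode : 0 ≤ v * frac B (S k) := mul_nonneg hv (frac_nonneg hB _)
  have hle : v * frac B (S k) ≤ v := mul_le_of_le_one_right hv
    ((frac_le_half hB _).trans (by norm_num))
  have hsum : (∑ a, if M.stack a.1 = k then if M.reading σ S = some a then v else 0 else 0) =
      if (M.reading σ S).map (fun a => M.stack a.1) = some k then v else 0 := by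
    rw [sum_ite_eq_some]
    rcases M.reading σ S with _ | a <;> simp
  rw [hsum]
  split_ifs with hk
  · rw [← mul_sub]
    exact max_eq_right (mul_nonpos_of_nonneg_of_nonpos (by positivity) (sub_nonpos.2 hle))
  · rw [mul_zero, sub_zero, nextStacks_of_ne hk, mul_assoc]
    exact max_eq_left (by positivity)

end Relu

variable [Fintype Q] [Fintype K] [DecidableEq Q]

lemma intLayer_readMatrix (χ : Fin 3 → ℝ) {y : K → ℝ} (hv : 0 ≤ v) (hζ₀ : 0 ≤ ζ)
    (hζ₁ : ζ ≤ v) (hσ : σ = none → ζ = v ∨ 2 * ζ ≤ v) (hy : ∀ k, 0 ≤ y k) (hw : ∀ b, 0 ≤ w b)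
    {b : ReadIx Q K Γ → ℝ}
    (hb : ∀ i, b i = match i with
      | .init => β
      | .block b => w b
      | _ => 0) :
    intLayer (readMatrix B C) b (stateVec χ v ζ v σ y) = readVec B C v ζ β σ y w := by
  have hcontrol (q : Q) : 0 ≤ if σ = some q then v else 0 := by
    split_ifs
    exacts [hv, le_rfl]
  funext i
  rw [intLayer, hb]
  cases i <;>
    simp only [readMatrix, readVec, stateVec, evalForm_coord, map_sub, map_sum, map_zero,
      evalForm_zsmul, add_zero, zero_add, max_eq_left, hv, hζ₀, hcontrol, hy, hw]
  case threshold => push_cast; rfl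
  case clockExcess => push_cast; rfl
  case launch => push_cast; exact relu_launch hζ₀ hζ₁ hσ
  case init => push_cast; ring_nf

variable [DecidableEq Γ]

lemma intLayer_matchMatrix (hB : 2 * Fintype.card Γ + 2 ≤ B) (hv : 0 ≤ v) (hζ : 0 ≤ ζ)
    (hw : ∀ b, 0 ≤ w b) :
    intLayer (M.matchMatrix B) 0 (readVec B C v ζ β σ (fun k => v * frac B (S k)) w) =
      matchVec v (min (B ^ 5 * ζ) v) (if σ = none ∧ ζ = v then v else 0) (max (β - C * v) 0)
        (M.reading σ S) (fun k => v * frac B (S k)) w := by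
  have hlaunch : 0 ≤ if σ = none ∧ ζ = v then v else 0 := by
    split_ifs
    exacts [hv, le_rfl]
  have hstack (k : K) : 0 ≤ v * frac B (S k) := mul_nonneg hv (frac_nonneg hB _)
  have hclock : max (B ^ 5 * ζ - max (B ^ 5 * ζ - v) 0) 0 = min (B ^ 5 * ζ) v := by
    rw [← min_sub_sub_left, sub_sub_cancel, sub_zero, min_comm]
    exact max_eq_left (le_min (by positivity) hv)
  funext i
  rw [intLayer]
  cases i <;>
    simp only [matchMatrix, matchVec, readVec, evalForm_coord, evalForm_zsmul, map_sub, map_add,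
      Pi.zero_apply, add_zero, max_eq_left, hv, hstack, hlaunch, hw, le_max_right]
  case active a =>
    have hhead := relu_head_eq hB hv (S (M.stack a.1)) a.2 fun _ => rfl
    rw [if_congr reading_eq_some_iff rfl rfl]
    trans max ((if σ = some a.1 then v else 0) +
      (if (S (M.stack a.1)).head? = a.2 then v else 0) - v) 0
    · rw [← hhead]
      ring_nf
    · split_ifs <;> simp_all
  case nextClock => exact_mod_cast hclock

lemma intLayer_actMatrix (hB : 2 * Fintype.card Γ + 2 ≤ B) (hv : 0 ≤ v) (hζ' : 0 ≤ ζ')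
    (hl : 0 ≤ l) (hι : 0 ≤ ι) (hw : ∀ b, 0 ≤ w b) :
    intLayer (M.actMatrix B) 0
        (matchVec v ζ' l ι (M.reading σ S) (fun k => v * frac B (S k)) w) =
      M.actVec v ζ' l ι (M.reading σ S) (fun k => B ^ 5 * v * frac B (M.nextStacks σ S k)) w := by
  have hactive (a : Q × Option Γ) : 0 ≤ if M.reading σ S = some a then v else 0 := by
    split_ifs
    exacts [hv, le_rfl]
  funext i
  rw [intLayer]
  cases i <;>
    simp only [actMatrix, actVec, matchVec, evalForm_coord, evalForm_zsmul, map_sub, map_add,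
      evalForm_coordSum, Pi.zero_apply, add_zero, max_eq_left, hv, hζ', hl, hι, hw, hactive]
  case updated a => exact_mod_cast relu_updated hB hv a
  case kept k => exact_mod_cast relu_kept hB hv k

lemma evalForm_outMatrix {m : ℕ} (sym : Fin m → Block Γ) (τ : Fin m → ℝ) (y : K → ℝ)
    (i : StateIx Q K) :
    evalForm (M.actVec v ζ' (if σ = none ∧ ζ = v then v else 0) ι (M.reading σ S) y
        (blockLoad sym τ)) (M.outMatrix B i) =
      stateVec (fun i => σ.elim 0 fun q => if M.channel q i then v else 0) (B ^ 5 * v + ι)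
        (B ^ 5 * ζ' + ∑ j, if (sym j).2 then τ j else 0) (B ^ 5 * v) (M.nextControl v ζ σ S)
        (fun k => y k + if M.input = k then ∑ j, blockValue B (sym j) * τ j else 0) i := by
  cases i <;>
    simp only [outMatrix, stateVec, actVec, evalForm_coord, evalForm_zsmul, map_add,
      evalForm_coordSum, evalForm_ite, map_sum, map_zero, sum_ite_eq_some]
  case channel => cases σ <;> rfl
  case unit => push_cast; rfl
  case clock =>
    have hlast := sum_mul_blockLoad sym τ fun b => if b.2 then 1 else 0
    simp only [ite_mul, one_mul, zero_mul] at hlast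
    rw [hlast]
    push_cast
    rfl
  case control q =>
    rcases σ with _ | q'
    · by_cases hstart : M.start = q <;> by_cases hζ : ζ = v <;>
        simp [reading, nextControl, hstart, hζ]
    · simp [reading, nextControl, step]
  case stack k =>
    simp only [Int.cast_natCast, sum_mul_blockLoad sym τ fun b => (blockValue B b : ℝ)]
    congr 1
    rcases M.reading σ S with _ | a
    · simp
    · by_cases hk : M.stack a.1 = k <;> simp [hk]

end StackMachine

namespace StackMachine

section Tape

variable {Q K Γ : Type} [Fintype Q] [Fintype K] [Fintype Γ] [DecidableEq Q] [DecidableEq K]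
  [DecidableEq Γ] {m : ℕ}

/-- The first layer of the network with an input tape whose cells carry the blocks `sym`. The
tape is a copied part of the state in which a single active cell moves to the right. -/
noncomputable def tapeReadMatrix (B C : ℕ) (sym : Fin m → Block Γ) :
    Matrix (ReadIx Q K Γ ⊕ Fin m) (StateIx Q K ⊕ Fin m) ℤ :=
  .fromBlocks (readMatrix B C) (.of fun i j => if i = .block (sym j) then 1 else 0) 0 1

/-- The bias of the first layer, which only feeds the neuron that starts the first iteration. -/
def tapeBias (Q K Γ : Type) [DecidableEq Q] [DecidableEq K] [DecidableEq Γ] (m : ℕ) :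
    ReadIx Q K Γ ⊕ Fin m → ℕ :=
  Sum.elim (Pi.single .init 1) 0

variable (M : StackMachine Q K Γ) (B C : ℕ)

/-- The output layer, which also moves the active cell of the tape by one position. -/
noncomputable def tapeOutMatrix (m : ℕ) : Matrix (StateIx Q K ⊕ Fin m) (ActIx Q K Γ ⊕ Fin m) ℤ :=
  .fromBlocks (M.outMatrix B) 0 (.of fun i j => if i.val = 0 ∧ j = .init then 1 else 0)
    (.of fun i j => if i.val = j.val + 1 then 1 else 0)

/-- One iteration of the network, where `β` is the value of the bias. -/
noncomputable def netStep (sym : Fin m → Block Γ) (β : ℝ) (x : StateIx Q K ⊕ Fin m → ℝ) :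
    StateIx Q K ⊕ Fin m → ℝ :=
  fun j => evalForm (intLayer (copyMatrix m (M.actMatrix B)) 0
    (intLayer (copyMatrix m (M.matchMatrix B)) 0
      (intLayer (tapeReadMatrix B C sym) (fun i => β * tapeBias Q K Γ m i) x)))
    (M.tapeOutMatrix B m j)

variable {B C}

lemma intLayer_tapeReadMatrix (sym : Fin m → Block Γ) {v ζ : ℝ} (β : ℝ) (χ : Fin 3 → ℝ)
    {σ : Option Q} {y : K → ℝ} {τ : Fin m → ℝ} (hv : 0 ≤ v) (hζ₀ : 0 ≤ ζ) (hζ₁ : ζ ≤ v)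
    (hσ : σ = none → ζ = v ∨ 2 * ζ ≤ v) (hy : ∀ k, 0 ≤ y k) (hτ : 0 ≤ τ) :
    intLayer (tapeReadMatrix B C sym) (fun i => β * tapeBias Q K Γ m i)
        (Sum.elim (stateVec χ v ζ v σ y) τ) =
      Sum.elim (readVec B C v ζ β σ y (blockLoad sym τ)) τ := by
  have hbias : (fun i => β * (tapeBias Q K Γ m i : ℝ)) =
      Sum.elim (fun i => β * ((Pi.single .init 1 : ReadIx Q K Γ → ℕ) i : ℝ)) 0 := by
    funext i
    rcases i with i | i <;> simp [tapeBias]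
  rw [tapeReadMatrix, hbias, intLayer_fromBlocks hτ]
  congr 1
  refine intLayer_readMatrix χ hv hζ₀ hζ₁ hσ hy
    (fun b => Finset.sum_nonneg fun j _ => ite_nonneg (hτ j) le_rfl) fun i => ?_
  rw [evalForm_apply]
  cases i <;> simp

lemma netStep_stateVec (hB : 2 * Fintype.card Γ + 2 ≤ B) (sym : Fin m → Block Γ) {v ζ : ℝ} (β : ℝ)
    (χ : Fin 3 → ℝ) {σ : Option Q} (S : K → List Γ) {τ : Fin m → ℝ} (hv : 0 ≤ v) (hζ₀ : 0 ≤ ζ)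
    (hζ₁ : ζ ≤ v) (hσ : σ = none → ζ = v ∨ 2 * ζ ≤ v) (hτ : 0 ≤ τ) :
    M.netStep B C sym β (Sum.elim (stateVec χ v ζ v σ fun k => v * frac B (S k)) τ) =
      Sum.elim (stateVec (fun i => σ.elim 0 fun q => if M.channel q i then v else 0)
        (B ^ 5 * v + max (β - C * v) 0)
        (B ^ 5 * min (B ^ 5 * ζ) v + ∑ j, if (sym j).2 then τ j else 0) (B ^ 5 * v)
        (M.nextControl v ζ σ S) fun k => B ^ 5 * v * frac B (M.nextStacks σ S k) +
          if M.input = k then ∑ j, blockValue B (sym j) * τ j else 0)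
        fun i => (if i.val = 0 then max (β - C * v) 0 else 0) +
          ∑ j, if i.val = j.val + 1 then τ j else 0 := by
  have hload (b : Block Γ) : 0 ≤ blockLoad sym τ b :=
    Finset.sum_nonneg fun j _ => ite_nonneg (hτ j) le_rfl
  have hlaunch : 0 ≤ if σ = none ∧ ζ = v then v else 0 := ite_nonneg hv le_rfl
  funext i
  rw [netStep, intLayer_tapeReadMatrix sym β χ hv hζ₀ hζ₁ hσ
    (fun k => mul_nonneg hv (frac_nonneg hB _)) hτ, intLayer_copyMatrix hτ,
    intLayer_matchMatrix hB hv hζ₀ hload, intLayer_copyMatrix hτ,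
    intLayer_actMatrix hB hv (le_min (by positivity) hv) hlaunch (le_max_right _ _) hload,
    evalForm_sumElim]
  rcases i with i | i
  · rw [Sum.elim_inl, ← evalForm_outMatrix sym τ]
    exact (congrArg _ (map_zero (evalForm τ))).trans (add_zero _)
  · simp only [Sum.elim_inr, evalForm_apply, tapeOutMatrix, Function.comp_def,
      Matrix.fromBlocks_apply₂₁, Matrix.fromBlocks_apply₂₂, Matrix.of_apply, Int.cast_ite,
      Int.cast_one, Int.cast_zero, ite_mul, one_mul, zero_mul, ite_and]
    by_cases hi : i.val = 0 <;> simp [hi, actVec]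

end Tape

section Run

variable {Q K Γ : Type}

/-- The number of blocks of an input. -/
def tapeLen (l : List Γ) : ℕ := l.length / 5 + 1

/-- The blocks of an input. -/
def tapeBlock (l : List Γ) (i : Fin (tapeLen l)) : Block Γ :=
  (fun j => l[5 * i.val + j.val]?, decide (i.val + 1 = tapeLen l))

/-- The tape on which only the cell `i` is active. -/
def activeCell {m : ℕ} (i : ℕ) (j : Fin m) : ℝ := if j.val = i then 1 else 0

lemma activeCell_nonneg {m i : ℕ} : 0 ≤ (activeCell i : Fin m → ℝ) :=
  fun _ => ite_nonneg zero_le_one le_rfl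

lemma sum_activeCell {m i : ℕ} (hi : i < m) (F : Fin m → ℝ → ℝ) (hF : ∀ j, F j 0 = 0) :
    ∑ j, F j (activeCell i j) = F ⟨i, hi⟩ 1 := by
  rw [Finset.sum_eq_single_of_mem ⟨i, hi⟩ (Finset.mem_univ _)]
  · rw [activeCell, if_pos rfl]
  · intro j _ hj
    rw [activeCell, if_neg fun h => hj (Fin.ext h), hF]

variable [DecidableEq K] (M : StackMachine Q K Γ)

/-- The stacks of a machine whose input stack holds `l`. -/
def inputStacks (l : List Γ) : K → List Γ := Function.update (fun _ => []) M.input l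

variable [Fintype Q] [Fintype K] [Fintype Γ] [DecidableEq Q] [DecidableEq Γ] (B C : ℕ) (ε : ℝ)

/-- The states of the network on an input. -/
noncomputable def netState (l : List Γ) : ℕ → StateIx Q K ⊕ Fin (tapeLen l) → ℝ :=
  intState ε (tapeReadMatrix B C (tapeBlock l)) (tapeBias Q K Γ _)
    (copyMatrix _ (M.matchMatrix B)) (copyMatrix _ (M.actMatrix B)) (M.tapeOutMatrix B _)

/-- The network state with unit `(B ^ 5) ^ t`, channels `χ`, clock `ζ`, control state `σ`, stacks
`S` and tape `τ`. -/
noncomputable def codedState {m : ℕ} (t : ℕ) (χ : Fin 3 → ℝ) (ζ : ℝ) (σ : Option Q)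
    (S : K → List Γ) (τ : Fin m → ℝ) : StateIx Q K ⊕ Fin m → ℝ :=
  Sum.elim (stateVec χ ((B ^ 5) ^ t) ζ ((B ^ 5) ^ t) σ fun k => (B ^ 5) ^ t * frac B (S k)) τ

lemma netState_succ (l : List Γ) (t : ℕ) :
    M.netState B C ε l (t + 1) =
      M.netStep B C (tapeBlock l) (ε ^ t)⁻¹ (M.netState B C ε l t) := rfl

variable {M B C ε} {l : List Γ}

lemma netState_one (hB : 2 * Fintype.card Γ + 2 ≤ B) :
    M.netState B C ε l 1 = codedState B 0 0 0 none (fun _ => ([] : List Γ)) (activeCell 0) := by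
  have hzero : M.netState B C ε l 0 =
      Sum.elim (stateVec 0 0 0 0 none fun k => 0 * frac B ((fun _ => []) k : List Γ)) 0 := by
    funext i
    rcases i with (_ | _ | _ | _ | _) | _ <;> simp [netState, intState, stateVec]
  rw [netState_succ, hzero, netStep_stateVec M hB _ _ 0 (fun _ => []) le_rfl le_rfl le_rfl
    (fun _ => .inl rfl) le_rfl]
  funext i
  rcases i with (_ | _ | _ | _ | _) | _ <;>
    simp [codedState, stateVec, nextStacks, nextControl, frac, activeCell]

omit [Fintype Q] [Fintype K] [DecidableEq Q] [DecidableEq Γ] in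
lemma mul_frac_inputStacks_take (hB : 2 * Fintype.card Γ + 2 ≤ B) (i : Fin (tapeLen l)) (k : K) :
    ((B : ℝ) ^ 5) ^ (i.val + 1) * frac B (M.inputStacks (l.take (5 * (i.val + 1))) k) =
      B ^ 5 * (B ^ 5) ^ i.val * frac B (M.inputStacks (l.take (5 * i.val)) k) +
        if M.input = k then (blockValue B (tapeBlock l i) : ℝ) else 0 := by
  rcases eq_or_ne M.input k with rfl | hk
  · simp only [inputStacks, Function.update_self, if_true, blockValue, tapeBlock]
    rw [← pow_mul, ← pow_mul, mul_add, mul_one, frac_take_add hB, mul_assoc]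
    push_cast
    rfl
  · simp [inputStacks, Function.update_of_ne hk.symm, hk, frac]

section Iteration

variable {i t j : ℕ} {χ : Fin 3 → ℝ} {ζ : ℝ} {σ : Option Q} {S : K → List Γ}
  (hB : 2 * Fintype.card Γ + 2 ≤ B) (hε : 0 < ε) (hεB : ε⁻¹ ≤ (B : ℝ) ^ 5) (hεC : ε⁻¹ ≤ C)
include hε hεB hεC

omit [Fintype Γ] [DecidableEq Γ] [DecidableEq K] [DecidableEq Q] [Fintype Q] [Fintype K] in
lemma relu_bias_eq_zero (t : ℕ) : max ((ε ^ (t + 1))⁻¹ - C * ((B : ℝ) ^ 5) ^ t) 0 = 0 := by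
  refine max_eq_right (sub_nonpos.2 ?_)
  calc (ε ^ (t + 1))⁻¹ = ε⁻¹ * ε⁻¹ ^ t := by rw [← inv_pow, pow_succ']
    _ ≤ C * ((B : ℝ) ^ 5) ^ t := by gcongr

include hB

lemma netState_add_two {τ : Fin (tapeLen l) → ℝ}
    (h : M.netState B C ε l (t + 1) = codedState B t χ ζ σ S τ) (hζ₀ : 0 ≤ ζ)
    (hζ₁ : ζ ≤ ((B : ℝ) ^ 5) ^ t) (hσ : σ = none → ζ = (B ^ 5) ^ t ∨ 2 * ζ ≤ (B ^ 5) ^ t)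
    (hτ : 0 ≤ τ) :
    M.netState B C ε l (t + 2) =
      Sum.elim (stateVec (fun i => σ.elim 0 fun q => if M.channel q i then (B ^ 5) ^ t else 0)
        ((B ^ 5) ^ (t + 1))
        (B ^ 5 * min (B ^ 5 * ζ) ((B ^ 5) ^ t) + ∑ j, if (tapeBlock l j).2 then τ j else 0)
        ((B ^ 5) ^ (t + 1)) (M.nextControl ((B ^ 5) ^ t) ζ σ S) fun k =>
          (B ^ 5) ^ (t + 1) * frac B (M.nextStacks σ S k) +
            if M.input = k then ∑ j, blockValue B (tapeBlock l j) * τ j else 0)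
        fun i => ∑ j, if i.val = j.val + 1 then τ j else 0 := by
  rw [netState_succ, h, codedState,
    netStep_stateVec M hB _ _ _ _ (by positivity) hζ₀ hζ₁ hσ hτ, relu_bias_eq_zero hε hεB hεC]
  simp only [add_zero, ite_self, zero_add, ← pow_succ']

lemma netState_add_two_of_empty_tape
    (h : M.netState B C ε l (t + 1) = codedState B t χ ζ σ S 0) (hζ₀ : 0 ≤ ζ)
    (hζ₁ : ζ ≤ ((B : ℝ) ^ 5) ^ t) (hσ : σ = none → ζ = (B ^ 5) ^ t ∨ 2 * ζ ≤ (B ^ 5) ^ t) :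
    M.netState B C ε l (t + 2) =
      codedState B (t + 1) (fun i => σ.elim 0 fun q => if M.channel q i then (B ^ 5) ^ t else 0)
        (B ^ 5 * min (B ^ 5 * ζ) ((B ^ 5) ^ t)) (M.nextControl ((B ^ 5) ^ t) ζ σ S)
        (M.nextStacks σ S) 0 := by
  rw [netState_add_two hB hε hεB hεC h hζ₀ hζ₁ hσ le_rfl]
  simp only [Pi.zero_apply, ite_self, Finset.sum_const_zero, mul_zero, add_zero]
  rfl

lemma netState_load (hi : i ≤ tapeLen l) :
    M.netState B C ε l (i + 1) = codedState B i 0 (if i = tapeLen l then 1 else 0) none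
      (M.inputStacks (l.take (5 * i))) (activeCell i) := by
  induction i with
  | zero =>
    have hstacks : M.inputStacks ([] : List Γ) = fun _ => [] := Function.update_eq_self ..
    have hne : 0 ≠ tapeLen l := (Nat.succ_ne_zero _).symm
    rw [netState_one hB, mul_zero, List.take_zero, hstacks, if_neg hne]
  | succ i ih =>
    have hlt : i < tapeLen l := hi
    have hpos : (0 : ℝ) < (B ^ 5) ^ i := by have := base_pos hB; positivity
    specialize ih hlt.le
    rw [if_neg hlt.ne] at ih
    rw [netState_add_two hB hε hεB hεC ih le_rfl hpos.le (fun _ => .inr (by simp))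
      activeCell_nonneg, codedState]
    congr 1
    · congr 1
      · rw [sum_activeCell hlt (fun j r => if (tapeBlock l j).2 then r else 0) fun _ => ite_self _]
        simp [tapeBlock, hpos.le]
      · simp [nextControl, hpos.ne]
      · funext k
        rw [sum_activeCell hlt (fun j r => blockValue B (tapeBlock l j) * r) fun _ => mul_zero _,
          mul_one, mul_frac_inputStacks_take hB ⟨i, hlt⟩, ← pow_succ']
        rfl
    · funext c
      rw [sum_activeCell hlt (fun j r => if c.val = j.val + 1 then r else 0) fun _ => ite_self _]
      rfl

lemma netState_clock (hj : j ≤ tapeLen l) :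
    M.netState B C ε l (tapeLen l + j + 1) =
      codedState B (tapeLen l + j) 0 ((B ^ 5) ^ (2 * j)) none (M.inputStacks l) 0 := by
  have hB2 : (2 : ℝ) ≤ B ^ 5 := by
    have : (2 : ℝ) ≤ B := by exact_mod_cast (by omega : 2 ≤ B)
    exact this.trans (le_self_pow₀ (by linarith) (by norm_num))
  induction j with
  | zero =>
    have htake : l.take (5 * tapeLen l) = l := List.take_of_length_le (by rw [tapeLen]; omega)
    have htape : (activeCell (tapeLen l) : Fin (tapeLen l) → ℝ) = 0 :=
      funext fun c => if_neg c.isLt.ne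
    rw [add_zero, netState_load hB hε hεB hεC le_rfl, if_pos rfl, htake, htape, mul_zero, pow_zero]
  | succ j ih =>
    have hpos : (0 : ℝ) < (B ^ 5) ^ (2 * j) := by positivity
    have hle : ((B : ℝ) ^ 5) * (B ^ 5) ^ (2 * j) ≤ (B ^ 5) ^ (tapeLen l + j) := by
      rw [← pow_succ']
      exact pow_le_pow_right₀ (by linarith) (by omega)
    have hle₂ : 2 * ((B : ℝ) ^ 5) ^ (2 * j) ≤ (B ^ 5) ^ (tapeLen l + j) :=
      (mul_le_mul_of_nonneg_right hB2 hpos.le).trans hle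
    have hne : ((B : ℝ) ^ 5) ^ (2 * j) ≠ (B ^ 5) ^ (tapeLen l + j) := by linarith
    rw [← add_assoc, netState_add_two_of_empty_tape hB hε hεB hεC (ih (by omega)) hpos.le
      (by linarith) fun _ => .inr hle₂, min_eq_left hle]
    congr 1
    · ring
    · exact if_neg hne

lemma netState_start :
    M.netState B C ε l (2 * tapeLen l + 2) =
      codedState B (2 * tapeLen l + 1) 0 ((B ^ 5) ^ (2 * tapeLen l + 1)) (some M.start)
        (M.inputStacks l) 0 := by
  have hB1 : (1 : ℝ) ≤ B ^ 5 := one_le_pow₀ (by exact_mod_cast (by omega : 1 ≤ B))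
  have h := netState_clock hB hε hεB hεC (M := M) (l := l) le_rfl
  rw [← two_mul] at h
  rw [netState_add_two_of_empty_tape hB hε hεB hεC h (by positivity) le_rfl fun _ => .inl rfl,
    min_eq_right (le_mul_of_one_le_left (by positivity) hB1), ← pow_succ']
  congr 1
  exact if_pos rfl

lemma netState_run (n : ℕ) :
    ∃ χ, M.netState B C ε l (2 * tapeLen l + n + 2) =
      codedState B (2 * tapeLen l + n + 1) χ ((B ^ 5) ^ (2 * tapeLen l + n + 1))
        (some (M.step^[n] (M.start, M.inputStacks l)).1)
        (M.step^[n] (M.start, M.inputStacks l)).2 0 := by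
  have hB1 : (1 : ℝ) ≤ B ^ 5 := one_le_pow₀ (by exact_mod_cast (by omega : 1 ≤ B))
  induction n with
  | zero => exact ⟨0, netState_start hB hε hεB hεC⟩
  | succ n ih =>
    obtain ⟨χ, h⟩ := ih
    have hnext := netState_add_two_of_empty_tape hB hε hεB hεC h (by positivity) le_rfl nofun
    rw [min_eq_right (le_mul_of_one_le_left (by positivity) hB1), ← pow_succ'] at hnext
    simp only [Function.iterate_succ_apply']
    exact ⟨_, hnext⟩

lemma netState_channel_pos_iff (n : ℕ) (i : Fin 3) :
    0 < M.netState B C ε l (2 * tapeLen l + n + 3) (.inl (.channel i)) ↔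
      M.channel (M.step^[n] (M.start, M.inputStacks l)).1 i := by
  have hpos : (0 : ℝ) < (B ^ 5) ^ (2 * tapeLen l + n + 1) := by have := base_pos hB; positivity
  obtain ⟨χ, h⟩ := netState_run hB hε hεB hεC (M := M) (l := l) n
  rw [netState_add_two_of_empty_tape hB hε hεB hεC h hpos.le le_rfl nofun]
  simp only [codedState, Sum.elim_inl, stateVec, Option.elim_some]
  split_ifs with hc <;> simp [hc, hpos]

lemma netState_channel_eq_zero (ht : t ≤ 2 * tapeLen l + 2) (i : Fin 3) :
    M.netState B C ε l t (.inl (.channel i)) = 0 := by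
  rcases t with _ | t
  · rfl
  rcases le_total t (tapeLen l) with hload | hclock
  · rw [netState_load hB hε hεB hεC hload]
    rfl
  obtain ⟨j, rfl⟩ := Nat.exists_eq_add_of_le hclock
  rcases le_or_gt j (tapeLen l) with hj | hj
  · rw [netState_clock hB hε hεB hεC hj]
    rfl
  · rw [show tapeLen l + j + 1 = 2 * tapeLen l + 2 by omega, netState_start hB hε hεB hεC]
    rfl

lemma mem_streamOutput_netState {s : List Bool} (hrun : M.Run (M.start, M.inputStacks l) s) :
    s ∈ streamOutput (fun t => decide (0 < M.netState B C ε l t (.inl (.channel 0))))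
      (fun t => decide (0 < M.netState B C ε l t (.inl (.channel 1))))
      (fun t => decide (0 < M.netState B C ε l t (.inl (.channel 2)))) := by
  have hsilent (i : Fin 3) (t : ℕ) (ht : t < 2 * tapeLen l + 2) :
      decide (0 < M.netState B C ε l (t + 1) (.inl (.channel i))) = false := by
    rw [netState_channel_eq_zero hB hε hεB hεC ht, decide_eq_false_iff_not]
    exact lt_irrefl _
  refine mem_streamOutput_of_silent (2 * tapeLen l + 2) (hsilent 0) (hsilent 1)
    (hrun.mem_streamOutput (χ := fun t i =>
      decide (0 < M.netState B C ε l (t + (2 * tapeLen l + 2)) (.inl (.channel i)))) fun n => ?_)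
  funext i
  rw [show n + 1 + (2 * tapeLen l + 2) = 2 * tapeLen l + n + 3 by omega,
    decide_eq_decide.2 (netState_channel_pos_iff hB hε hεB hεC n i), Bool.decide_coe]

end Iteration

end Run

end StackMachine

section CopyMatrix

variable {I J : Type*} {m : ℕ}

lemma natAbs_copyMatrix_le {A : Matrix I J ℤ} {μ : J → ℕ} (h : ∀ i j, (A i j).natAbs ≤ μ j)
    (i : I ⊕ Fin m) (j : J ⊕ Fin m) : (copyMatrix m A i j).natAbs ≤ Sum.elim μ 1 j := by
  rcases i with i | i <;> rcases j with j | j <;> simp [copyMatrix, h, Matrix.one_apply]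
  split_ifs <;> simp

lemma sum_natAbs_copyMatrix [Fintype I] [Fintype J] (A : Matrix I J ℤ) (μ : I → ℕ) :
    (∑ i, Sum.elim μ 1 i * ∑ j, (copyMatrix m A i j).natAbs) =
      (∑ i, μ i * ∑ j, (A i j).natAbs) + m := by
  simp [Fintype.sum_sum_type, copyMatrix, Matrix.one_apply, apply_ite Int.natAbs]

end CopyMatrix

namespace StackMachine

section Weights

variable {Q K Γ : Type}

/-- The number of copies of a neuron of the first layer. A tape cell costs few parameters because
the neurons that it feeds have a single copy. -/
def readCopies (R : ℕ) : ReadIx Q K Γ → ℕ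
  | .block _ => 1
  | _ => R

variable [DecidableEq Q] [DecidableEq K] [DecidableEq Γ] (M : StackMachine Q K Γ) {B C R m : ℕ}

lemma natAbs_matchMatrix_le (h : ∀ i j, (M.matchMatrix B i j).natAbs ≤ R) (i : MatchIx Q K Γ)
    (j : ReadIx Q K Γ) : (M.matchMatrix B i j).natAbs ≤ readCopies R j := by
  cases j
  case block b =>
    cases i <;> simp [matchMatrix, coord, readCopies, Pi.single_apply]
    split_ifs <;> simp
  all_goals exact h _ _

variable [Fintype Q] [Fintype Γ]

lemma natAbs_tapeReadMatrix_le
    (h : ∀ i j, (readMatrix (Q := Q) (K := K) (Γ := Γ) B C i j).natAbs ≤ R)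
    (sym : Fin m → Block Γ) (i : ReadIx Q K Γ ⊕ Fin m) (j : StateIx Q K ⊕ Fin m) :
    (tapeReadMatrix B C sym i j).natAbs ≤ Sum.elim (fun _ => R) 1 j := by
  rcases i with i | i <;> rcases j with j | j
  · exact h i j
  · simp only [tapeReadMatrix, Matrix.fromBlocks_apply₁₂, Matrix.of_apply, Sum.elim_inr]
    split_ifs <;> simp
  · exact Nat.zero_le _
  · simp only [tapeReadMatrix, Matrix.fromBlocks_apply₂₂, Matrix.one_apply, Sum.elim_inr]
    split_ifs <;> simp

lemma natAbs_tapeOutMatrix_le (hR : 0 < R) (h : ∀ i j, (M.outMatrix B i j).natAbs ≤ R)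
    (i : StateIx Q K ⊕ Fin m) (j : ActIx Q K Γ ⊕ Fin m) :
    (M.tapeOutMatrix B m i j).natAbs ≤ Sum.elim (fun _ => R) 1 j := by
  rcases i with i | i <;> rcases j with j | j
  · exact h i j
  · exact Nat.zero_le _
  · simp only [tapeOutMatrix, Matrix.fromBlocks_apply₂₁, Matrix.of_apply, Sum.elim_inl]
    split_ifs
    exacts [hR, Nat.zero_le _]
  · simp only [tapeOutMatrix, Matrix.fromBlocks_apply₂₂, Matrix.of_apply, Sum.elim_inr]
    split_ifs <;> simp

lemma exists_natAbs_le [Finite K] (B C : ℕ) : ∃ R : ℕ, 0 < R ∧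
    (∀ i j, (readMatrix (Q := Q) (K := K) (Γ := Γ) B C i j).natAbs ≤ R) ∧
    (∀ i j, (M.matchMatrix B i j).natAbs ≤ R) ∧ (∀ i j, (M.actMatrix B i j).natAbs ≤ R) ∧
    ∀ i j, (M.outMatrix B i j).natAbs ≤ R := by
  have := Fintype.ofFinite K
  obtain ⟨R₁, h₁⟩ := Finite.exists_le fun p : ReadIx Q K Γ × StateIx Q K =>
    (readMatrix B C p.1 p.2).natAbs
  obtain ⟨R₂, h₂⟩ := Finite.exists_le fun p : MatchIx Q K Γ × ReadIx Q K Γ =>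
    (M.matchMatrix B p.1 p.2).natAbs
  obtain ⟨R₃, h₃⟩ := Finite.exists_le fun p : ActIx Q K Γ × MatchIx Q K Γ =>
    (M.actMatrix B p.1 p.2).natAbs
  obtain ⟨R₄, h₄⟩ := Finite.exists_le fun p : StateIx Q K × ActIx Q K Γ =>
    (M.outMatrix B p.1 p.2).natAbs
  exact ⟨R₁ + R₂ + R₃ + R₄ + 1, by omega, fun i j => (h₁ (i, j)).trans (by omega),
    fun i j => (h₂ (i, j)).trans (by omega), fun i j => (h₃ (i, j)).trans (by omega),
    fun i j => (h₄ (i, j)).trans (by omega)⟩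

variable [Fintype K]

lemma sum_natAbs_tapeReadMatrix (R : ℕ) (sym : Fin m → Block Γ) :
    (∑ i, Sum.elim (readCopies R) 1 i *
        ∑ j, (tapeReadMatrix (Q := Q) (K := K) B C sym i j).natAbs) =
      (∑ i : ReadIx Q K Γ, readCopies R i * ∑ j, (readMatrix B C i j).natAbs) + 2 * m := by
  have hcells : ∑ i : ReadIx Q K Γ, readCopies R i * ∑ j, (if i = .block (sym j) then 1 else 0) =
      m := by
    simp only [Finset.mul_sum, mul_ite, mul_one, mul_zero]
    rw [Finset.sum_comm]
    simp [readCopies]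
  simp only [Fintype.sum_sum_type, tapeReadMatrix, apply_ite Int.natAbs, Sum.elim_inl, Sum.elim_inr,
    Matrix.fromBlocks_apply₁₁, Matrix.fromBlocks_apply₁₂, Matrix.fromBlocks_apply₂₁,
    Matrix.fromBlocks_apply₂₂, Matrix.of_apply, Matrix.one_apply, Matrix.zero_apply, Pi.one_apply,
    mul_add, Finset.sum_add_distrib, Int.natAbs_one, Int.natAbs_zero, hcells]
  simp
  ring

lemma sum_mul_tapeBias (R m : ℕ) :
    ∑ i, Sum.elim (readCopies R) 1 i * tapeBias Q K Γ m i = R := by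
  simp [tapeBias, Pi.single_apply, readCopies]

lemma sum_natAbs_tapeOutMatrix_le (μ : StateIx Q K → ℕ) :
    (∑ i, Sum.elim μ 1 i * ∑ j, (M.tapeOutMatrix B m i j).natAbs) ≤
      (∑ i, μ i * ∑ j, (M.outMatrix B i j).natAbs) + m + 1 := by
  have hinit : ∑ i : Fin m, ∑ j : ActIx Q K Γ, (if i.val = 0 ∧ j = .init then 1 else 0) ≤ 1 := by
    rcases m with _ | m
    · simp
    · rw [Fin.sum_univ_succ]
      simp
  have hshift : ∑ i : Fin m, ∑ j : Fin m, (if i.val = j.val + 1 then 1 else 0) ≤ m := by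
    have hrow (i : Fin m) : ∑ j : Fin m, (if i.val = j.val + 1 then 1 else 0) ≤ 1 := by
      rw [← Finset.card_filter, Finset.card_le_one]
      intro a ha b hb
      simp only [Finset.mem_filter, Finset.mem_univ, true_and] at ha hb
      exact Fin.ext (by omega)
    exact (Finset.sum_le_sum fun i _ => hrow i).trans (by simp)
  simp only [Fintype.sum_sum_type, tapeOutMatrix, apply_ite Int.natAbs, Sum.elim_inl, Sum.elim_inr,
    Matrix.fromBlocks_apply₁₁, Matrix.fromBlocks_apply₁₂, Matrix.fromBlocks_apply₂₁,
    Matrix.fromBlocks_apply₂₂, Matrix.of_apply, Matrix.zero_apply, Pi.one_apply,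
    mul_add, Finset.sum_add_distrib, Int.natAbs_one, Int.natAbs_zero, one_mul,
    Finset.sum_const_zero, mul_zero]
  omega

lemma exists_network_of_netState {δ P : ℝ} (hδ : 0 < δ) (hδP : δ ≤ P) (B C : ℕ) :
    ∃ c : ℕ, ∀ l, ∃ N : LNN, N.FixedPrecision δ P ∧
      (∀ t i, 0 < N.state t (Fin.castLE N.three_le i) ↔
        0 < M.netState B C (δ ^ 4) l t (.inl (.channel i))) ∧ N.zeroNorm ≤ l.length + c := by
  obtain ⟨R, hR, hread, hmatch, hact, hout⟩ := M.exists_natAbs_le B C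
  refine ⟨(∑ i : ReadIx Q K Γ, readCopies R i * ∑ j, (readMatrix B C i j).natAbs) + R +
    (∑ i, R * ∑ j, (M.matchMatrix B i j).natAbs) + (∑ i, R * ∑ j, (M.actMatrix B i j).natAbs) +
    (∑ i, R * ∑ j, (M.outMatrix B i j).natAbs) + 6, fun l => ?_⟩
  have hbias (i) : tapeBias Q K Γ (tapeLen l) i ≤ 1 := by
    rcases i with i | _
    · rw [tapeBias, Sum.elim_inl, Pi.single_apply]
      split_ifs <;> simp
    · exact Nat.zero_le _
  obtain ⟨N, hN, hstate, hnorm⟩ := exists_network_of_int hδ hδP hbias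
    (natAbs_tapeReadMatrix_le hread (tapeBlock l))
    (natAbs_copyMatrix_le (M.natAbs_matchMatrix_le hmatch)) (natAbs_copyMatrix_le hact)
    (M.natAbs_tapeOutMatrix_le hR hout) (f := fun i => .inl (.channel i))
    (fun i j h => by simpa using h) fun _ => hR
  refine ⟨N, hN, hstate, ?_⟩
  rw [sum_natAbs_tapeReadMatrix, sum_natAbs_copyMatrix, sum_natAbs_copyMatrix,
    sum_mul_tapeBias] at hnorm
  have hlast := M.sum_natAbs_tapeOutMatrix_le (B := B) (m := tapeLen l) fun _ => R
  have hlen : 5 * tapeLen l ≤ l.length + 5 := by rw [tapeLen]; omega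
  omega

end Weights

lemma exists_network_of_run {Q K Γ : Type} [Finite Q] [Finite K] [Finite Γ] [DecidableEq K]
    (M : StackMachine Q K Γ) {δ P : ℝ} (hδ : 0 < δ) (hδP : δ ≤ P) :
    ∃ c : ℕ, ∀ l s, M.Run (M.start, M.inputStacks l) s →
      ∃ N : LNN, N.FixedPrecision δ P ∧ N.Outputs s ∧ N.zeroNorm ≤ l.length + c := by
  classical
  have := Fintype.ofFinite Q
  have := Fintype.ofFinite K
  have := Fintype.ofFinite Γ
  obtain ⟨C, hC⟩ := exists_nat_ge (δ ^ 4)⁻¹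
  have hB : (δ ^ 4)⁻¹ ≤ ((2 * Fintype.card Γ + 2 + C : ℕ) : ℝ) ^ 5 := by
    refine hC.trans ?_
    exact_mod_cast (Nat.le_add_left C _).trans (Nat.le_self_pow (by norm_num) _)
  obtain ⟨c, hc⟩ := M.exists_network_of_netState hδ hδP (2 * Fintype.card Γ + 2 + C) C
  refine ⟨c, fun l s hrun => ?_⟩
  obtain ⟨N, hN, hstate, hnorm⟩ := hc l
  refine ⟨N, hN, LNN.outputs_iff_mem_streamOutput.2 ?_, hnorm⟩
  convert mem_streamOutput_netState (Nat.le_add_right _ C) (by positivity) hB hC hrun using 3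
  exacts [decide_eq_decide.2 (hstate _ 0), decide_eq_decide.2 (hstate _ 1),
    decide_eq_decide.2 (hstate _ 2)]

end StackMachine

/-! ### Stack machines for partial recursive functions -/

namespace StackMachine

variable {Q K Γ : Type}

/-- The restriction of a machine to a set of states that is closed under transitions. -/
def restrict (M : StackMachine Q K Γ) (P : Set Q) (hstart : M.start ∈ P)
    (hnext : ∀ q ∈ P, ∀ o, M.next q o ∈ P) : StackMachine P K Γ where
  start := ⟨M.start, hstart⟩
  input := M.input
  stack q := M.stack q
  next q o := ⟨M.next q o, hnext q q.2 o⟩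
  act q := M.act q
  halts q := M.halts q
  emits q := M.emits q

namespace Run

variable [DecidableEq K] {M : StackMachine Q K Γ} {s : List Bool}

lemma restrict {P : Set Q} {hstart : M.start ∈ P} {hnext : ∀ q ∈ P, ∀ o, M.next q o ∈ P}
    {c : Q × (K → List Γ)} (hrun : M.Run c s) (hc : c.1 ∈ P) :
    (M.restrict P hstart hnext).Run (⟨c.1, hc⟩, c.2) s := by
  induction hrun with
  | halt hhalts => exact .halt hhalts
  | @step c s hhalts _ ih =>
    exact .step (M := M.restrict P hstart hnext) (c := (⟨c.1, hc⟩, c.2)) hhalts (ih _)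

lemma of_keep {q : Q} {S : K → List Γ} (hhalts : M.halts q = false)
    (hact : M.act q (S (M.stack q)).head? = none)
    (hrun : M.Run (M.next q (S (M.stack q)).head?, S) s) :
    M.Run (q, S) ((M.emits q).toList ++ s) := by
  refine .step hhalts ?_
  rwa [StackMachine.step, hact, applyAct, Function.update_eq_self]

lemma of_pop {q : Q} {S : K → List Γ} {a : Γ} {r : List Γ} (hhalts : M.halts q = false)
    (hS : S (M.stack q) = a :: r) (hact : M.act q (some a) = some none)
    (hrun : M.Run (M.next q (some a), Function.update S (M.stack q) r) s) :
    M.Run (q, S) ((M.emits q).toList ++ s) := by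
  refine .step hhalts ?_
  dsimp only [StackMachine.step]
  rwa [hS, List.head?_cons, hact, applyAct, List.tail_cons]

end Run

end StackMachine

section Code

open Turing Turing.PartrecToTM2

instance : Finite K' :=
  Finite.of_surjective (![.main, .rev, .aux, .stack] : Fin 4 → K')
    (by rintro (_ | _ | _ | _); exacts [⟨0, rfl⟩, ⟨1, rfl⟩, ⟨2, rfl⟩, ⟨3, rfl⟩])

/-- The phases in which a machine emits the result of a computation. Since the leading binary
digit is not to be emitted, each bit is held back until the next one has been read. -/
inductive EmitPhase
  | read
  | hold (b : Bool)
  | out (b c : Bool)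
  | done
  deriving Fintype

/-- The tape symbol of a bit. -/
def bitSymbol (b : Bool) : Γ' := bif b then .bit1 else .bit0

/-- The phase after a symbol has been read, where `f` gives the phase after a bit. -/
def EmitPhase.next (f : Bool → EmitPhase) : Option Γ' → EmitPhase
  | some .bit0 => f false
  | some .bit1 => f true
  | _ => .done

lemma EmitPhase.next_bitSymbol (f : Bool → EmitPhase) (b : Bool) :
    EmitPhase.next f (some (bitSymbol b)) = f b := by
  cases b <;> rfl

/-- The statements of the programs to which Mathlib compiles partial recursive functions. -/
abbrev CodeStmt : Type := TM2.Stmt (fun _ : K' => Γ') Λ' (Option Γ')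

/-- The configurations of the programs to which Mathlib compiles partial recursive functions. -/
abbrev CodeCfg : Type := TM2.Cfg (fun _ : K' => Γ') Λ' (Option Γ')

open TM2.Stmt in
/-- The machine that performs the elementary statements of a program one by one, and then emits
the binary digits of the result except for the leading one. -/
def codeMachine (c : ToPartrec.Code) : StackMachine ((CodeStmt × Option Γ') ⊕ EmitPhase) K' Γ' where
  start := .inl (tr (trNormal c .halt), none)
  input := .main
  stack
    | .inl (push k _ _, _) => k
    | .inl (peek k _ _, _) => k
    | .inl (pop k _ _, _) => k
    | _ => .main
  next
    | .inl (push _ _ q, v), _ => .inl (q, v)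
    | .inl (peek _ f q, v), o => .inl (q, f v o)
    | .inl (pop _ f q, v), o => .inl (q, f v o)
    | .inl (load f q, v), _ => .inl (q, f v)
    | .inl (branch f q₁ q₂, v), _ => .inl (bif f v then q₁ else q₂, v)
    | .inl (goto l, v), _ => .inl (tr (l v), v)
    | .inl (.halt, _), _ => .inr .read
    | .inr .read, o => .inr (EmitPhase.next .hold o)
    | .inr (.hold b), o => .inr (EmitPhase.next (.out b) o)
    | .inr (.out _ c), _ => .inr (.hold c)
    | .inr .done, _ => .inr .done
  act
    | .inl (push _ f _, v), _ => some (some (f v))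
    | .inl (pop _ _ _, _), _ => some none
    | .inr .read, _ => some none
    | .inr (.hold _), _ => some none
    | _, _ => none
  halts
    | .inr .done => true
    | _ => false
  emits
    | .inr (.out b _) => some b
    | _ => none

/-- The configuration of `codeMachine` that corresponds to a configuration of a program. -/
def codeCfg : CodeCfg → ((CodeStmt × Option Γ') ⊕ EmitPhase) × (K' → List Γ')
  | ⟨some l, v, S⟩ => (.inl (tr l, v), S)
  | ⟨none, _, S⟩ => (.inr .read, S)

section Run

variable {c : ToPartrec.Code} {s : List Bool}

lemma run_stmt (q : CodeStmt) (v : Option Γ') (S : K' → List Γ')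
    (hrun : (codeMachine c).Run (codeCfg (TM2.stepAux q v S)) s) :
    (codeMachine c).Run (.inl (q, v), S) s := by
  induction q generalizing v S with
  | push k f q ih => exact .step (s := s) rfl (ih v _ hrun)
  | peek k f q ih => exact .of_keep (s := s) rfl rfl (ih _ _ hrun)
  | pop k f q ih => exact .step (s := s) rfl (ih _ _ hrun)
  | load f q ih => exact .of_keep (s := s) rfl rfl (ih _ _ hrun)
  | branch f q₁ q₂ ih₁ ih₂ =>
    refine .of_keep (s := s) rfl rfl ?_
    change (codeMachine c).Run (.inl (bif f v then q₁ else q₂, v), S) s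
    rw [TM2.stepAux] at hrun
    cases hf : f v <;> rw [hf] at hrun
    · exact ih₂ _ _ hrun
    · exact ih₁ _ _ hrun
  | goto l => exact .of_keep (s := s) rfl rfl hrun
  | halt => exact .of_keep (s := s) rfl rfl hrun

lemma run_of_reaches {a b : CodeCfg} (hab : StateTransition.Reaches (TM2.step tr) a b)
    (hb : (codeMachine c).Run (codeCfg b) s) : (codeMachine c).Run (codeCfg a) s := by
  induction hab using Relation.ReflTransGen.head_induction_on with
  | refl => exact hb
  | @head a a' hstep _ ih =>
    rcases a with ⟨_ | l, v, S⟩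
    · cases hstep
    · obtain rfl : TM2.stepAux (tr l) v S = a' := Option.some.inj hstep
      exact run_stmt _ _ _ ih

lemma run_hold {b : Bool} {l : List Bool} {r : List Γ'} {S : K' → List Γ'}
    (hS : S .main = l.map bitSymbol ++ .cons :: r) :
    (codeMachine c).Run (.inr (.hold b), S) (b :: l).dropLast := by
  induction l generalizing b S with
  | nil => exact .of_pop (s := []) rfl hS rfl (.halt rfl)
  | cons a l ih =>
    refine .of_pop (s := b :: (a :: l).dropLast) rfl hS rfl ?_
    simp only [codeMachine, EmitPhase.next_bitSymbol]
    exact .of_keep (M := codeMachine c) rfl rfl (ih (Function.update_self _ _ _))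

lemma run_read {r : List Γ'} {S : K' → List Γ'}
    (hS : S .main = (s ++ [true]).map bitSymbol ++ .cons :: r) :
    (codeMachine c).Run (.inr .read, S) s := by
  obtain ⟨b, l, hbl⟩ := List.exists_cons_of_ne_nil (l := s ++ [true]) (by simp)
  have hs : s = (b :: l).dropLast := by rw [← hbl, List.dropLast_concat]
  rw [hbl] at hS
  rw [hs]
  refine .of_pop (s := (b :: l).dropLast) rfl hS rfl ?_
  simp only [codeMachine, EmitPhase.next_bitSymbol]
  exact run_hold (c := c) (Function.update_self _ _ _)

end Run

lemma exists_finite_states (c : ToPartrec.Code) :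
    ∃ P : Set ((CodeStmt × Option Γ') ⊕ EmitPhase), P.Finite ∧ (codeMachine c).start ∈ P ∧
      ∀ q ∈ P, ∀ o, (codeMachine c).next q o ∈ P := by
  classical
  let : Inhabited Λ' := ⟨trNormal c .halt⟩
  have hsupp := tr_supports c .halt
  set T := TM2.stmts tr (codeSupp c .halt)
  have htr {l : Λ'} (hl : l ∈ codeSupp c .halt) : some (tr l) ∈ T :=
    Finset.some_mem_insertNone.2 (Finset.mem_biUnion.2 ⟨l, hl, TM2.stmts₁_self⟩)
  have hsub {q q' : CodeStmt} (hq : some q ∈ T) (hq' : q' ∈ TM2.stmts₁ q) : some q' ∈ T :=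
    TM2.stmts_trans hq' hq
  refine ⟨{x | x.elim (fun y => some y.1 ∈ T) fun _ => True}, ?_, ?_, ?_⟩
  · refine (((T.eraseNone ×ˢ Finset.univ).finite_toSet.image Sum.inl).union
      (Set.finite_range Sum.inr)).subset ?_
    rintro (⟨q, v⟩ | e) hx
    · exact Or.inl ⟨(q, v), by simpa using hx, rfl⟩
    · exact Or.inr ⟨e, rfl⟩
  · exact htr hsupp.1
  · rintro (⟨q, v⟩ | e) hx o
    · cases q with
      | push | peek | pop | load => exact hsub hx (by simp [TM2.stmts₁, TM2.stmts₁_self])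
      | branch f =>
        refine hsub hx ?_
        cases f v <;> simp [TM2.stmts₁, TM2.stmts₁_self]
      | goto => exact htr (TM2.stmts_supportsStmt hsupp hx v)
      | halt => trivial
    · cases e <;> trivial

/-- The number whose binary digits are the given bits, least significant first, below a leading
digit `1`. This is how strings are passed to partial recursive functions on numbers. -/
def binary (l : List Bool) : ℕ := l.foldr (fun b n => n.bit b) 1

lemma trNat_bit {n : ℕ} (hn : n ≠ 0) (b : Bool) : trNat (n.bit b) = bitSymbol b :: trNat n := by
  rw [trNat, trNat, ← Num.ofNat'_eq, Num.ofNat'_bit, Num.ofNat'_eq]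
  rcases hnum : (n : Num) with _ | p
  · exact absurd (Num.of_nat_inj.1 (hnum.trans Nat.cast_zero.symm)) hn
  · cases b <;> rfl

lemma binary_ne_zero (l : List Bool) : binary l ≠ 0 := by
  induction l with
  | nil => exact one_ne_zero
  | cons b l ih => exact Nat.bit_ne_zero b ih

lemma trNat_binary (l : List Bool) : trNat (binary l) = (l ++ [true]).map bitSymbol := by
  induction l with
  | nil => rfl
  | cons b l ih => exact (trNat_bit (binary_ne_zero l) b).trans (congrArg (bitSymbol b :: ·) ih)

lemma binary_injective : Function.Injective binary := by
  intro l l' h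
  have hsymbols := congrArg trNat h
  rw [trNat_binary, trNat_binary] at hsymbols
  have hinj : Function.Injective bitSymbol := by decide
  exact List.append_cancel_right (hinj.list_map hsymbols)

lemma computable_binary : Computable binary :=
  (Primrec.list_foldr Primrec.id (Primrec.const 1) (Primrec.cond (Primrec.fst.comp Primrec.snd)
    (Primrec.nat_double_succ.comp (Primrec.snd.comp Primrec.snd))
    (Primrec.nat_double.comp (Primrec.snd.comp Primrec.snd))).to₂).to_comp

lemma run_code {c : ToPartrec.Code} {w s : List Bool}
    (hc : c.eval [binary w] = pure [binary s]) :
    (codeMachine c).Run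
      ((codeMachine c).start, (codeMachine c).inputStacks (trList [binary w])) s := by
  have hmem : halt [binary s] ∈ StateTransition.eval (TM2.step tr) (init c [binary w]) := by
    rw [tr_eval, hc]
    exact Part.mem_map _ (Part.mem_some _)
  have hinput : (codeMachine c).inputStacks (trList [binary w]) =
      K'.elim (trList [binary w]) [] [] [] := by
    funext k
    cases k <;> rfl
  rw [hinput]
  refine run_of_reaches (StateTransition.mem_eval.1 hmem).1 (run_read (r := []) ?_)
  rw [K'.elim_main, trList, trNat_binary, trList]

lemma exists_code {U : List Bool →. List Bool} (hU : Partrec U) :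
    ∃ c : ToPartrec.Code, ∀ w s, s ∈ U w → c.eval [binary w] = pure [binary s] := by
  obtain ⟨g, hg, hinv⟩ := exists_partrec_inverse computable_binary binary_injective
  have hpartrec : Partrec fun n => ((g n).bind U).map binary :=
    (hg.bind (hU.comp Computable.snd).to₂).map (computable_binary.comp Computable.snd).to₂
  obtain ⟨c, hc⟩ := ToPartrec.Code.exists_code (Nat.Partrec'.part_iff₁.2 hpartrec)
  refine ⟨c, fun w s hs => (hc ⟨[binary w], rfl⟩).trans ?_⟩
  have hval : ((g (binary w)).bind U).map binary = Part.some (binary s) :=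
    Part.eq_some_iff.2 (Part.mem_map _ (Part.mem_bind ((hinv _ _).2 rfl) hs))
  change _ <$> ((g (binary w)).bind U).map binary = _
  rw [hval, Part.map_eq_map, Part.map_some]
  rfl

lemma IsUniversal.exists_network {U : List Bool →. List Bool} (hU : IsUniversal U) {δ M : ℝ}
    (hδ : 0 < δ) (hδM : δ ≤ M) : ∃ c : ℕ, ∀ s, ∃ N : LNN, N.FixedPrecision δ M ∧ N.Outputs s ∧
      N.zeroNorm ≤ kolmogorov U s + c := by
  obtain ⟨c, hc⟩ := exists_code hU.isPrefixMachine.partrec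
  obtain ⟨P, hP, hstart, hnext⟩ := exists_finite_states c
  have : Finite P := hP
  obtain ⟨k, hk⟩ := ((codeMachine c).restrict P hstart hnext).exists_network_of_run hδ hδM
  refine ⟨k + 2, fun s => ?_⟩
  obtain ⟨w, hw, hlen⟩ := hU.exists_length_eq_kolmogorov s
  obtain ⟨N, hN, hout, hnorm⟩ := hk _ s ((run_code (hc w s hw)).restrict hstart)
  refine ⟨N, hN, hout, hnorm.trans_eq ?_⟩
  rw [← hlen, trList, trNat_binary, trList, List.length_append, List.length_map,
    List.length_append, List.length_singleton, List.length_singleton]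
  omega

end Code

/-! ### Norms -/

lemma FFNet.eval_eq_zero {m k : ℕ} (F : FFNet m k) (hF : ∀ a ∈ F.params, a = 0)
    (x : Fin m → ℝ) : F.eval x = 0 := by
  induction F with
  | last W b =>
    obtain ⟨hW, hb⟩ := forall_mem_layerParams.1 hF
    obtain rfl : W = 0 := Matrix.ext hW
    obtain rfl : b = 0 := funext hb
    rw [FFNet.eval, Matrix.zero_mulVec, add_zero]
  | cons W b rest ih => exact ih (fun a ha => hF a (List.mem_append_right _ ha)) _

namespace LNN

lemma Outputs.one_le_zeroNorm {N : LNN} {s : List Bool} (hN : N.Outputs s) : 1 ≤ N.zeroNorm := by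
  classical
  obtain ⟨t, ht, _⟩ := hN
  refine List.countP_pos_iff.2 ?_
  by_contra! hzero
  rw [state, FFNet.eval_eq_zero _ fun a ha => by simpa using hzero a ha] at ht
  exact lt_irrefl _ ht

lemma sum_rpow_params_nonneg (N : LNN) (p : ℝ) :
    0 ≤ (N.block.params.map fun a => |a| ^ p).sum :=
  List.sum_nonneg <| List.forall_mem_map.2 fun _ _ => Real.rpow_nonneg (abs_nonneg _) p

lemma lpNorm_nonneg (N : LNN) (p : ℝ) : 0 ≤ N.lpNorm p :=
  Real.rpow_nonneg (N.sum_rpow_params_nonneg p) _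

lemma lpNorm_rpow (N : LNN) {p : ℝ} (hp : p ≠ 0) :
    N.lpNorm p ^ p = (N.block.params.map fun a => |a| ^ p).sum := by
  rw [lpNorm, one_div, Real.rpow_inv_rpow (N.sum_rpow_params_nonneg p) hp]

end LNN

lemma le_abs_int_mul {δ : ℝ} (hδ : 0 ≤ δ) {z : ℤ} (hz : z ≠ 0) : δ ≤ |δ * z| := by
  rw [abs_mul, abs_of_nonneg hδ]
  exact le_mul_of_one_le_right hδ (by exact_mod_cast Int.one_le_abs hz)

section Bounds

variable {δ M p : ℝ}

lemma sum_rpow_mem_Icc {l : List ℝ} (hδ : 0 ≤ δ) (hp : 0 < p)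
    (hl : ∀ a ∈ l, a ≠ 0 → δ ≤ |a| ∧ |a| ≤ M) [DecidablePred fun a : ℝ => a ≠ 0] :
    (l.map fun a => |a| ^ p).sum ∈
      Set.Icc (δ ^ p * l.countP fun a => a ≠ 0) (M ^ p * l.countP fun a => a ≠ 0) := by
  induction l with
  | nil => simp
  | cons a l ih =>
    obtain ⟨hlower, hupper⟩ := ih fun b hb => hl b (List.mem_cons_of_mem _ hb)
    rw [List.map_cons, List.sum_cons, List.countP_cons]
    by_cases ha : a = 0
    · simpa [ha, Real.zero_rpow hp.ne'] using And.intro hlower hupper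
    · obtain ⟨hδa, haM⟩ := hl a List.mem_cons_self ha
      have hδp : δ ^ p ≤ |a| ^ p := Real.rpow_le_rpow hδ hδa hp.le
      have hMp : |a| ^ p ≤ M ^ p := Real.rpow_le_rpow (abs_nonneg a) haM hp.le
      rw [if_pos (decide_eq_true ha), Nat.cast_add, Nat.cast_one, mul_add_one, mul_add_one]
      constructor <;> linarith

namespace LNN

lemma FixedPrecision.lpNorm_rpow_mem_Icc {N : LNN} (hN : N.FixedPrecision δ M) (hδ : 0 ≤ δ)
    (hp : 0 < p) : N.lpNorm p ^ p ∈ Set.Icc (δ ^ p * N.zeroNorm) (M ^ p * N.zeroNorm) := by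
  classical
  rw [N.lpNorm_rpow hp.ne']
  refine sum_rpow_mem_Icc hδ hp fun a ha ha₀ => ?_
  obtain ⟨⟨z, rfl⟩, haM⟩ := hN a ha
  exact ⟨le_abs_int_mul hδ (by rintro rfl; simp at ha₀), haM⟩

end LNN

variable {N : LNN} {s : List Bool}

lemma minLpNorm_le (hN : N.FixedPrecision δ M) (hs : N.Outputs s) :
    minLpNorm δ M p s ≤ ENNReal.ofReal (N.lpNorm p) :=
  iInf_le_of_le N (iInf₂_le hN hs)

lemma toReal_minLpNorm_rpow_le (hδ : 0 ≤ δ) (hp : 0 < p) (hN : N.FixedPrecision δ M)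
    (hs : N.Outputs s) : (minLpNorm δ M p s).toReal ^ p ≤ M ^ p * N.zeroNorm :=
  (Real.rpow_le_rpow ENNReal.toReal_nonneg
    (ENNReal.toReal_le_of_le_ofReal (N.lpNorm_nonneg p) (minLpNorm_le hN hs)) hp.le).trans
    (hN.lpNorm_rpow_mem_Icc hδ hp).2

lemma le_toReal_minLpNorm_rpow (hδ : 0 ≤ δ) (hp : 0 < p) (htop : minLpNorm δ M p s ≠ ⊤) {k : ℕ}
    (hk : ∀ N : LNN, N.FixedPrecision δ M → N.Outputs s → k ≤ N.zeroNorm) :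
    δ ^ p * k ≤ (minLpNorm δ M p s).toReal ^ p := by
  rw [← Real.rpow_inv_le_iff_of_pos (by positivity) ENNReal.toReal_nonneg hp,
    ← ENNReal.ofReal_le_iff_le_toReal htop]
  refine le_iInf fun N => le_iInf₂ fun hN hs => ENNReal.ofReal_le_ofReal ?_
  rw [Real.rpow_inv_le_iff_of_pos (by positivity) (N.lpNorm_nonneg p) hp]
  exact (mul_le_mul_of_nonneg_left (Nat.cast_le.2 (hk N hN hs)) (by positivity)).trans
    (hN.lpNorm_rpow_mem_Icc hδ hp).1

lemma exists_zeroNorm_le_toReal_minLpNorm_rpow (hδ : 0 < δ) (hp : 0 < p)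
    (hN : N.FixedPrecision δ M) (hs : N.Outputs s) :
    ∃ N₀ : LNN, N₀.FixedPrecision δ M ∧ N₀.Outputs s ∧
      N₀.zeroNorm ≤ (minLpNorm δ M p s).toReal ^ p / δ ^ p := by
  have htop : minLpNorm δ M p s ≠ ⊤ :=
    ne_top_of_le_ne_top ENNReal.ofReal_ne_top (minLpNorm_le hN hs)
  obtain ⟨N₀, ⟨hN₀, hs₀⟩, hmin⟩ := exists_minimalFor_of_wellFoundedLT
    (fun N : LNN => N.FixedPrecision δ M ∧ N.Outputs s) LNN.zeroNorm ⟨N, hN, hs⟩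
  refine ⟨N₀, hN₀, hs₀, ?_⟩
  rw [le_div_iff₀' (Real.rpow_pos_of_pos hδ p)]
  exact le_toReal_minLpNorm_rpow hδ.le hp htop fun N hN hs =>
    (le_total _ _).elim id (hmin ⟨hN, hs⟩)

end Bounds

lemma IsUniversal.exists_kolmogorov_le_minLpNorm {U : List Bool →. List Bool} (hU : IsUniversal U)
    {δ : ℝ} (hδ : 0 < δ) (M : ℝ) :
    ∃ C, 0 ≤ C ∧ (IsComputableReal δ → ∀ p, 0 < p → ∀ N : LNN, ∀ s,
      N.FixedPrecision δ M → N.Outputs s →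
      (kolmogorov U s : ℝ) ≤ C / δ ^ p * (minLpNorm δ M p s).toReal ^ p *
        Real.logb 2 ((minLpNorm δ M p s).toReal ^ p / δ ^ p) + C) := by
  by_cases hδc : IsComputableReal δ
  swap
  · exact ⟨0, le_rfl, fun h => absurd h hδc⟩
  obtain ⟨C, hC, hbound⟩ := hU.exists_kolmogorov_le_zeroNorm hδ hδc M
  refine ⟨C, hC, fun _ p hp N s hN hs => ?_⟩
  obtain ⟨N₀, hN₀, hs₀, hle⟩ := exists_zeroNorm_le_toReal_minLpNorm_rpow hδ hp hN hs
  set X : ℝ := (minLpNorm δ M p s).toReal ^ p / δ ^ p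
  have hpos : (1 : ℝ) ≤ N₀.zeroNorm := by exact_mod_cast hs₀.one_le_zeroNorm
  have hlog : 0 ≤ Real.logb 2 N₀.zeroNorm := Real.logb_nonneg one_lt_two hpos
  calc (kolmogorov U s : ℝ) ≤ C * (N₀.zeroNorm * Real.logb 2 N₀.zeroNorm) + C :=
        hbound N₀ s hN₀ hs₀ hs₀.one_le_zeroNorm
    _ ≤ C * (X * Real.logb 2 X) + C := by gcongr; norm_num
    _ = C / δ ^ p * (minLpNorm δ M p s).toReal ^ p * Real.logb 2 X + C := by
        simp only [X]; ring

end LoopedNet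

theorem mainTheorem4_general (U : List Bool →. List Bool) (hU : LoopedNet.IsUniversal U)
    (δ M : ℝ) (hδ : 0 < δ) (hδM : δ ≤ M) :
    ∃ c_U c_d : ℝ, 0 ≤ c_U ∧ 0 ≤ c_d ∧ ∀ p : ℝ, 0 < p →
      (∀ N : LoopedNet.LNN, N.FixedPrecision δ M →
        δ ^ p * (N.zeroNorm : ℝ) ≤ N.lpNorm p ^ p ∧
          N.lpNorm p ^ p ≤ M ^ p * (N.zeroNorm : ℝ)) ∧
      ∀ s : List Bool,
        LoopedNet.minLpNorm δ M p s ≠ ⊤ ∧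
        (LoopedNet.minLpNorm δ M p s).toReal ^ p
          ≤ M ^ p * ((LoopedNet.kolmogorov U s : ℝ) + c_U) ∧
        (LoopedNet.IsComputableReal δ →
          (LoopedNet.kolmogorov U s : ℝ)
            ≤ c_d / δ ^ p * (LoopedNet.minLpNorm δ M p s).toReal ^ p
                * Real.logb 2 ((LoopedNet.minLpNorm δ M p s).toReal ^ p / δ ^ p) + c_d) := by
  obtain ⟨c, hupper⟩ := hU.exists_network hδ hδM
  obtain ⟨C, hC, hlower⟩ := hU.exists_kolmogorov_le_minLpNorm hδ M
  refine ⟨c, C, c.cast_nonneg, hC, fun p hp =>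
    ⟨fun N hN => hN.lpNorm_rpow_mem_Icc hδ.le hp, fun s => ?_⟩⟩
  obtain ⟨N, hN, hs, hnorm⟩ := hupper s
  refine ⟨ne_top_of_le_ne_top ENNReal.ofReal_ne_top (LoopedNet.minLpNorm_le hN hs), ?_,
    fun hδc => hlower hδc p hp N s hN hs⟩
  refine (LoopedNet.toReal_minLpNorm_rpow_le hδ.le hp hN hs).trans ?_
  have hM : 0 ≤ M ^ p := Real.rpow_nonneg (hδ.le.trans hδM) p
  exact mul_le_mul_of_nonneg_left (by exact_mod_cast hnorm) hM

theorem mainTheorem4 (U : List Bool →. List Bool) (hU : LoopedNet.IsUniversal U)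
    (δ M : ℝ) (hδ : 0 < δ) (hδM : δ ≤ M) :
    ∃ c_U c_d : ℝ, 0 ≤ c_U ∧ 0 ≤ c_d ∧ ∀ p : ℝ, 1 ≤ p →
      (∀ N : LoopedNet.LNN, N.FixedPrecision δ M →
        δ ^ p * (N.zeroNorm : ℝ) ≤ N.lpNorm p ^ p ∧
          N.lpNorm p ^ p ≤ M ^ p * (N.zeroNorm : ℝ)) ∧
      ∀ s : List Bool,
        LoopedNet.minLpNorm δ M p s ≠ ⊤ ∧
        (LoopedNet.minLpNorm δ M p s).toReal ^ p
          ≤ M ^ p * ((LoopedNet.kolmogorov U s : ℝ) + c_U) ∧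
        (LoopedNet.IsComputableReal δ →
          (LoopedNet.kolmogorov U s : ℝ)
            ≤ c_d / δ ^ p * (LoopedNet.minLpNorm δ M p s).toReal ^ p
                * Real.logb 2 ((LoopedNet.minLpNorm δ M p s).toReal ^ p / δ ^ p) + c_d) := by
  obtain ⟨c_U, c_d, hU₀, hd₀, h⟩ := mainTheorem4_general U hU δ M hδ hδM
  exact ⟨c_U, c_d, hU₀, hd₀, fun p hp => h p (zero_lt_one.trans_le hp)⟩
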